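/- **Setting.** Let $E=(E^0,E^1,s,r)$ be a finite directed graph without sinks and without sources, $A=c(E^0)$ the functions on $E^0$, and $E^k$ the set of paths $\alpha=e_1\cdots e_k$ of length $|\alpha|=k$ ($s(e_j)=r(e_{j+1})$, $s(\alpha)=s(e_k)$, $r(\alpha)=r(e_1)$; $E^0$ is the set of paths of length $0$). Let $X_E^{\otimes k}$ be the space of functions on $E^k$ (with basis $\{\delta_\alpha\}$), a $C^*$-correspondence over $A$ with $(a\xi b)(\alpha)=a(r(\alpha))\xi(\alpha)b(s(\alpha))$ and $\langle\xi,\eta\rangle(v)=\sum_{s(\alpha)=v}\overline{\xi(\alpha)}\eta(\alpha)$, so that $\delta_\alpha\otimes\delta_\beta=\delta_{\alpha\beta}$ if $s(\alpha)=r(\beta)$, and $0$ otherwise. Let $\mathcal F=\bigoplus_{k\ge 0}X_E^{\otimes k}$ be the Fock correspondence, $Q_k$ the projection onto the $k$-th summand, $\mathcal L$ the algebra of adjointable operators on $\mathcal F$, $\mathcal K$ the ideal of compact operators (the closed span of the operators $\theta_{\xi,\eta}\zeta=\xi\langle\eta,\zeta\rangle$) and $q:\mathcal L\to\mathcal L/\mathcal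 K$ the quotient map. For $e\in E^1$ put $S_e\xi=\delta_e\otimes\xi$, and let $P_v$ be the left action of $\delta_v$ on $\mathcal F$. Let $Z=(Z_k)_{k\ge 0}$ be a weight sequence: $Z_k\in\mathcal L(X_E^{\otimes k})$ commutes with the left action of $A$, $Z_0=I$, $\sup_k\|Z_k\|<\infty$, each $Z_k$ is positive and invertible, and there is $\varepsilon>0$ with $Z_k\ge\varepsilon I$ for all $k\ge1$. Write also $Z=\mathrm{diag}(Z_0,Z_1,\dots)\in\mathcal L$. Let $p\ge 1$ and assume Condition A($p$): $\lim_{k\to\infty}\|I_p\otimes Z_k-Z_{k+p}\|=0$, where $I_p$ is the identity of $X_E^{\otimes p}$. Let $\mathcal T$ be the $C^*$-algebra generated by $\{ZS_e:e\in E^1\}$, let $\gamma_t=\mathrm{Ad}\big(\sum_n e^{int}Q_n\big)$, and put $$\mathcal D=\{X\in\mathcal T:\gamma_t(X)=X\ \forall t\in\mathbb R\},\qquad F=\{X\in\mathcal T:\gamma_t(X)=e^{it}X\ \forall t\in\mathbb R\}.$$ Write $z=q(Z)$, $u_e=q(S_e)$, $u_\alpha=u_{e_1}\cdots u_{e_k}$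 for a path $\alpha=e_1\cdots e_k$ with $k\ge1$, and $u_v=q(P_v)$ for a path $v\in E^0$ of length $0$. For $n\ge0$ let $\mathcal C_n$ be the $C^*$-algebra generated by all $u_\alpha z^l u_\beta^*$ with $l\ge0$, $np\le|\alpha|=|\beta|<(n+1)p$ and $s(\alpha)=s(\beta)$. For every $v\in E^0$ fix a path $\xi_v$ of length $p-1$ with $s(\xi_v)=v$. Let $J$ be a closed two-sided ideal of $q(\mathcal D)$ and $J_n=J\cap\mathcal C_n$. For $n\ge0$ and $v\in E^0$ let $$J_{n,v}=u_{\xi_v}u_{\mu_1}^*J_nu_{\mu_2}u_{\xi_v}^*,\qquad |\mu_1|=|\mu_2|=np+p-1,\quad s(\mu_1)=s(\mu_2)=v$$ (this set does not depend on the choice of $\mu_1,\mu_2$). The ideal $J$ is called fully invariant if $\overline{\mathrm{span}}\{\eta^*a\xi: a\in J,\ \xi,\eta\in q(F)\}\subseteq J$ and every $a\in q(\mathcal D)$ with $\eta^*a\xi\in J$ for all $\xi,\eta\in q(F)$ lies in $J$. **Theorem.** (A) $J$ is fully invariant if and only if the following three conditions hold: 1. $J_{0,v}=J_{n,v}$ for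 all $v\in E^0$ and $n\ge0$; 2. $u_{\alpha}^*J_0u_{\beta}\subseteq J_0$ for all paths $\alpha,\beta$ with $|\alpha|=|\beta|=p-1$; 3. $u_\alpha J_0u_\beta^*\subseteq J$ for all paths $\alpha,\beta$ with $|\alpha|=|\beta|$. (B) $J$ is fully invariant if and only if the following two conditions hold: 1. $J_{0,v}=J_{n,v}$ for all $v\in E^0$ and $n\ge0$; 2. $u_e^*J_0u_f\subseteq J_0$ for all $e,f\in E^1$. -/

import Mathlib

open scoped ComplexConjugate InnerProductSpace

noncomputable section

/-- A directed graph with vertex set `V`, edge set `Ed`, source map `s` and range map `r`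
(multiple edges and loops are allowed). -/
structure DirGraph (V Ed : Type*) where
  /-- the source map -/
  s : Ed → V
  /-- the range map -/
  r : Ed → V

namespace DirGraph

variable {V Ed : Type*}

/-- No sinks: every vertex is the source of an edge. -/
def NoSinks (G : DirGraph V Ed) : Prop := ∀ v, ∃ e, G.s e = v

/-- No sources: every vertex is the range of an edge. -/
def NoSources (G : DirGraph V Ed) : Prop := ∀ v, ∃ e, G.r e = v

/-- The range of the word `e₁ e₂ ⋯ eₖ` starting at `v`: it is `r e₁`, or `v` for the empty word. -/
def wordRange (G : DirGraph V Ed) (v : V) : List Ed → V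
  | [] => v
  | e :: _ => G.r e

/-- The word `e₁ e₂ ⋯ eₖ` is a path with source `v`: `s eⱼ = r eⱼ₊₁` for `j < k` and `s eₖ = v`. -/
def IsPathWord (G : DirGraph V Ed) (v : V) : List Ed → Prop
  | [] => True
  | e :: l => G.s e = G.wordRange v l ∧ G.IsPathWord v l

/-- The set `E^k` of paths of length `k`; paths of length `0` are the vertices. -/
@[ext]
structure Path (G : DirGraph V Ed) (k : ℕ) where
  /-- the source `s(α)` -/
  source : V
  /-- the edges of `α = e₁ e₂ ⋯ eₖ` -/
  edges : List Ed
  length_eq : edges.length = k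
  isPath : G.IsPathWord source edges

namespace Path

variable {G : DirGraph V Ed} {k : ℕ}

/-- The range `r(α)`. -/
def range (α : G.Path k) : V := G.wordRange α.source α.edges

/-- The path `e₂ ⋯ eₖ₊₁` obtained from `e₁ e₂ ⋯ eₖ₊₁`. -/
def tail (α : G.Path (k + 1)) : G.Path k where
  source := α.source
  edges := α.edges.tail
  length_eq := by simp [α.length_eq]
  isPath := by
    have h := α.isPath
    cases hl : α.edges with
    | nil => trivial
    | cons e l => rw [hl] at h; exact h.2

instance instFinite [Finite V] [Finite Ed] : Finite (G.Path k) := by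
  let f : G.Path k → V × List.Vector Ed k := fun α => (α.source, ⟨α.edges, α.length_eq⟩)
  refine Finite.of_injective f fun α β h => ?_
  have h2 : α.edges = β.edges := congrArg (fun x => x.2.1) h
  exact Path.ext (congrArg Prod.fst h) h2

instance instFintype [Finite V] [Finite Ed] : Fintype (G.Path k) := Fintype.ofFinite _

end Path

variable [Fintype V] [Fintype Ed] (G : DirGraph V Ed)

/-! ### The correspondences `X_E^{⊗k} = X_{E^k}` over `A = c(E^0)` -/

/-- The space `X_{E^k}` of all functions on `E^k`.  Its underlying vector space carries the
`ℓ²`-norm; the `A`-valued inner product is `Xk.innerA`.  For operators commuting with the right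
action of `A` the operator norm for the `ℓ²`-norm is the operator norm for the module norm. -/
abbrev Xk (k : ℕ) : Type _ := EuclideanSpace ℂ (G.Path k)

variable {G}

/-- Multiplication of a function on `E^k` by a fixed function on `E^k`. -/
def Xk.mulOp {k : ℕ} (f : G.Path k → ℂ) : G.Xk k →L[ℂ] G.Xk k :=
  LinearMap.toContinuousLinearMap
    { toFun := fun ξ => WithLp.toLp 2 fun α => f α * ξ α
      map_add' := fun x y => by ext α; simp [mul_add]
      map_smul' := fun c x => by ext α; simp [mul_left_comm] }

variable (G) in
/-- The left action `(φ(a) ξ)(α) = a(r(α)) ξ(α)`. -/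
def Xk.leftAct (k : ℕ) (a : V → ℂ) : G.Xk k →L[ℂ] G.Xk k := Xk.mulOp fun α => a α.range

variable (G) in
/-- The right action `(ξ a)(α) = ξ(α) a(s(α))`. -/
def Xk.rightAct (k : ℕ) (a : V → ℂ) : G.Xk k →L[ℂ] G.Xk k := Xk.mulOp fun α => a α.source

open Classical in
/-- The `A`-valued inner product `⟨ξ, η⟩(v) = ∑_{s(α) = v} conj (ξ(α)) η(α)`. -/
def Xk.innerA {k : ℕ} (ξ η : G.Xk k) (v : V) : ℂ :=
  ∑ α : G.Path k, if α.source = v then conj (ξ α) * η α else 0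

/-- `T` is adjointable for the `A`-valued inner product, that is, `T ∈ 𝓛(X_E^{⊗k})`. -/
def Xk.IsAdjointable {k : ℕ} (T : G.Xk k →L[ℂ] G.Xk k) : Prop :=
  ∃ T' : G.Xk k →L[ℂ] G.Xk k, ∀ ξ η v, Xk.innerA (T ξ) η v = Xk.innerA ξ (T' η) v

open Classical in
/-- The map `ξ ↦ δ_e ⊗ ξ` from `X_E^{⊗k}` to `X_E^{⊗(k+1)}`: it sends `δ_γ` to `δ_{eγ}` if
`s(e) = r(γ)` and to `0` otherwise. -/
def Xk.create (e : Ed) (k : ℕ) : G.Xk k →L[ℂ] G.Xk (k + 1) :=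
  LinearMap.toContinuousLinearMap
    { toFun := fun ξ => WithLp.toLp 2 fun β => if β.edges.head? = some e then ξ β.tail else 0
      map_add' := fun x y => by ext β; by_cases h : β.edges.head? = some e <;> simp [h]
      map_smul' := fun c x => by ext β; by_cases h : β.edges.head? = some e <;> simp [h] }

/-- The operator `I_1 ⊗ T`, `δ_e ⊗ ξ ↦ δ_e ⊗ T ξ`, on `X_E^{⊗(k+1)}`, for `T` on `X_E^{⊗k}`
commuting with the left action; the adjoint of `Xk.create e k` sends `δ_{eγ}` to `δ_γ` and
`δ_{fγ}` to `0` for `f ≠ e`. -/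
def Xk.oneTensor {k : ℕ} (T : G.Xk k →L[ℂ] G.Xk k) : G.Xk (k + 1) →L[ℂ] G.Xk (k + 1) :=
  ∑ e : Ed, Xk.create e k ∘L T ∘L ContinuousLinearMap.adjoint (Xk.create e k)

/-- The operator `I_p ⊗ T` on `X_E^{⊗(k+p)} = X_E^{⊗p} ⊗ X_E^{⊗k}`, through
`I_{p+1} ⊗ T = I_1 ⊗ (I_p ⊗ T)`. -/
def Xk.idTensor {k : ℕ} (T : G.Xk k →L[ℂ] G.Xk k) :
    (p : ℕ) → (G.Xk (k + p) →L[ℂ] G.Xk (k + p))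
  | 0 => T
  | p + 1 => Xk.oneTensor (Xk.idTensor T p)

variable (G) in
/-- A weight sequence `Z = (Z_k)`: adjointable operators commuting with the left action, `Z_0 = I`,
`sup ‖Z_k‖ < ∞`, each `Z_k` is positive and invertible, and `Z_k ≥ ε I` for all `k ≥ 1`. -/
structure WeightSequence where
  /-- the operators `Z_k` -/
  op : (k : ℕ) → (G.Xk k →L[ℂ] G.Xk k)
  adjointable : ∀ k, Xk.IsAdjointable (op k)
  comm_left : ∀ k a, op k ∘L Xk.leftAct G k a = Xk.leftAct G k a ∘L op k
  op_zero : op 0 = ContinuousLinearMap.id ℂ _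
  bounded : ∃ M : ℝ, ∀ k, ‖op k‖ ≤ M
  positive : ∀ k, (op k).IsPositive
  invertible : ∀ k, IsUnit (op k)
  lower_bound : ∃ ε : ℝ, 0 < ε ∧ ∀ k, 1 ≤ k →
    (op k - (ε : ℂ) • ContinuousLinearMap.id ℂ (G.Xk k)).IsPositive

/-- Condition A(p): `‖I_p ⊗ Z_k - Z_{k+p}‖ → 0`. -/
def WeightSequence.ConditionA (Z : G.WeightSequence) (p : ℕ) : Prop :=
  Filter.Tendsto (fun k => ‖Xk.idTensor (Z.op k) p - Z.op (k + p)‖) Filter.atTop (nhds 0)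

/-! ### The Fock correspondence -/

variable (G) in
/-- The Fock correspondence `⨁_k X_E^{⊗k}`.  As `A = c(E^0)` is finite dimensional, its underlying
vector space is the Hilbert direct sum of the `X_E^{⊗k}`, with an equivalent norm. -/
abbrev Fock : Type _ := lp (fun k : ℕ => G.Xk k) 2

namespace Fock

/-- The `A`-valued inner product of the Fock correspondence. -/
def innerA (ξ η : G.Fock) (v : V) : ℂ := ∑' k, Xk.innerA (ξ k) (η k) v

lemma memℓp_of_le {ξ : G.Fock} {f : ∀ k, G.Xk k} {M : ℝ} (hM : ∀ k, ‖f k‖ ≤ M * ‖ξ k‖) :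
    Memℓp f 2 := by
  have h2 : (0 : ℝ) < (2 : ENNReal).toReal := by norm_num
  have hs := (lp.memℓp ξ).summable h2
  refine memℓp_gen ((hs.mul_left (M ^ 2)).of_nonneg_of_le (fun k => by positivity) fun k => ?_)
  have h0 : 0 ≤ M * ‖ξ k‖ := (norm_nonneg _).trans (hM k)
  simp only [ENNReal.toReal_ofNat, Real.rpow_ofNat]
  rw [← mul_pow]
  exact pow_le_pow_left₀ (norm_nonneg _) (hM k) 2

lemma norm_sq (ξ : G.Fock) : ‖ξ‖ ^ 2 = ∑' k, ‖ξ k‖ ^ 2 := by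
  have := lp.norm_rpow_eq_tsum (p := 2) (by norm_num) ξ
  simpa using this

lemma summable_sq (ξ : G.Fock) : Summable fun k => ‖ξ k‖ ^ 2 := by
  have := (lp.memℓp ξ).summable (p := 2) (by norm_num)
  simpa using this

/-- The diagonal operator `diag(T_0, T_1, …)` for a bounded sequence `T_k` on `X_E^{⊗k}`. -/
def diag (T : (k : ℕ) → (G.Xk k →L[ℂ] G.Xk k)) (hT : ∃ M : ℝ, ∀ k, ‖T k‖ ≤ M) :
    G.Fock →L[ℂ] G.Fock :=
  LinearMap.mkContinuousOfExistsBound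
    { toFun := fun ξ => ⟨fun k => T k (ξ k), by
        obtain ⟨M, hM⟩ := hT
        exact memℓp_of_le (ξ := ξ) (M := M) fun k => (T k).le_of_opNorm_le (hM k) _⟩
      map_add' := fun x y => by ext k : 2; exact map_add (T k) _ _
      map_smul' := fun c x => by ext k : 2; exact map_smul (T k) c _ }
    (by
      obtain ⟨M, hM⟩ := hT
      have hM0 : 0 ≤ M := (norm_nonneg _).trans (hM 0)
      refine ⟨M, fun ξ => ?_⟩
      rw [← pow_le_pow_iff_left₀ (norm_nonneg _) (by positivity) two_ne_zero, mul_pow, norm_sq,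
        norm_sq, ← tsum_mul_left]
      refine Summable.tsum_le_tsum (fun k => ?_) (summable_sq _) ((summable_sq ξ).mul_left _)
      rw [← mul_pow]
      exact pow_le_pow_left₀ (norm_nonneg _) ((T k).le_of_opNorm_le (hM k) _) 2)

@[simp]
lemma diag_apply (T : (k : ℕ) → (G.Xk k →L[ℂ] G.Xk k)) (hT) (ξ : G.Fock) (k : ℕ) :
    diag T hT ξ k = T k (ξ k) := rfl

end Fock

lemma Xk.norm_mulOp_le {k : ℕ} (f : G.Path k → ℂ) (M : ℝ) (hM0 : 0 ≤ M) (hM : ∀ α, ‖f α‖ ≤ M) :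
    ‖Xk.mulOp f‖ ≤ M := by
  refine ContinuousLinearMap.opNorm_le_bound _ hM0 fun ξ => ?_
  rw [← pow_le_pow_iff_left₀ (norm_nonneg _) (by positivity) two_ne_zero, mul_pow,
    EuclideanSpace.norm_sq_eq, EuclideanSpace.norm_sq_eq, Finset.mul_sum]
  refine Finset.sum_le_sum fun α _ => ?_
  have : Xk.mulOp f ξ α = f α * ξ α := rfl
  rw [this, norm_mul, mul_pow]
  gcongr
  exact hM α

lemma Xk.norm_create_le (e : Ed) (k : ℕ) : ‖(Xk.create e k : G.Xk k →L[ℂ] G.Xk (k + 1))‖ ≤ 1 := by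
  classical
  refine ContinuousLinearMap.opNorm_le_bound _ zero_le_one fun ξ => ?_
  rw [one_mul, ← pow_le_pow_iff_left₀ (norm_nonneg _) (norm_nonneg _) two_ne_zero,
    EuclideanSpace.norm_sq_eq, EuclideanSpace.norm_sq_eq]
  have h1 : ∀ β : G.Path (k + 1), ‖Xk.create e k ξ β‖ ^ 2 =
      if β.edges.head? = some e then ‖ξ β.tail‖ ^ 2 else 0 := fun β => by
    have : Xk.create e k ξ β = if β.edges.head? = some e then ξ β.tail else 0 := rfl
    rw [this]
    split_ifs <;> simp
  rw [Finset.sum_congr rfl fun β _ => h1 β, ← Finset.sum_filter]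
  have hinj : Set.InjOn (Path.tail : G.Path (k + 1) → G.Path k)
      (Finset.univ.filter fun β : G.Path (k + 1) => β.edges.head? = some e) := by
    intro β hβ β' hβ' h
    simp only [Finset.coe_filter, Finset.mem_univ, true_and, Set.mem_ofPred_eq] at hβ hβ'
    have hs : β.tail.source = β'.tail.source := congrArg (fun γ : G.Path k => γ.source) h
    have ht : β.tail.edges = β'.tail.edges := congrArg (fun γ : G.Path k => γ.edges) h
    change β.edges.tail = β'.edges.tail at ht
    refine Path.ext hs ?_
    rw [List.eq_cons_of_mem_head? hβ, List.eq_cons_of_mem_head? hβ', ht]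
  rw [← Finset.sum_image (f := fun γ => ‖ξ γ‖ ^ 2) hinj]
  exact Finset.sum_le_sum_of_subset_of_nonneg (Finset.subset_univ _) fun _ _ _ => by positivity

namespace Fock

variable (G) in
/-- The right action of `A` on the Fock correspondence. -/
def rightAct (a : V → ℂ) : G.Fock →L[ℂ] G.Fock :=
  diag (fun k => Xk.rightAct G k a)
    ⟨‖a‖, fun _ => Xk.norm_mulOp_le _ _ (norm_nonneg _) fun _ => norm_le_pi_norm a _⟩

variable (G) in
/-- The left action `φ_∞` of `A` on the Fock correspondence. -/
def leftAct (a : V → ℂ) : G.Fock →L[ℂ] G.Fock :=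
  diag (fun k => Xk.leftAct G k a)
    ⟨‖a‖, fun _ => Xk.norm_mulOp_le _ _ (norm_nonneg _) fun _ => norm_le_pi_norm a _⟩

/-- The components of `S_e ξ`. -/
def shiftFun (e : Ed) (ξ : G.Fock) : (k : ℕ) → G.Xk k
  | 0 => 0
  | k + 1 => Xk.create e k (ξ k)

lemma norm_create_sq_le (e : Ed) (ξ : G.Fock) (k : ℕ) :
    ‖Xk.create e k (ξ k)‖ ^ 2 ≤ ‖ξ k‖ ^ 2 := by
  have h := (Xk.create (G := G) e k).le_of_opNorm_le (Xk.norm_create_le e k) (ξ k)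
  rw [one_mul] at h
  exact pow_le_pow_left₀ (norm_nonneg _) h 2

/-- The creation operator `S_e`: `S_e δ_γ = δ_{eγ}` if `s(e) = r(γ)`, and `0` otherwise. -/
def shift (e : Ed) : G.Fock →L[ℂ] G.Fock :=
  LinearMap.mkContinuous
    { toFun := fun ξ => ⟨shiftFun e ξ, by
        refine memℓp_gen ?_
        simp only [ENNReal.toReal_ofNat, Real.rpow_ofNat]
        rw [← summable_nat_add_iff 1]
        exact (summable_sq ξ).of_nonneg_of_le (fun k => by positivity)
          fun k => norm_create_sq_le e ξ k⟩
      map_add' := fun x y => by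
        ext k : 2
        cases k with
        | zero => exact (add_zero (0 : G.Xk 0)).symm
        | succ k => exact map_add (Xk.create e k) _ _
      map_smul' := fun c x => by
        ext k : 2
        cases k with
        | zero => exact (smul_zero c : c • (0 : G.Xk 0) = 0).symm
        | succ k => exact map_smul (Xk.create e k) c _ }
    1
    (fun ξ => by
      rw [one_mul, ← pow_le_pow_iff_left₀ (norm_nonneg _) (norm_nonneg _) two_ne_zero, norm_sq,
        norm_sq, (summable_sq _).tsum_eq_zero_add]
      have h0 : ‖shiftFun e ξ 0‖ ^ 2 = 0 := by simp [shiftFun]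
      refine (add_le_of_nonpos_left (le_of_eq h0)).trans ?_
      exact Summable.tsum_le_tsum (norm_create_sq_le e ξ)
        ((summable_nat_add_iff 1).2 (summable_sq _)) (summable_sq ξ))

/-- The unitary `W_t = ∑_n e^{int} Q_n`. -/
def gaugeUnitary (t : ℝ) : G.Fock →L[ℂ] G.Fock :=
  diag (fun k => Complex.exp (Complex.I * k * t) • ContinuousLinearMap.id ℂ (G.Xk k))
    ⟨1, fun k => by
      rw [norm_smul, show Complex.I * k * t = ((k * t : ℝ) : ℂ) * Complex.I by push_cast; ring,
        Complex.norm_exp_ofReal_mul_I, one_mul]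
      exact ContinuousLinearMap.norm_id_le⟩

/-- The weight operator `Z = diag(Z_0, Z_1, …)`. -/
def weightOp (Z : G.WeightSequence) : G.Fock →L[ℂ] G.Fock := diag Z.op Z.bounded

open Classical in
/-- The function `δ_v ∈ A = c(E^0)`. -/
def delta (v : V) : V → ℂ := fun w => if w = v then 1 else 0

lemma _root_.DirGraph.Xk.innerA_eq {k : ℕ} (ξ η : G.Xk k) (v : V) :
    Xk.innerA ξ η v = ⟪ξ, Xk.rightAct G k (delta v) η⟫_ℂ := by
  classical
  rw [PiLp.inner_apply]
  refine Finset.sum_congr rfl fun α _ => ?_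
  have : Xk.rightAct G k (delta v) η α = delta v α.source * η α := rfl
  rw [this]
  by_cases h : α.source = v <;> simp [h, delta, mul_comm]

lemma innerA_eq (ξ η : G.Fock) (v : V) : innerA ξ η v = ⟪ξ, rightAct G (delta v) η⟫_ℂ := by
  rw [lp.inner_eq_tsum]
  exact tsum_congr fun k => Xk.innerA_eq _ _ _

lemma _root_.DirGraph.Xk.inner_rightAct {k : ℕ} (ξ η : G.Xk k) (v : V) :
    ⟪Xk.rightAct G k (delta v) ξ, η⟫_ℂ = ⟪ξ, Xk.rightAct G k (delta v) η⟫_ℂ := by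
  classical
  rw [PiLp.inner_apply, PiLp.inner_apply]
  refine Finset.sum_congr rfl fun α _ => ?_
  have h1 : ∀ ζ, Xk.rightAct G k (delta v) ζ α = delta v α.source * ζ α := fun _ => rfl
  rw [h1, h1]
  by_cases h : α.source = v <;> simp [h, delta]

lemma inner_rightAct (ξ η : G.Fock) (v : V) :
    ⟪rightAct G (delta v) ξ, η⟫_ℂ = ⟪ξ, rightAct G (delta v) η⟫_ℂ := by
  rw [lp.inner_eq_tsum, lp.inner_eq_tsum]
  exact tsum_congr fun k => Xk.inner_rightAct _ _ _

lemma rightAct_eq_sum (a : V → ℂ) (ξ : G.Fock) :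
    rightAct G a ξ = ∑ v, a v • rightAct G (delta v) ξ := by
  classical
  ext k α
  have h1 : ∀ b : V → ℂ, (rightAct G b ξ) k α = b α.source * ξ k α := fun _ => rfl
  have h2 : (∑ v, a v • rightAct G (delta v) ξ) k α =
      ∑ v, a v * (rightAct G (delta v) ξ k α) := by
    rw [lp.coeFn_sum, Finset.sum_apply, WithLp.ofLp_sum, Finset.sum_apply]
    rfl
  rw [h2, h1]
  simp only [h1, delta]
  simp

lemma sum_rightAct (ξ : G.Fock) : ∑ v, rightAct G (delta v) ξ = ξ := by
  have h := rightAct_eq_sum (fun _ => 1) ξ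
  simp only [one_smul] at h
  rw [← h]
  ext k α
  exact one_mul _

/-- `T` is adjointable for the `A`-valued inner product of the Fock correspondence. -/
def IsAdjointable (T : G.Fock →L[ℂ] G.Fock) : Prop :=
  ∃ T' : G.Fock →L[ℂ] G.Fock, ∀ ξ η v, innerA (T ξ) η v = innerA ξ (T' η) v

lemma isAdjointable_iff (T : G.Fock →L[ℂ] G.Fock) :
    IsAdjointable T ↔ ∀ v ξ, T (rightAct G (delta v) ξ) = rightAct G (delta v) (T ξ) := by
  constructor
  · rintro ⟨T', h⟩
    simp only [innerA_eq] at h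
    have hT' : T' = ContinuousLinearMap.adjoint T := by
      rw [ContinuousLinearMap.eq_adjoint_iff]
      intro x y
      rw [← inner_conj_symm, ← inner_conj_symm x]
      congr 1
      conv_rhs => rw [← sum_rightAct x]
      conv_lhs => rw [← sum_rightAct (T' x)]
      rw [inner_sum, inner_sum]
      exact Finset.sum_congr rfl fun v _ => (h y x v).symm
    subst hT'
    intro v ξ
    refine ext_inner_right ℂ fun η => ?_
    rw [← ContinuousLinearMap.adjoint_inner_right, inner_rightAct, inner_rightAct, h]
  · intro h
    refine ⟨ContinuousLinearMap.adjoint T, fun ξ η v => ?_⟩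
    rw [innerA_eq, innerA_eq, ← inner_rightAct, ← inner_rightAct, ← h,
      ContinuousLinearMap.adjoint_inner_right]

lemma _root_.DirGraph.Xk.IsAdjointable.comm {k : ℕ} {T : G.Xk k →L[ℂ] G.Xk k}
    (hT : Xk.IsAdjointable T) (v : V) (ξ : G.Xk k) :
    T (Xk.rightAct G k (delta v) ξ) = Xk.rightAct G k (delta v) (T ξ) := by
  classical
  obtain ⟨T', h⟩ := hT
  have hsum : ∀ x : G.Xk k, ∑ v, Xk.rightAct G k (delta v) x = x := fun x => by
    ext α
    rw [WithLp.ofLp_sum, Finset.sum_apply]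
    have h1 : ∀ v, Xk.rightAct G k (delta v) x α = delta v α.source * x α := fun _ => rfl
    simp only [h1, delta]
    simp
  simp only [Xk.innerA_eq] at h
  have hT' : T' = ContinuousLinearMap.adjoint T := by
    rw [ContinuousLinearMap.eq_adjoint_iff]
    intro x y
    rw [← inner_conj_symm, ← inner_conj_symm x]
    congr 1
    conv_rhs => rw [← hsum x]
    conv_lhs => rw [← hsum (T' x)]
    rw [inner_sum, inner_sum]
    exact Finset.sum_congr rfl fun v _ => (h y x v).symm
  subst hT'
  refine ext_inner_right ℂ fun η => ?_
  rw [← ContinuousLinearMap.adjoint_inner_right, Xk.inner_rightAct, Xk.inner_rightAct, h]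

lemma isAdjointable_diag (T : (k : ℕ) → (G.Xk k →L[ℂ] G.Xk k)) (hT)
    (h : ∀ k v ξ, T k (Xk.rightAct G k (delta v) ξ) = Xk.rightAct G k (delta v) (T k ξ)) :
    IsAdjointable (diag T hT) :=
  (isAdjointable_iff _).2 fun v ξ => by ext k : 2; exact h k v (ξ k)

lemma isAdjointable_leftAct (a : V → ℂ) : IsAdjointable (leftAct G a) :=
  isAdjointable_diag _ _ fun _ _ _ => by ext α; exact mul_left_comm _ _ _

lemma isAdjointable_gaugeUnitary (t : ℝ) : IsAdjointable (gaugeUnitary t : G.Fock →L[ℂ] G.Fock) :=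
  isAdjointable_diag _ _ fun k v ξ => (map_smul (Xk.rightAct G k (delta v)) _ ξ).symm

lemma isAdjointable_weightOp (Z : G.WeightSequence) : IsAdjointable (weightOp Z) :=
  isAdjointable_diag _ _ fun k => (Z.adjointable k).comm

lemma isAdjointable_shift (e : Ed) : IsAdjointable (shift e : G.Fock →L[ℂ] G.Fock) := by
  classical
  refine (isAdjointable_iff _).2 fun v ξ => ?_
  ext k : 2
  cases k with
  | zero => exact (map_zero (Xk.rightAct G 0 (delta v))).symm
  | succ k =>
    ext β
    change (if β.edges.head? = some e then delta v β.source * ξ k β.tail else 0) =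
      delta v β.source * (if β.edges.head? = some e then ξ k β.tail else 0)
    split_ifs <;> simp

end Fock

/-! ### The algebra `𝓛(𝓕(X_E))`, the compact operators, and the quotient -/

variable (G) in
/-- The algebra `𝓛 = 𝓛(𝓕(X_E))` of adjointable operators on the Fock correspondence. -/
def adjointableOps : StarSubalgebra ℂ (G.Fock →L[ℂ] G.Fock) where
  carrier := {T | Fock.IsAdjointable T}
  mul_mem' := fun {S T} hS hT => by
    rw [Set.mem_ofPred_eq, Fock.isAdjointable_iff] at *
    intro v ξ
    simp [hS, hT]
  add_mem' := fun {S T} hS hT => by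
    rw [Set.mem_ofPred_eq, Fock.isAdjointable_iff] at *
    intro v ξ
    simp [hS, hT]
  algebraMap_mem' := fun c => by
    rw [Set.mem_ofPred_eq, Fock.isAdjointable_iff]
    intro v ξ
    simp [Algebra.algebraMap_eq_smul_one]
  star_mem' := fun {T} hT => by
    rw [Set.mem_ofPred_eq, Fock.isAdjointable_iff] at *
    intro v ξ
    refine ext_inner_right ℂ fun η => ?_
    rw [ContinuousLinearMap.star_eq_adjoint, ContinuousLinearMap.adjoint_inner_left,
      Fock.inner_rightAct, Fock.inner_rightAct, ContinuousLinearMap.adjoint_inner_left, hT]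

variable (G) in
/-- The rank-one operators `θ_{ξ,η} ζ = ξ ⟨η, ζ⟩` on the Fock correspondence. -/
def rankOneOps : Set G.adjointableOps :=
  {T | ∃ ξ η : G.Fock, ∀ ζ : G.Fock, T.1 ζ = Fock.rightAct G (Fock.innerA η ζ) ξ}

lemma mul_mem_rankOneOps (S : G.adjointableOps) {T : G.adjointableOps} (hT : T ∈ G.rankOneOps) :
    S * T ∈ G.rankOneOps := by
  obtain ⟨ξ, η, h⟩ := hT
  refine ⟨S.1 ξ, η, fun ζ => ?_⟩
  have hS := (Fock.isAdjointable_iff S.1).1 S.2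
  have : (S * T).1 ζ = S.1 (T.1 ζ) := rfl
  rw [this, h, Fock.rightAct_eq_sum, Fock.rightAct_eq_sum, map_sum]
  simp [hS]

lemma star_mem_rankOneOps {T : G.adjointableOps} (hT : T ∈ G.rankOneOps) :
    star T ∈ G.rankOneOps := by
  obtain ⟨ξ, η, h⟩ := hT
  refine ⟨η, ξ, fun ζ => ?_⟩
  refine ext_inner_right ℂ fun χ => ?_
  have : (star T).1 = ContinuousLinearMap.adjoint T.1 := rfl
  rw [this, ContinuousLinearMap.adjoint_inner_left, h, Fock.rightAct_eq_sum, Fock.rightAct_eq_sum,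
    inner_sum, sum_inner]
  refine Finset.sum_congr rfl fun v _ => ?_
  rw [inner_smul_right, inner_smul_left, Fock.innerA_eq, Fock.innerA_eq, inner_conj_symm,
    Fock.inner_rightAct, Fock.inner_rightAct, mul_comm]

variable (G) in
/-- The closed linear span of the rank-one operators. -/
def compactSpan : Submodule ℂ G.adjointableOps :=
  (Submodule.span ℂ G.rankOneOps).topologicalClosure

lemma mul_mem_compactSpan (S : G.adjointableOps) {T : G.adjointableOps} (hT : T ∈ G.compactSpan) :
    S * T ∈ G.compactSpan := by
  refine map_mem_closure (continuous_const_mul S) hT fun x hx => ?_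
  induction hx using Submodule.span_induction with
  | mem x hx => exact Submodule.subset_span (mul_mem_rankOneOps S hx)
  | zero => simp
  | add x y _ _ hx hy => simpa [mul_add] using Submodule.add_mem _ hx hy
  | smul c x _ hx => simpa using Submodule.smul_mem _ c hx

lemma star_mem_compactSpan {T : G.adjointableOps} (hT : T ∈ G.compactSpan) :
    star T ∈ G.compactSpan := by
  refine map_mem_closure continuous_star hT fun x hx => ?_
  induction hx using Submodule.span_induction with
  | mem x hx => exact Submodule.subset_span (star_mem_rankOneOps hx)
  | zero => simp
  | add x y _ _ hx hy => simpa using Submodule.add_mem _ hx hy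
  | smul c x _ hx => simpa using Submodule.smul_mem _ (conj c) hx

variable (G) in
/-- The ideal `𝓚 = 𝓚(𝓕(X_E))` of (generalized) compact operators: the closed linear span of the
operators `θ_{ξ,η}`. -/
def compactOps : Ideal G.adjointableOps where
  carrier := G.compactSpan
  add_mem' := G.compactSpan.add_mem
  zero_mem' := G.compactSpan.zero_mem
  smul_mem' := fun S _ hT => mul_mem_compactSpan S hT

instance instIsTwoSided : G.compactOps.IsTwoSided where
  mul_mem_of_left := fun {T} S hT => by
    have h := star_mem_compactSpan (mul_mem_compactSpan (star S) (star_mem_compactSpan hT))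
    rw [star_mul, star_star, star_star] at h
    exact h

instance instIsClosed : IsClosed (G.compactOps : Set G.adjointableOps) :=
  Submodule.isClosed_topologicalClosure _

variable (G) in
/-- The quotient algebra `𝓛(𝓕(X_E)) / 𝓚`, with the quotient norm and the involution
`q(T)^* = q(T^*)`. -/
def QuotAlg : Type _ := G.adjointableOps ⧸ G.compactOps

namespace QuotAlg

instance : Ring G.QuotAlg := inferInstanceAs (Ring (G.adjointableOps ⧸ G.compactOps))

instance : Algebra ℂ G.QuotAlg := inferInstanceAs (Algebra ℂ (G.adjointableOps ⧸ G.compactOps))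

variable (G) in
/-- The quotient map `q`. -/
def q : G.adjointableOps →ₐ[ℂ] G.QuotAlg := Ideal.Quotient.mkₐ ℂ G.compactOps

lemma q_surjective : Function.Surjective (q G) := Ideal.Quotient.mk_surjective

lemma q_eq_zero_iff (T : G.adjointableOps) : q G T = 0 ↔ T ∈ G.compactOps :=
  Ideal.Quotient.eq_zero_iff_mem

instance : NormedAddCommGroup G.QuotAlg :=
  inferInstanceAs (NormedAddCommGroup (G.adjointableOps ⧸ G.compactOps))


lemma norm_q_le (T : G.adjointableOps) : ‖q G T‖ ≤ ‖T‖ :=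
  Submodule.Quotient.norm_mk_le G.compactOps T

lemma exists_norm_lt (x : G.QuotAlg) {ε : ℝ} (hε : 0 < ε) :
    ∃ T : G.adjointableOps, q G T = x ∧ ‖T‖ < ‖x‖ + ε :=
  Submodule.Quotient.norm_mk_lt x hε

instance : NormedRing G.QuotAlg where
  __ := (inferInstance : Ring G.QuotAlg)
  __ := (inferInstance : NormedAddCommGroup G.QuotAlg)
  norm_mul_le := fun x y => by
    refine le_of_forall_pos_le_add fun ε hε => ?_
    have ht : Filter.Tendsto (fun d : ℝ => (‖x‖ + d) * (‖y‖ + d)) (nhdsWithin 0 (Set.Ioi 0))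
        (nhds ((‖x‖ + 0) * (‖y‖ + 0))) :=
      ((by fun_prop : Continuous fun d : ℝ => (‖x‖ + d) * (‖y‖ + d)).tendsto 0).mono_left
        nhdsWithin_le_nhds
    rw [add_zero, add_zero] at ht
    obtain ⟨d, hd, hd0⟩ := ((ht.eventually (gt_mem_nhds (lt_add_of_pos_right _ hε))).and
      self_mem_nhdsWithin).exists
    obtain ⟨S, rfl, hS⟩ := exists_norm_lt x hd0
    obtain ⟨T, rfl, hT⟩ := exists_norm_lt y hd0
    calc ‖q G S * q G T‖ = ‖q G (S * T)‖ := by rw [map_mul]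
      _ ≤ ‖S * T‖ := norm_q_le _
      _ ≤ ‖S‖ * ‖T‖ := norm_mul_le _ _
      _ ≤ _ := mul_le_mul hS.le hT.le (norm_nonneg _) ((norm_nonneg _).trans hS.le)
      _ ≤ _ := hd.le

instance : NormedAlgebra ℂ G.QuotAlg where
  __ := (inferInstance : Algebra ℂ G.QuotAlg)
  norm_smul_le := fun c x => by
    refine le_of_forall_pos_le_add fun ε hε => ?_
    have hc : 0 < ‖c‖ + 1 := by positivity
    obtain ⟨T, rfl, hT⟩ := exists_norm_lt x (div_pos hε hc)
    calc ‖c • q G T‖ = ‖q G (c • T)‖ := by rw [map_smul]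
      _ ≤ ‖c • T‖ := norm_q_le _
      _ = ‖c‖ * ‖T‖ := norm_smul _ _
      _ ≤ ‖c‖ * (‖q G T‖ + ε / (‖c‖ + 1)) := by gcongr
      _ = ‖c‖ * ‖q G T‖ + ε * (‖c‖ / (‖c‖ + 1)) := by ring
      _ ≤ ‖c‖ * ‖q G T‖ + ε * 1 := by
        gcongr
        rw [div_le_one hc]
        linarith
      _ = _ := by rw [mul_one]

/-- The involution of the quotient, `q(T)^* = q(T^*)`. -/
def starFun : G.QuotAlg → G.QuotAlg :=
  Quotient.map' (fun T : G.adjointableOps => star T) fun S T h => by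
    rw [Submodule.quotientRel_def] at h ⊢
    rw [← star_sub]
    exact star_mem_compactSpan h

instance : Star G.QuotAlg := ⟨starFun⟩

lemma q_star (T : G.adjointableOps) : q G (star T) = star (q G T) := rfl

instance : StarRing G.QuotAlg where
  star_involutive := fun x => by
    obtain ⟨T, rfl⟩ := q_surjective x
    rw [← q_star, ← q_star, star_star]
  star_mul := fun x y => by
    obtain ⟨S, rfl⟩ := q_surjective x
    obtain ⟨T, rfl⟩ := q_surjective y
    rw [← map_mul, ← q_star, star_mul, map_mul, q_star, q_star]
  star_add := fun x y => by
    obtain ⟨S, rfl⟩ := q_surjective x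
    obtain ⟨T, rfl⟩ := q_surjective y
    rw [← map_add, ← q_star, star_add, map_add, q_star, q_star]

instance : StarModule ℂ G.QuotAlg where
  star_smul := fun c x => by
    obtain ⟨T, rfl⟩ := q_surjective x
    rw [← map_smul, ← q_star, star_smul, map_smul, q_star]

instance : NormedStarGroup G.QuotAlg where
  norm_star_le := fun x => by
    refine le_of_forall_pos_le_add fun ε hε => ?_
    obtain ⟨T, rfl, hT⟩ := exists_norm_lt x hε
    rw [← q_star]
    refine (norm_q_le _).trans ?_
    have h : ‖star T‖ = ‖T‖ := norm_star (T : G.Fock →L[ℂ] G.Fock)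
    rw [h]
    exact hT.le

end QuotAlg

/-! ### The weighted Toeplitz algebra, `𝓓`, `F`, and their images in the quotient -/

variable (G) in
/-- `S_e` as an element of `𝓛(𝓕(X_E))`. -/
def S (e : Ed) : G.adjointableOps := ⟨Fock.shift e, Fock.isAdjointable_shift e⟩

variable (G) in
/-- `P_v = φ_∞(δ_v)` as an element of `𝓛(𝓕(X_E))`. -/
def P (v : V) : G.adjointableOps :=
  ⟨Fock.leftAct G (Fock.delta v), Fock.isAdjointable_leftAct (Fock.delta v)⟩

variable (G) in
/-- The gauge automorphism `γ_t = Ad W_t` of `𝓛(𝓕(X_E))`. -/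
def gauge (t : ℝ) (X : G.adjointableOps) : G.adjointableOps :=
  let W : G.adjointableOps := ⟨Fock.gaugeUnitary t, Fock.isAdjointable_gaugeUnitary t⟩
  W * X * star W

variable (G) in
/-- `u_e = q(S_e)`. -/
def u (e : Ed) : G.QuotAlg := QuotAlg.q G (G.S e)

variable (G) in
/-- `p_v = q(P_v)`. -/
def pv (v : V) : G.QuotAlg := QuotAlg.q G (G.P v)

/-- `u_α = u_{e₁} u_{e₂} ⋯ u_{eₖ}` for a path `α = e₁ e₂ ⋯ eₖ`, and `u_v = p_v` for a path of length
`0`.  The last factor `p_{s(α)}` is redundant if `k ≥ 1`, as `u_e p_{s(e)} = u_e`. -/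
def uPath {k : ℕ} (α : G.Path k) : G.QuotAlg :=
  α.edges.foldr (fun e x => G.u e * x) (G.pv α.source)

namespace WeightSequence

variable (Z : G.WeightSequence)

/-- The weight operator `Z` as an element of `𝓛(𝓕(X_E))`. -/
def opL : G.adjointableOps := ⟨Fock.weightOp Z, Fock.isAdjointable_weightOp Z⟩

/-- The weighted Toeplitz algebra `𝓣(X_E, Z)`: the `C^*`-algebra generated by the weighted shifts
`W_e = Z S_e`. -/
def toeplitz : NonUnitalStarSubalgebra ℂ G.adjointableOps :=
  (NonUnitalStarAlgebra.adjoin ℂ (Set.range fun e : Ed => Z.opL * G.S e)).topologicalClosure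

/-- `𝓓`, the fixed points of the gauge action in `𝓣(X_E, Z)`. -/
def D : Set G.adjointableOps := {X | X ∈ Z.toeplitz ∧ ∀ t : ℝ, G.gauge t X = X}

/-- `F`, the first spectral subspace of the gauge action in `𝓣(X_E, Z)`. -/
def F : Set G.adjointableOps :=
  {X | X ∈ Z.toeplitz ∧ ∀ t : ℝ, G.gauge t X = Complex.exp (Complex.I * t) • X}

/-- `q(𝓓)`. -/
def qD : Set G.QuotAlg := QuotAlg.q G '' Z.D

/-- `q(F)`. -/
def qF : Set G.QuotAlg := QuotAlg.q G '' Z.F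

/-- `z = q(Z)`. -/
def z : G.QuotAlg := QuotAlg.q G Z.opL

/-- The algebra `𝓒_n`: the `C^*`-algebra generated by the elements `u_α z^l u_β^*` with `l ≥ 0`,
`np ≤ |α| = |β| < (n+1)p` and `s(α) = s(β)`. -/
def C (p n : ℕ) : NonUnitalStarSubalgebra ℂ G.QuotAlg :=
  (NonUnitalStarAlgebra.adjoin ℂ
    {x : G.QuotAlg | ∃ (l k : ℕ) (α β : G.Path k), n * p ≤ k ∧ k < (n + 1) * p ∧
      α.source = β.source ∧ x = uPath α * Z.z ^ l * star (uPath β)}).topologicalClosure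

/-- `J` is a closed two-sided ideal of `q(𝓓)`. -/
structure IsIdeal (J : Submodule ℂ G.QuotAlg) : Prop where
  subset : (J : Set G.QuotAlg) ⊆ Z.qD
  isClosed : IsClosed (J : Set G.QuotAlg)
  mul_mem_left : ∀ a ∈ Z.qD, ∀ x ∈ J, a * x ∈ J
  mul_mem_right : ∀ a ∈ Z.qD, ∀ x ∈ J, x * a ∈ J

/-- `q(F)(J)`, the closed linear span of the elements `⟨η, a ξ⟩ = η^* a ξ` with `a ∈ J` and
`ξ, η ∈ q(F)`. -/
def qFImage (J : Submodule ℂ G.QuotAlg) : Submodule ℂ G.QuotAlg :=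
  (Submodule.span ℂ {x | ∃ a ∈ J, ∃ ξ ∈ Z.qF, ∃ η ∈ Z.qF,
    x = star η * a * ξ}).topologicalClosure

/-- `q(F)⁻¹(J)`, the set of all `a ∈ q(𝓓)` with `⟨η, a ξ⟩ = η^* a ξ ∈ J` for all `ξ, η ∈ q(F)`. -/
def qFPreimage (J : Submodule ℂ G.QuotAlg) : Set G.QuotAlg :=
  {a | a ∈ Z.qD ∧ ∀ ξ ∈ Z.qF, ∀ η ∈ Z.qF, star η * a * ξ ∈ J}

/-- The ideal `J` is fully invariant: `q(F)(J) ⊆ J` and `q(F)⁻¹(J) ⊆ J`. -/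
def FullyInvariant (J : Submodule ℂ G.QuotAlg) : Prop :=
  Z.qFImage J ≤ J ∧ Z.qFPreimage J ⊆ J

/-- `J_n = J ∩ 𝓒_n`. -/
def restrict (p : ℕ) (J : Submodule ℂ G.QuotAlg) (n : ℕ) : Set G.QuotAlg := {x | x ∈ J ∧ x ∈ Z.C p n}

/-- The corner `J_{n,v}`: the set of all `u_{ξ_v} u_{μ₁}^* x u_{μ₂} u_{ξ_v}^*` with `x ∈ J_n` and
`μ₁, μ₂` paths of length `np + (p - 1)` with source `v`, for a given path `ξ_v`.  (The
set obtained from one fixed pair `μ₁, μ₂` is the same for all such pairs.) -/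
def corner (p : ℕ) (J : Submodule ℂ G.QuotAlg) {k : ℕ} (ξ : V → G.Path k) (n : ℕ) (v : V) :
    Set G.QuotAlg :=
  {y | ∃ μ₁ μ₂ : G.Path (n * p + (p - 1)), μ₁.source = v ∧ μ₂.source = v ∧
    ∃ x ∈ Z.restrict p J n,
      y = uPath (ξ v) * star (uPath μ₁) * x * uPath μ₂ * star (uPath (ξ v))}

end WeightSequence

end DirGraph

end

/-!
Write `r_k(x)` for the matrix `(u_μ^* x u_ν)` indexed by the paths of length `k`. Condition A(`p`)
makes `q(Z)` periodic under `x ↦ ∑ₑ uₑ x uₑ^*`, so all the coefficients that occur lie in one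
coefficient algebra `R`, and `𝓒_n` consists of all `x` for which `r_k(x)` has entries in `R`, where
`k = np + p - 1`. Averaging over the gauge action shows that `⋃ 𝓒_n` is dense in `q(𝓓)`, so a closed
ideal `J` is the closure of `⋃ J_n` and is determined by its coefficient ideals `I_k(v)`, the
entries at the vertex `v` of the matrices `r_k(x)`, `x ∈ J`.

Full invariance says that `I_k = I_0` for all `k`. Summing over the edges shows that `I_k` is always
the preimage of `I_{k+1}` under the compressions `y ↦ u_g^* y u_g`. The condition on the corners
says that `I_{np+p-1} = I_{p-1}` for all `n`, and by this periodicity the preimage of `I_0` is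
`I_{p-1}`. The remaining conditions, in (A) as in (B), amount to `I_0 = I_{p-1}`, hence `I_0` is its
own preimage and the sequence is constant.
-/

noncomputable section

/-! ### Approximation by elements of an ideal in a closed `*`-subalgebra -/

lemma mem_of_nonneg_of_mul_self_mem {A : Type*} [CStarAlgebra A] [PartialOrder A]
    [StarOrderedRing A] {T : NonUnitalStarSubalgebra ℂ A} (hT : IsClosed (T : Set A)) {b : A}
    (hb : 0 ≤ b) (h : b * b ∈ T) : b ∈ T := by
  rw [← CFC.sqrt_mul_self b hb, CFC.sqrt_eq_real_sqrt (b * b) (by cfc_tac)]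
  exact cfcₙ_mem (hs := hT) Real.sqrt h

lemma pow_sub_pow_mem_of_sub_mem {R : Type*} [Ring R] {J : AddSubgroup R} {a b : R}
    (hab : a - b ∈ J) (hb : ∀ x ∈ J, b * x ∈ J) (ha : ∀ x ∈ J, x * a ∈ J) (n : ℕ) :
    a ^ n - b ^ n ∈ J := by
  have hpow : ∀ n, ∀ x ∈ J, b ^ n * x ∈ J := fun n => by
    induction n with
    | zero => simp
    | succ n ih => exact fun x hx => by simpa only [pow_succ, mul_assoc] using ih _ (hb x hx)
  induction n with
  | zero => simp
  | succ n ih =>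
    have hsplit : a ^ (n + 1) - b ^ (n + 1) = (a ^ n - b ^ n) * a + b ^ n * (a - b) := by
      rw [pow_succ, pow_succ]; noncomm_ring
    exact hsplit ▸ add_mem (ha _ ih) (hpow n _ hab)

/-- A continuous function vanishing on `(-∞, θ]`, divided by `n` further factors `t` where it does
not vanish. For `n = 0` it is the cut-off `1 - θ / max t θ`. -/
def softThreshold (θ : ℝ) (n : ℕ) (t : ℝ) : ℝ := max 0 (t - θ) / max t θ ^ (n + 1)

section softThreshold

variable {θ : ℝ} (hθ : 0 < θ)
include hθ

lemma continuous_softThreshold (n : ℕ) : Continuous (softThreshold θ n) :=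
  Continuous.div (by fun_prop) (by fun_prop) fun t => by
    have : 0 < max t θ := lt_max_of_lt_right hθ
    positivity

lemma softThreshold_apply_zero (n : ℕ) : softThreshold θ n 0 = 0 := by
  simp [softThreshold, hθ.le]

lemma softThreshold_eq_mul_succ (n : ℕ) (t : ℝ) :
    softThreshold θ n t = t * softThreshold θ (n + 1) t := by
  unfold softThreshold
  rcases le_total t θ with h | h
  · simp [h]
  · have : t ≠ 0 := (hθ.trans_le h).ne'
    rw [max_eq_left h]
    field_simp
    ring

lemma one_sub_softThreshold_zero (t : ℝ) : 1 - softThreshold θ 0 t = θ / max t θ := by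
  unfold softThreshold
  rcases le_total t θ with h | h
  · simp [h, hθ.ne']
  · have : t ≠ 0 := (hθ.trans_le h).ne'
    rw [max_eq_left h, max_eq_right (sub_nonneg.2 h)]
    field_simp
    ring

lemma norm_softThreshold_le (n : ℕ) (t : ℝ) : ‖softThreshold θ n t‖ ≤ (θ ^ n)⁻¹ := by
  have hm : 0 < max t θ := lt_max_of_lt_right hθ
  have h1 : max 0 (t - θ) / max t θ ≤ 1 := by
    rw [div_le_one hm]
    exact max_le hm.le ((sub_le_self _ hθ.le).trans (le_max_left _ _))
  unfold softThreshold
  rw [Real.norm_of_nonneg (by positivity), pow_succ, ← div_div, div_right_comm, ← one_div (θ ^ n)]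
  gcongr
  exact le_max_right _ _

lemma norm_mul_one_sub_softThreshold_le {t : ℝ} (ht : 0 ≤ t) :
    ‖(1 - softThreshold θ 0 t) * t * (1 - softThreshold θ 0 t)‖ ≤ θ := by
  have hm : 0 < max t θ := lt_max_of_lt_right hθ
  rw [one_sub_softThreshold_zero hθ, Real.norm_of_nonneg (by positivity)]
  calc θ / max t θ * t * (θ / max t θ) = θ * (t / max t θ) * (θ / max t θ) := by ring
    _ ≤ θ * 1 * 1 := by
      gcongr
      · exact div_le_one_of_le₀ (le_max_left _ _) hm.le
      · exact div_le_one_of_le₀ (le_max_right _ _) hm.le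
    _ = θ := by ring

end softThreshold

section CStarAlgebra

variable {A : Type*} [CStarAlgebra A]

lemma cfcₙ_softThreshold_zero_eq_pow_mul {θ : ℝ} (hθ : 0 < θ) {h : A} (hh : IsSelfAdjoint h)
    (n : ℕ) : cfcₙ (softThreshold θ 0) h = h ^ n * cfcₙ (softThreshold θ n) h := by
  have hcont : ∀ n, ContinuousOn (softThreshold θ n) (quasispectrum ℝ h) := fun n =>
    (continuous_softThreshold hθ n).continuousOn
  induction n with
  | zero => rw [pow_zero, one_mul]
  | succ n ih =>
    have hstep : cfcₙ (softThreshold θ n) h = h * cfcₙ (softThreshold θ (n + 1)) h := by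
      rw [funext (softThreshold_eq_mul_succ hθ n), cfcₙ_mul _ _ h (by fun_prop) rfl (hcont _)
        (softThreshold_apply_zero hθ _), cfcₙ_id' ℝ h]
    rw [ih, hstep, pow_succ, mul_assoc]

lemma norm_sub_mul_cfcₙ_softThreshold_sq_le [PartialOrder A] [StarOrderedRing A] {θ : ℝ}
    (hθ : 0 < θ) (d : A) :
    ‖d - d * cfcₙ (softThreshold θ 0) (star d * d)‖ ^ 2 ≤ θ := by
  set h := star d * d with hh
  have hh0 : 0 ≤ h := star_mul_self_nonneg d
  have hcont : Continuous (softThreshold θ 0) := continuous_softThreshold hθ 0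
  have hdefect : d - d * cfcₙ (softThreshold θ 0) h = d * cfc (1 - softThreshold θ 0 ·) h := by
    rw [cfcₙ_eq_cfc (hf0 := softThreshold_apply_zero hθ 0), cfc_sub (fun _ => 1) _ h,
      cfc_const_one ℝ h, mul_sub, mul_one]
  have hself : star (cfc (1 - softThreshold θ 0 ·) h) = cfc (1 - softThreshold θ 0 ·) h :=
    (cfc_predicate (R := ℝ) (p := IsSelfAdjoint) _ h).star_eq
  rw [hdefect, sq, ← CStarRing.norm_star_mul_self, star_mul, hself]
  have hcfc : cfc (1 - softThreshold θ 0 ·) h * star d * (d * cfc (1 - softThreshold θ 0 ·) h) =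
      cfc (fun t => (1 - softThreshold θ 0 t) * t * (1 - softThreshold θ 0 t)) h := by
    rw [cfc_mul (fun t => (1 - softThreshold θ 0 t) * t) _ h, cfc_mul _ _ h, cfc_id' ℝ h, hh]
    noncomm_ring
  rw [hcfc]
  exact norm_cfc_le hθ.le fun t ht =>
    norm_mul_one_sub_softThreshold_le hθ (spectrum_nonneg_of_nonneg hh0 ht)

variable {B : Type*} [NormedRing B] [StarRing B] [NormedAlgebra ℂ B] {q : A →⋆ₐ[ℂ] B}
  {J : Submodule ℂ B}

/-- Modulo the ideal `J` the element `q h` has norm `< θ`, so that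
`softThreshold θ 0 (h) = h ^ n * softThreshold θ n (h)` tends to `0` modulo `J`. -/
lemma map_cfcₙ_softThreshold_mem (hq : ∀ a, ‖q a‖ ≤ ‖a‖) (hJ : IsClosed (J : Set B))
    {h : A} (hh : IsSelfAdjoint h) (hl : ∀ x ∈ J, q h * x ∈ J)
    (hr : ∀ f : ℝ → ℝ, ∀ x ∈ J, x * q (cfcₙ f h) ∈ J) {j : B} (hj : j ∈ J)
    (hjl : ∀ x ∈ J, j * x ∈ J) {θ : ℝ} (hθ : ‖q h - j‖ < θ) :
    q (cfcₙ (softThreshold θ 0) h) ∈ J := by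
  have hθ0 : 0 < θ := (norm_nonneg _).trans_lt hθ
  set r : B := q h - j with hr_def
  have hpow : ∀ n, q h ^ n - r ^ n ∈ J := fun n =>
    pow_sub_pow_mem_of_sub_mem (J := J.toAddSubgroup) (by simpa [r] using hj)
      (fun x hx => by rw [hr_def, sub_mul]; exact sub_mem (hl x hx) (hjl x hx))
      (fun x hx => cfcₙ_id ℝ h ▸ hr id x hx) n
  have hlim : Filter.Tendsto (fun n => (q h ^ (n + 1) - r ^ (n + 1)) *
      q (cfcₙ (softThreshold θ (n + 1)) h)) Filter.atTop
      (nhds (q (cfcₙ (softThreshold θ 0) h))) := by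
    have hgeom : Filter.Tendsto (fun n : ℕ => (‖r‖ / θ) ^ (n + 1)) Filter.atTop (nhds 0) :=
      (tendsto_pow_atTop_nhds_zero_of_lt_one (by positivity) ((div_lt_one hθ0).2 hθ)).comp
        (Filter.tendsto_add_atTop_nat 1)
    rw [tendsto_iff_norm_sub_tendsto_zero]
    refine squeeze_zero (fun _ => norm_nonneg _) (fun n => ?_) hgeom
    rw [cfcₙ_softThreshold_zero_eq_pow_mul hθ0 hh (n + 1), map_mul, map_pow, sub_mul,
      sub_sub_cancel_left, norm_neg, div_pow, div_eq_mul_inv]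
    exact norm_mul_le_of_le (norm_pow_le' r n.succ_pos)
      ((hq _).trans (norm_cfcₙ_le fun t _ => norm_softThreshold_le hθ0 _ t))
  exact hJ.mem_of_tendsto hlim (Filter.Eventually.of_forall fun n => hr _ _ (hpow _))

lemma exists_mem_inter_norm_sub_le [PartialOrder A] [StarOrderedRing A] [NormedStarGroup B]
    [StarModule ℂ B] (hq : ∀ a, ‖q a‖ ≤ ‖a‖) (hsurj : Function.Surjective q)
    {C : NonUnitalStarSubalgebra ℂ B} (hC : IsClosed (C : Set B)) (hJ : IsClosed (J : Set B))
    (hl : ∀ a ∈ C, ∀ x ∈ J, a * x ∈ J) (hr : ∀ a ∈ C, ∀ x ∈ J, x * a ∈ J)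
    (hJJ : ∀ a ∈ J, ∀ x ∈ J, a * x ∈ J) {x c : B} (hx : x ∈ J) (hc : c ∈ C) {δ : ℝ} (hδ : 0 < δ)
    (hxc : ‖c - x‖ ≤ δ) : ∃ y ∈ J, y ∈ C ∧ ‖c - y‖ ^ 2 ≤ 2 * ((‖x‖ + δ) * δ) := by
  obtain ⟨d, rfl⟩ := hsurj c
  have hqh : q (star d * d) = star (q d) * q d := by rw [map_mul, map_star]
  have hqhC : q (star d * d) ∈ C := hqh ▸ mul_mem (star_mem hc) hc
  have hcfc : ∀ f : ℝ → ℝ, q (cfcₙ f (star d * d)) ∈ C := fun f =>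
    cfcₙ_mem (s := C.comap (q : A →⋆ₙₐ[ℂ] B))
      (hs := hC.preimage (AddMonoidHomClass.continuous_of_bound q 1 fun a => by simpa using hq a))
      f hqhC
  have hj : star (q d) * x ∈ J := hl _ (star_mem hc) _ hx
  have hη : 0 < (‖x‖ + δ) * δ := by positivity
  have hdist : ‖q (star d * d) - star (q d) * x‖ ≤ (‖x‖ + δ) * δ := by
    have hd : ‖q d‖ ≤ ‖x‖ + δ := (norm_le_norm_add_norm_sub' _ _).trans (by gcongr)
    rw [hqh, ← mul_sub]
    exact norm_mul_le_of_le (by rwa [norm_star]) hxc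
  have hcut : q (cfcₙ (softThreshold (2 * ((‖x‖ + δ) * δ)) 0) (star d * d)) ∈ J :=
    map_cfcₙ_softThreshold_mem hq hJ (.star_mul_self d) (hl _ hqhC) (fun f => hr _ (hcfc f)) hj
      (hJJ _ hj) (hdist.trans_lt (by linarith))
  refine ⟨_, hl _ hc _ hcut, mul_mem hc (hcfc _), ?_⟩
  rw [← map_mul, ← map_sub]
  exact (pow_le_pow_left₀ (norm_nonneg _) (hq _) 2).trans
    (norm_sub_mul_cfcₙ_softThreshold_sq_le (by positivity) d)

end CStarAlgebra

/-! ### Matrix entries along a family with `∑ wᵢ wᵢ^* = 1` -/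

section Entries

variable {B ι κ : Type*} [Ring B] [StarRing B] [Fintype ι] [Fintype κ] {w : ι → B} {w' : κ → B}

lemma mul_mul_mul_eq_sum_entries (hw : ∑ i, w i * star (w i) = 1) (a x y b : B) :
    a * (x * y) * b = ∑ i, (a * x * w i) * (star (w i) * y * b) := by
  have h : a * (x * y) * b = a * x * (∑ i, w i * star (w i)) * (y * b) := by
    rw [hw]; noncomm_ring
  rw [h, Finset.mul_sum, Finset.sum_mul]
  exact Finset.sum_congr rfl fun i _ => by noncomm_ring

lemma eq_sum_entries (hw : ∑ i, w i * star (w i) = 1) (hw' : ∑ j, w' j * star (w' j) = 1) (x : B) :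
    x = ∑ i, ∑ j, w i * (star (w i) * x * w' j) * star (w' j) := by
  calc x = (∑ i, w i * star (w i)) * x * ∑ j, w' j * star (w' j) := by
        rw [hw, hw', one_mul, mul_one]
    _ = ∑ i, ∑ j, w i * star (w i) * x * (w' j * star (w' j)) := by
        simp only [Finset.sum_mul, Finset.mul_sum]
        exact Finset.sum_comm
    _ = _ := by simp only [mul_assoc]

lemma mul_star_mul_eq_star (x y z : B) : star x * star y * z = star (star z * y * x) := by
  simp only [star_mul, star_star, mul_assoc]

variable [Algebra ℂ B]

/-- The `*`-algebra of all elements whose matrix entries `wᵢ^* x wⱼ` lie in `A`. -/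
def entryAlg (hw : ∑ i, w i * star (w i) = 1) (A : NonUnitalStarSubalgebra ℂ B) :
    NonUnitalStarSubalgebra ℂ B where
  carrier := {x | ∀ i j, star (w i) * x * w j ∈ A}
  zero_mem' := fun i j => by simp
  add_mem' := fun {x y} hx hy i j => by
    rw [mul_add, add_mul]
    exact add_mem (hx i j) (hy i j)
  mul_mem' := fun {x y} hx hy i j => by
    rw [mul_mul_mul_eq_sum_entries hw]
    exact sum_mem fun g _ => mul_mem (hx i g) (hy g j)
  smul_mem' := fun c x hx i j => by
    rw [mul_smul_comm, smul_mul_assoc]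
    exact SMulMemClass.smul_mem c (hx i j)
  star_mem' := fun {x} hx i j => by
    rw [mul_star_mul_eq_star]
    exact star_mem (hx j i)

lemma isClosed_entryAlg [TopologicalSpace B] [IsTopologicalSemiring B]
    (hw : ∑ i, w i * star (w i) = 1) {A : NonUnitalStarSubalgebra ℂ B}
    (hA : IsClosed (A : Set B)) : IsClosed (entryAlg hw A : Set B) := by
  have h : (entryAlg hw A : Set B) = ⋂ i, ⋂ j, (fun x => star (w i) * x * w j) ⁻¹' A := by
    ext x
    simp only [Set.mem_iInter]
    rfl
  rw [h]
  exact isClosed_iInter fun i => isClosed_iInter fun j => hA.preimage (by fun_prop)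

/-- The `*`-algebra of all elements whose matrix `(wᵢ^* x wⱼ)` is diagonal. -/
def diagonalAlg (hw : ∑ i, w i * star (w i) = 1) : NonUnitalStarSubalgebra ℂ B where
  carrier := {x | ∀ i j, i ≠ j → star (w i) * x * w j = 0}
  zero_mem' := fun i j _ => by simp
  add_mem' := fun {x y} hx hy i j hij => by rw [mul_add, add_mul, hx i j hij, hy i j hij, add_zero]
  mul_mem' := fun {x y} hx hy i j hij => by
    rw [mul_mul_mul_eq_sum_entries hw]
    refine Finset.sum_eq_zero fun g _ => ?_
    rcases eq_or_ne i g with rfl | hig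
    · rw [hy i j hij, mul_zero]
    · rw [hx i g hig, zero_mul]
  smul_mem' := fun c x hx i j hij => by rw [mul_smul_comm, smul_mul_assoc, hx i j hij, smul_zero]
  star_mem' := fun {x} hx i j hij => by rw [mul_star_mul_eq_star, hx j i hij.symm, star_zero]

lemma isClosed_diagonalAlg [TopologicalSpace B] [IsTopologicalSemiring B] [T2Space B]
    (hw : ∑ i, w i * star (w i) = 1) : IsClosed (diagonalAlg hw : Set B) := by
  have h : (diagonalAlg hw : Set B) = ⋂ i, ⋂ j, {x | i ≠ j → star (w i) * x * w j = 0} := by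
    ext x
    simp only [Set.mem_iInter]
    rfl
  rw [h]
  refine isClosed_iInter fun i => isClosed_iInter fun j => ?_
  by_cases hij : i = j
  · simp only [hij, ne_eq, not_true_eq_false, false_implies, Set.ofPred_true, isClosed_univ]
  · simp only [hij, ne_eq, not_false_eq_true, forall_const]
    exact isClosed_eq (by fun_prop) continuous_const

lemma mul_eq_of_mem_diagonalAlg {hw : ∑ i, w i * star (w i) = 1} {x : B}
    (hx : x ∈ diagonalAlg hw) (i : ι) : x * w i = w i * (star (w i) * x * w i) := by
  calc x * w i = ∑ j, w j * (star (w j) * x * w i) := by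
        simpa only [one_mul, mul_one, mul_assoc] using mul_mul_mul_eq_sum_entries hw 1 1 x (w i)
    _ = _ := Finset.sum_eq_single i (fun j _ hji => by rw [hx j i hji, mul_zero])
        fun hi => absurd (Finset.mem_univ i) hi

end Entries

namespace DirGraph

variable {V Ed : Type*} {G : DirGraph V Ed}

namespace Path

variable {k : ℕ}

lemma edges_zero (α : G.Path 0) : α.edges = [] := List.eq_nil_of_length_eq_zero α.length_eq

lemma range_zero (α : G.Path 0) : α.range = α.source := by
  rw [range, edges_zero]
  rfl

/-- The vertex `v` as a path of length `0`. -/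
def ofVertex (v : V) : G.Path 0 := ⟨v, [], rfl, trivial⟩

lemma ofVertex_source (α : G.Path 0) : ofVertex α.source = α :=
  Path.ext rfl α.edges_zero.symm

lemma sum_zero [Fintype V] [Finite Ed] {M : Type*} [AddCommMonoid M] (F : G.Path 0 → M) :
    ∑ α, F α = ∑ v, F (ofVertex v) :=
  (Fintype.sum_bijective ofVertex
    ⟨fun _ _ h => congrArg Path.source h, fun α => ⟨_, ofVertex_source α⟩⟩ _ _
    fun _ => rfl).symm

/-- The first edge of a path of positive length. -/
def head (α : G.Path (k + 1)) : Ed := α.edges.head (by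
  intro h
  have := α.length_eq
  simp [h] at this)

/-- The path `e α`, for `s(e) = r(α)`. -/
def cons (e : Ed) (α : G.Path k) (h : G.s e = α.range) : G.Path (k + 1) where
  source := α.source
  edges := e :: α.edges
  length_eq := by simp [α.length_eq]
  isPath := ⟨h, α.isPath⟩

lemma edges_eq (α : G.Path (k + 1)) : α.edges = α.head :: α.tail.edges :=
  (List.cons_head_tail _).symm

lemma s_head (α : G.Path (k + 1)) : G.s α.head = α.tail.range := by
  have h := α.isPath
  rw [edges_eq] at h
  exact h.1

lemma range_eq (α : G.Path (k + 1)) : α.range = G.r α.head := by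
  rw [range, edges_eq]
  rfl

@[simp] lemma cons_head_tail (α : G.Path (k + 1)) : cons α.head α.tail α.s_head = α :=
  Path.ext rfl (edges_eq α).symm

@[simp] lemma head_cons (e : Ed) (α : G.Path k) (h) : (cons e α h).head = e := rfl

@[simp] lemma tail_cons (e : Ed) (α : G.Path k) (h) : (cons e α h).tail = α := rfl

@[simp] lemma source_tail (α : G.Path (k + 1)) : α.tail.source = α.source := rfl

lemma head?_edges (α : G.Path (k + 1)) (e : Ed) : α.edges.head? = some e ↔ α.head = e := by
  rw [edges_eq]
  simp

lemma head_tail_injective :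
    Function.Injective fun α : G.Path (k + 1) => (α.head, α.tail) := by
  intro α β h
  have h1 : α.head = β.head := congrArg Prod.fst h
  have h2 : α.tail = β.tail := congrArg Prod.snd h
  have h3 : α.tail.source = β.tail.source := congrArg Path.source h2
  refine Path.ext h3 ?_
  rw [edges_eq, edges_eq β, h1, h2]

open Classical in
lemma sum_succ [Finite V] [Fintype Ed] {M : Type*} [AddCommMonoid M] (F : G.Path (k + 1) → M) :
    ∑ β, F β = ∑ e, ∑ γ : G.Path k, if h : G.s e = γ.range then F (cons e γ h) else 0 := by
  rw [← Fintype.sum_prod_type']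
  refine Fintype.sum_of_injective (fun α : G.Path (k + 1) => (α.head, α.tail))
    head_tail_injective _ _ ?_ ?_
  · rintro ⟨e, γ⟩ hx
    refine dif_neg fun h => hx ⟨cons e γ h, rfl⟩
  · intro α
    simp [s_head]

/-- The path `α e`, for `s(α) = r(e)`. -/
def snoc (α : G.Path k) (e : Ed) (h : α.source = G.r e) : G.Path (k + 1) where
  source := G.s e
  edges := α.edges ++ [e]
  length_eq := by simp [α.length_eq]
  isPath := by
    have key : ∀ l : List Ed, G.IsPathWord (G.r e) l → G.IsPathWord (G.s e) (l ++ [e]) := by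
      intro l
      induction l with
      | nil => exact fun _ => ⟨rfl, trivial⟩
      | cons f l ih =>
        rintro ⟨h1, h2⟩
        refine ⟨h1.trans ?_, ih h2⟩
        cases l <;> rfl
    exact key _ (h ▸ α.isPath)

lemma exists_source_eq (hG : G.NoSinks) (k : ℕ) (v : V) : ∃ α : G.Path k, α.source = v := by
  induction k with
  | zero => exact ⟨⟨v, [], rfl, trivial⟩, rfl⟩
  | succ k ih =>
    obtain ⟨α, hα⟩ := ih
    obtain ⟨e, he⟩ := hG α.range
    exact ⟨cons e α he, hα⟩

end Path

variable [Fintype V] [Fintype Ed]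

-- Shortcut instances: instance search on the subtype `𝓛` is slow without them.

instance : NormedRing G.adjointableOps := inferInstance

instance : Ring G.adjointableOps := inferInstance

instance : StarRing G.adjointableOps := inferInstance

instance : Algebra ℂ G.adjointableOps := inferInstance

instance : NormedAlgebra ℂ G.adjointableOps := inferInstance

instance : Module ℂ G.adjointableOps := inferInstance

instance : SMul ℂ G.adjointableOps := inferInstance

instance : Mul G.adjointableOps := inferInstance

instance : Star G.adjointableOps := inferInstance

/-! ### Creation and annihilation on the summands -/

namespace Xk

open Classical in
lemma create_apply (e : Ed) (k : ℕ) (ξ : G.Xk k) (β : G.Path (k + 1)) :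
    create e k ξ β = if β.head = e then ξ β.tail else 0 := by
  have : create e k ξ β = if β.edges.head? = some e then ξ β.tail else 0 := rfl
  simp only [this, Path.head?_edges]

open Classical in
lemma adjoint_create_apply (e : Ed) (k : ℕ) (ξ : G.Xk (k + 1)) (γ : G.Path k) :
    ContinuousLinearMap.adjoint (create e k) ξ γ =
      if h : G.s e = γ.range then ξ (γ.cons e h) else 0 := by
  have h1 : ContinuousLinearMap.adjoint (create e k) ξ γ =
      ⟪EuclideanSpace.single γ (1 : ℂ), ContinuousLinearMap.adjoint (create e k) ξ⟫_ℂ := by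
    rw [EuclideanSpace.inner_single_left, map_one, one_mul]
  rw [h1, ContinuousLinearMap.adjoint_inner_right, PiLp.inner_apply, Path.sum_succ,
    Finset.sum_eq_single e, Finset.sum_eq_single γ]
  · simp [create_apply]
  · intro γ' _ hγ
    split_ifs with h
    · simp [create_apply, hγ]
    · rfl
  · simp
  · intro e' _ he
    refine Finset.sum_eq_zero fun γ' _ => ?_
    split_ifs with h
    · simp [create_apply, he]
    · rfl
  · simp

lemma leftAct_apply (k : ℕ) (a : V → ℂ) (ξ : G.Xk k) (α : G.Path k) :
    leftAct G k a ξ α = a α.range * ξ α := rfl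

open Classical in
lemma adjoint_create_create (e f : Ed) (k : ℕ) (ξ : G.Xk k) :
    ContinuousLinearMap.adjoint (create e k) (create f k ξ) =
      if e = f then leftAct G k (Fock.delta (G.s e)) ξ else 0 := by
  ext γ
  rw [adjoint_create_apply]
  by_cases hef : e = f
  · subst hef
    by_cases h : G.s e = γ.range
    · rw [dif_pos h, if_pos rfl, leftAct_apply, h]
      simp [create_apply, Fock.delta]
    · rw [dif_neg h, if_pos rfl, leftAct_apply]
      simp [Fock.delta, Ne.symm h]
  · rw [if_neg hef]
    split_ifs
    · simp [create_apply, hef]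
    · rfl

lemma sum_create_adjoint_create (k : ℕ) (ξ : G.Xk (k + 1)) :
    ∑ e, create e k (ContinuousLinearMap.adjoint (create e k) ξ) = ξ := by
  classical
  ext β
  rw [WithLp.ofLp_sum, Finset.sum_apply, Finset.sum_eq_single β.head]
  · simp [create_apply, adjoint_create_apply, Path.s_head]
  · intro e _ he
    simp [create_apply, he.symm]
  · simp

lemma create_leftAct (e : Ed) (k : ℕ) (ξ : G.Xk k) :
    create e k (leftAct G k (Fock.delta (G.s e)) ξ) = create e k ξ := by
  classical
  ext β
  rw [create_apply, create_apply]
  split_ifs with h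
  · rw [leftAct_apply, ← Path.s_head, h]
    simp [Fock.delta]
  · rfl

lemma leftAct_create (e : Ed) (k : ℕ) (ξ : G.Xk k) :
    leftAct G (k + 1) (Fock.delta (G.r e)) (create e k ξ) = create e k ξ := by
  classical
  ext β
  rw [leftAct_apply, create_apply]
  split_ifs with h
  · rw [Path.range_eq, h]
    simp [Fock.delta]
  · simp

end Xk

/-! ### Diagonal operators -/

lemma adjointableOps_ext {X Y : G.adjointableOps} (h : ∀ (ξ : G.Fock) k, X.1 ξ k = Y.1 ξ k) :
    X = Y :=
  Subtype.ext (ContinuousLinearMap.ext fun ξ => by ext k : 2; exact h ξ k)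

lemma coe_sum_apply {ι : Type*} (s : Finset ι) (X : ι → G.adjointableOps) (ξ : G.Fock) (k : ℕ) :
    (∑ i ∈ s, X i).1 ξ k = ∑ i ∈ s, (X i).1 ξ k := by
  rw [AddSubmonoidClass.coe_finsetSum, _root_.sum_apply, lp.coeFn_sum, Finset.sum_apply]

lemma star_apply_eq_adjoint_apply {X : G.adjointableOps} {j k : ℕ} {T : G.Xk k →L[ℂ] G.Xk j}
    (hX : ∀ η, X.1 (lp.single 2 k η) = lp.single 2 j (T η)) (ξ : G.Fock) :
    (star X).1 ξ k = ContinuousLinearMap.adjoint T (ξ j) := by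
  refine ext_inner_left ℂ fun η => ?_
  calc ⟪η, (star X).1 ξ k⟫_ℂ = ⟪lp.single 2 k η, (star X).1 ξ⟫_ℂ :=
        (lp.inner_single_left k η _).symm
    _ = ⟪X.1 (lp.single 2 k η), ξ⟫_ℂ := ContinuousLinearMap.adjoint_inner_right _ _ _
    _ = ⟪T η, ξ j⟫_ℂ := by rw [hX, lp.inner_single_left]
    _ = ⟪η, ContinuousLinearMap.adjoint T (ξ j)⟫_ℂ :=
        (ContinuousLinearMap.adjoint_inner_right _ _ _).symm

/-- `X` is the diagonal operator `diag(T_0, T_1, …)`. -/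
def IsDiag (X : G.adjointableOps) (T : (k : ℕ) → (G.Xk k →L[ℂ] G.Xk k)) : Prop :=
  ∀ (ξ : G.Fock) (k : ℕ), X.1 ξ k = T k (ξ k)

namespace IsDiag

variable {X Y : G.adjointableOps} {T U : (k : ℕ) → (G.Xk k →L[ℂ] G.Xk k)}

lemma ext (hX : IsDiag X T) (hY : IsDiag Y T) : X = Y :=
  adjointableOps_ext fun ξ k => (hX ξ k).trans (hY ξ k).symm

lemma congr (hX : IsDiag X T) (h : T = U) : IsDiag X U := h ▸ hX

lemma one : IsDiag (1 : G.adjointableOps) fun _ => 1 := fun _ _ => rfl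

lemma zero : IsDiag (0 : G.adjointableOps) fun _ => 0 := fun _ _ => rfl

lemma add (hX : IsDiag X T) (hY : IsDiag Y U) : IsDiag (X + Y) fun k => T k + U k :=
  fun ξ k => congrArg₂ (· + ·) (hX ξ k) (hY ξ k)

lemma sub (hX : IsDiag X T) (hY : IsDiag Y U) : IsDiag (X - Y) fun k => T k - U k :=
  fun ξ k => congrArg₂ (· - ·) (hX ξ k) (hY ξ k)

lemma smul (c : ℂ) (hX : IsDiag X T) : IsDiag (c • X) fun k => c • T k :=
  fun ξ k => congrArg (c • ·) (hX ξ k)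

lemma mul (hX : IsDiag X T) (hY : IsDiag Y U) : IsDiag (X * Y) fun k => T k * U k :=
  fun ξ k => (hX (Y.1 ξ) k).trans (congrArg (T k) (hY ξ k))

lemma pow (hX : IsDiag X T) (n : ℕ) : IsDiag (X ^ n) fun k => T k ^ n := by
  induction n with
  | zero => simpa only [pow_zero] using one
  | succ n ih => simpa only [pow_succ] using ih.mul hX

lemma star (hX : IsDiag X T) : IsDiag (star X) fun k => Star.star (T k) := fun ξ k => by
  refine star_apply_eq_adjoint_apply (fun η => ?_) ξ
  ext j : 2
  rw [hX]
  by_cases hj : j = k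
  · subst hj; simp
  · rw [lp.single_apply_ne 2 _ _ hj, lp.single_apply_ne 2 _ _ hj, map_zero]

lemma norm_le (hX : IsDiag X T) {M : ℝ} (hM0 : 0 ≤ M) (hM : ∀ k, ‖T k‖ ≤ M) : ‖X‖ ≤ M := by
  refine ContinuousLinearMap.opNorm_le_bound X.1 hM0 fun ξ => ?_
  rw [← pow_le_pow_iff_left₀ (norm_nonneg _) (by positivity) two_ne_zero, mul_pow, Fock.norm_sq,
    Fock.norm_sq, ← tsum_mul_left]
  refine Summable.tsum_le_tsum (fun k => ?_) (Fock.summable_sq _) ((Fock.summable_sq ξ).mul_left _)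
  rw [← mul_pow, hX]
  exact pow_le_pow_left₀ (norm_nonneg _) ((T k).le_of_opNorm_le (hM k) _) 2

end IsDiag

open Classical in
variable (G) in
/-- The projection `Q_k` onto the `k`-th summand. -/
def Q (k : ℕ) : G.adjointableOps :=
  ⟨Fock.diag (fun j => if j = k then 1 else 0)
    ⟨1, fun j => by
      split_ifs <;> simp [ContinuousLinearMap.norm_id_le, ContinuousLinearMap.one_def]⟩,
    Fock.isAdjointable_diag _ _ fun j v ξ => by split_ifs <;> simp⟩

open Classical in
lemma isDiag_Q (k : ℕ) : IsDiag (G.Q k) fun j => if j = k then 1 else 0 := fun _ _ => rfl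

open Classical in
lemma isDiag_sum_range_Q (n : ℕ) :
    IsDiag (∑ k ∈ Finset.range n, G.Q k) fun j => if j < n then 1 else 0 := by
  induction n with
  | zero => simpa using IsDiag.zero
  | succ n ih =>
    rw [Finset.sum_range_succ]
    refine (ih.add (isDiag_Q n)).congr (funext fun j => ?_)
    rcases lt_trichotomy j n with h | h | h
    · simp [h, h.ne, h.trans (Nat.lt_succ_self n)]
    · simp [h]
    · simp [h.ne', not_lt.2 h.le, not_lt.2 (Nat.succ_le_of_lt h)]

lemma isDiag_P (v : V) : IsDiag (G.P v) fun k => Xk.leftAct G k (Fock.delta v) := fun _ _ => rfl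

lemma isDiag_opL (Z : G.WeightSequence) : IsDiag Z.opL Z.op := fun _ _ => rfl

namespace Fock

variable {k : ℕ}

open Classical in
/-- The basis vector `δ_α` of the Fock correspondence. -/
def basisVec (α : G.Path k) : G.Fock := lp.single 2 k (EuclideanSpace.single α 1)

open Classical in
lemma basisVec_apply (α β : G.Path k) : basisVec α k β = if β = α then 1 else 0 := by
  simp [basisVec]

lemma basisVec_apply_of_ne (α : G.Path k) {j : ℕ} (hj : j ≠ k) : basisVec α j = 0 :=
  lp.single_apply_ne 2 _ _ hj

lemma inner_basisVec (α : G.Path k) (ζ : G.Fock) : ⟪basisVec α, ζ⟫_ℂ = ζ k α := by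
  classical
  rw [basisVec, lp.inner_single_left, EuclideanSpace.inner_single_left, map_one, one_mul]

lemma inner_basisVec_rightAct (α : G.Path k) (a : V → ℂ) (ζ : G.Fock) :
    ⟪basisVec α, rightAct G a ζ⟫_ℂ = a α.source * ⟪basisVec α, ζ⟫_ℂ := by
  rw [inner_basisVec, inner_basisVec]
  rfl

lemma rightAct_basisVec (a : V → ℂ) (α : G.Path k) :
    rightAct G a (basisVec α) = a α.source • basisVec α := by
  classical
  ext j β
  change a β.source * basisVec α j β = a α.source * basisVec α j β
  by_cases hj : j = k
  · subst hj
    by_cases hβ : β = α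
    · rw [hβ]
    · simp [basisVec_apply, hβ]
  · simp [basisVec_apply_of_ne α hj]

/-- The operator `θ_{δ_α, δ_α}`, the projection onto the line spanned by `δ_α`. -/
def basisProj (α : G.Path k) : G.adjointableOps :=
  ⟨InnerProductSpace.rankOne ℂ (basisVec α) (basisVec α), (isAdjointable_iff _).2 fun v ζ => by
    rw [InnerProductSpace.rankOne_apply, InnerProductSpace.rankOne_apply, inner_basisVec_rightAct,
      map_smul, rightAct_basisVec, smul_smul, mul_comm]⟩

lemma basisProj_apply (α : G.Path k) (ζ : G.Fock) :
    (basisProj α).1 ζ = ⟪basisVec α, ζ⟫_ℂ • basisVec α :=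
  InnerProductSpace.rankOne_apply ..

lemma basisProj_mem_rankOneOps (α : G.Path k) : basisProj α ∈ G.rankOneOps :=
  ⟨basisVec α, basisVec α, fun ζ => by
    rw [basisProj_apply, rightAct_basisVec, innerA_eq, inner_basisVec_rightAct]
    simp [delta]⟩

end Fock

lemma Q_eq_sum_basisProj (k : ℕ) : G.Q k = ∑ α : G.Path k, Fock.basisProj α := by
  classical
  refine adjointableOps_ext fun ζ j => ?_
  simp only [isDiag_Q k ζ j, coe_sum_apply, Fock.basisProj_apply, Fock.inner_basisVec,
    lp.coeFn_smul, Pi.smul_apply]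
  by_cases hj : j = k
  · subst hj
    ext β
    simp [WithLp.ofLp_sum, Finset.sum_apply, Fock.basisVec_apply]
  · simp [hj, Fock.basisVec_apply_of_ne _ hj]

lemma Q_mem_compactOps (k : ℕ) : G.Q k ∈ G.compactOps :=
  Q_eq_sum_basisProj (G := G) k ▸ sum_mem fun α _ =>
    subset_closure (Submodule.subset_span (Fock.basisProj_mem_rankOneOps α))

lemma IsDiag.mem_compactOps {X : G.adjointableOps} {T : (k : ℕ) → (G.Xk k →L[ℂ] G.Xk k)}
    (hX : IsDiag X T) (hT : Filter.Tendsto (fun k => ‖T k‖) Filter.atTop (nhds 0)) :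
    X ∈ G.compactOps := by
  classical
  have hclosed : IsClosed (G.compactOps : Set G.adjointableOps) := inferInstance
  refine SetLike.mem_coe.1 (hclosed.closure_subset_iff.2 subset_rfl (Metric.mem_closure_iff.2 ?_))
  intro ε hε
  obtain ⟨n, hn⟩ := Filter.eventually_atTop.1 (hT.eventually (gt_mem_nhds (half_pos hε)))
  refine ⟨X * ∑ k ∈ Finset.range n, G.Q k,
    Ideal.mul_mem_left _ _ (sum_mem fun k _ => Q_mem_compactOps k), ?_⟩
  rw [dist_eq_norm]
  refine lt_of_le_of_lt
    ((hX.sub (hX.mul (isDiag_sum_range_Q n))).norm_le (half_pos hε).le fun k => ?_)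
    (half_lt_self hε)
  by_cases hk : k < n
  · simp [hk, (half_pos hε).le]
  · simpa [hk] using (hn k (not_lt.1 hk)).le

/-! ### Relations in `𝓛` -/

lemma S_apply_zero (e : Ed) (ξ : G.Fock) : (G.S e).1 ξ 0 = 0 := rfl

lemma S_apply_succ (e : Ed) (ξ : G.Fock) (k : ℕ) : (G.S e).1 ξ (k + 1) = Xk.create e k (ξ k) := rfl

lemma star_S_apply (e : Ed) (ξ : G.Fock) (k : ℕ) :
    (star (G.S e)).1 ξ k = ContinuousLinearMap.adjoint (Xk.create e k) (ξ (k + 1)) := by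
  refine star_apply_eq_adjoint_apply (fun η => ?_) ξ
  ext j : 2
  cases j with
  | zero => rw [S_apply_zero, lp.single_apply_ne 2 _ _ (Nat.succ_ne_zero k).symm]
  | succ j =>
    rw [S_apply_succ]
    by_cases hj : j = k
    · subst hj; simp
    · rw [lp.single_apply_ne 2 _ _ hj, lp.single_apply_ne 2 _ _ (by simpa using hj), map_zero]

open Classical in
lemma star_S_mul_S (e f : Ed) : star (G.S e) * G.S f = if e = f then G.P (G.s e) else 0 := by
  refine adjointableOps_ext fun ξ k => ?_
  change (star (G.S e)).1 ((G.S f).1 ξ) k = _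
  rw [star_S_apply, S_apply_succ, Xk.adjoint_create_create]
  split_ifs <;> rfl

lemma S_mul_P (e : Ed) : G.S e * G.P (G.s e) = G.S e :=
  adjointableOps_ext fun ξ k => match k with
    | 0 => rfl
    | k + 1 => Xk.create_leftAct e k (ξ k)

lemma P_mul_S (e : Ed) : G.P (G.r e) * G.S e = G.S e :=
  adjointableOps_ext fun ξ k => match k with
    | 0 => map_zero (Xk.leftAct G 0 _)
    | k + 1 => Xk.leftAct_create e k (ξ k)

/-- The diagonal entries of `∑ₑ Sₑ diag(T_0, T_1, …) Sₑ^*`. -/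
def Xk.oneTensorSeq (T : (k : ℕ) → (G.Xk k →L[ℂ] G.Xk k)) : (k : ℕ) → (G.Xk k →L[ℂ] G.Xk k)
  | 0 => 0
  | k + 1 => Xk.oneTensor (T k)

lemma IsDiag.sum_S {X : G.adjointableOps} {T : (k : ℕ) → (G.Xk k →L[ℂ] G.Xk k)}
    (hX : IsDiag X T) : IsDiag (∑ e, G.S e * X * Star.star (G.S e)) (Xk.oneTensorSeq T) := by
  intro ξ k
  rw [coe_sum_apply]
  cases k with
  | zero => exact Finset.sum_eq_zero fun e _ => rfl
  | succ k =>
    rw [Xk.oneTensorSeq, Xk.oneTensor, _root_.sum_apply]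
    refine Finset.sum_congr rfl fun e _ => ?_
    change (G.S e).1 (X.1 ((Star.star (G.S e)).1 ξ)) (k + 1) = _
    rw [S_apply_succ, hX, star_S_apply]
    rfl

lemma sum_S_mul_star_S : ∑ e, G.S e * star (G.S e) = 1 - G.Q 0 := by
  classical
  have h := (IsDiag.one (G := G)).sum_S
  simp only [mul_one] at h
  refine h.ext ((IsDiag.one.sub (isDiag_Q 0)).congr (funext fun k => ?_))
  cases k with
  | zero => simp [Xk.oneTensorSeq]
  | succ k =>
    refine ContinuousLinearMap.ext fun ξ => ?_
    rw [Xk.oneTensorSeq, Xk.oneTensor, _root_.sum_apply]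
    simpa using (Xk.sum_create_adjoint_create k ξ).symm

lemma P_apply (v : V) (ξ : G.Fock) (k : ℕ) (α : G.Path k) :
    (G.P v).1 ξ k α = Fock.delta v α.range * ξ k α := rfl

lemma sum_P : ∑ v, G.P v = 1 := by
  classical
  refine adjointableOps_ext fun ξ k => ?_
  ext α
  rw [coe_sum_apply, WithLp.ofLp_sum, Finset.sum_apply]
  simp [P_apply, Fock.delta]

open Classical in
lemma P_mul_P (v w : V) : G.P v * G.P w = if v = w then G.P v else 0 := by
  refine adjointableOps_ext fun ξ k => ?_
  ext α
  change Fock.delta v α.range * (Fock.delta w α.range * ξ k α) = _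
  split_ifs with h
  · subst h
    by_cases hv : α.range = v <;> simp [P_apply, Fock.delta, hv]
  · by_cases hv : α.range = v <;> simp [Fock.delta, hv, h]

lemma star_P (v : V) : star (G.P v) = G.P v := by
  classical
  refine (isDiag_P v).star.ext ((isDiag_P v).congr (funext fun k => ?_))
  refine (ContinuousLinearMap.eq_adjoint_iff _ _).2 fun x y => ?_
  rw [PiLp.inner_apply, PiLp.inner_apply]
  refine Finset.sum_congr rfl fun α _ => ?_
  rw [Xk.leftAct_apply, Xk.leftAct_apply]
  by_cases h : α.range = v <;> simp [Fock.delta, h]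

lemma opL_mul_P (Z : G.WeightSequence) (v : V) : Z.opL * G.P v = G.P v * Z.opL :=
  ((isDiag_opL Z).mul (isDiag_P v)).ext
    (((isDiag_P v).mul (isDiag_opL Z)).congr (funext fun k => (Z.comm_left k _).symm))

lemma star_opL (Z : G.WeightSequence) : star Z.opL = Z.opL :=
  (isDiag_opL Z).star.ext ((isDiag_opL Z).congr
    (funext fun k => (Z.positive k).isSelfAdjoint.star_eq.symm))

/-! ### Relations in the quotient -/

variable (G) in
/-- The quotient map `q` as a `*`-homomorphism. -/
def qStar : G.adjointableOps →⋆ₐ[ℂ] G.QuotAlg where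
  __ := QuotAlg.q G
  map_star' := QuotAlg.q_star

lemma q_Q (k : ℕ) : QuotAlg.q G (G.Q k) = 0 := (QuotAlg.q_eq_zero_iff _).2 (Q_mem_compactOps k)

open Classical in
lemma star_u_mul_u (e f : Ed) : star (G.u e) * G.u f = if e = f then G.pv (G.s e) else 0 := by
  rw [u, u, ← QuotAlg.q_star, ← map_mul, star_S_mul_S]
  split_ifs
  exacts [rfl, map_zero _]

lemma star_u_mul_u_self (e : Ed) : star (G.u e) * G.u e = G.pv (G.s e) := by
  classical rw [star_u_mul_u, if_pos rfl]

lemma star_u_mul_u_of_ne {e f : Ed} (h : e ≠ f) : star (G.u e) * G.u f = 0 := by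
  classical rw [star_u_mul_u, if_neg h]

lemma sum_u_mul_star_u : ∑ e, G.u e * star (G.u e) = 1 := by
  have h := congrArg (QuotAlg.q G) (sum_S_mul_star_S (G := G))
  rw [map_sub, q_Q, sub_zero, map_one, map_sum] at h
  simpa only [map_mul, QuotAlg.q_star, u] using h

@[simp] lemma u_mul_pv (e : Ed) : G.u e * G.pv (G.s e) = G.u e := by
  rw [u, pv, ← map_mul, S_mul_P]

@[simp] lemma pv_mul_u (e : Ed) : G.pv (G.r e) * G.u e = G.u e := by
  rw [u, pv, ← map_mul, P_mul_S]

@[simp] lemma pv_mul_self (v : V) : G.pv v * G.pv v = G.pv v := by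
  classical rw [pv, ← map_mul, P_mul_P, if_pos rfl]

lemma pv_mul_pv_of_ne {v w : V} (h : v ≠ w) : G.pv v * G.pv w = 0 := by
  classical rw [pv, pv, ← map_mul, P_mul_P, if_neg h, map_zero]

@[simp] lemma star_pv (v : V) : star (G.pv v) = G.pv v := by
  rw [pv, ← QuotAlg.q_star, star_P]

lemma sum_pv : ∑ v, G.pv v = 1 := by
  have h := congrArg (QuotAlg.q G) (sum_P (G := G))
  rwa [map_sum, map_one] at h

lemma pv_mul_u_of_ne {v : V} {e : Ed} (h : v ≠ G.r e) : G.pv v * G.u e = 0 := by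
  rw [← pv_mul_u, ← mul_assoc, pv_mul_pv_of_ne h, zero_mul]

lemma star_u_mul_pv_of_ne {v : V} {e : Ed} (h : v ≠ G.r e) : star (G.u e) * G.pv v = 0 := by
  simpa only [star_mul, star_pv, star_zero] using congrArg star (pv_mul_u_of_ne h)

lemma u_mul_pv_of_ne {v : V} {e : Ed} (h : G.s e ≠ v) : G.u e * G.pv v = 0 := by
  rw [← u_mul_pv, mul_assoc, pv_mul_pv_of_ne h, mul_zero]

@[simp] lemma pv_mul_star_u (e : Ed) : G.pv (G.s e) * star (G.u e) = star (G.u e) := by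
  simpa only [star_mul, star_pv] using congrArg star (u_mul_pv (G := G) e)

@[simp] lemma star_u_mul_pv (e : Ed) : star (G.u e) * G.pv (G.r e) = star (G.u e) := by
  simpa only [star_mul, star_pv] using congrArg star (pv_mul_u (G := G) e)

namespace WeightSequence

variable (Z : G.WeightSequence)

lemma z_mul_pv (v : V) : Z.z * G.pv v = G.pv v * Z.z := by
  rw [z, pv, ← map_mul, opL_mul_P, map_mul]

end WeightSequence

/-! ### The map `x ↦ ∑ uₑ x uₑ^*` -/

/-- The map `x ↦ ∑ₑ uₑ x uₑ^*`, the image in the quotient of `T ↦ I ⊗ T`. -/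
def sumConj (x : G.QuotAlg) : G.QuotAlg := ∑ e, G.u e * x * star (G.u e)

lemma q_sum_S_mul_mul_star_S (X : G.adjointableOps) :
    QuotAlg.q G (∑ e, G.S e * X * star (G.S e)) = sumConj (QuotAlg.q G X) := by
  simp only [map_sum, map_mul, QuotAlg.q_star, sumConj, u]

lemma Xk.oneTensorSeq_iterate_apply (T : (k : ℕ) → (G.Xk k →L[ℂ] G.Xk k)) (n k : ℕ) :
    Xk.oneTensorSeq^[n] T (k + n) = Xk.idTensor (T k) n := by
  induction n with
  | zero => rfl
  | succ n ih =>
    rw [Function.iterate_succ_apply', Xk.idTensor, ← ih]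
    rfl

lemma WeightSequence.ConditionA.sumConj_iterate_z {Z : G.WeightSequence} {p : ℕ}
    (hA : Z.ConditionA p) : sumConj^[p] Z.z = Z.z := by
  set Φ : G.adjointableOps → G.adjointableOps := fun X => ∑ e, G.S e * X * star (G.S e)
  have hq : Function.Semiconj (QuotAlg.q G) Φ sumConj := q_sum_S_mul_mul_star_S
  have hdiag : ∀ n, IsDiag (Φ^[n] Z.opL) (Xk.oneTensorSeq^[n] Z.op) := fun n => by
    induction n with
    | zero => exact isDiag_opL Z
    | succ n ih =>
      rw [Function.iterate_succ_apply', Function.iterate_succ_apply']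
      exact ih.sum_S
  rw [WeightSequence.z, ← (hq.iterate_right p).eq, ← sub_eq_zero, ← map_sub,
    QuotAlg.q_eq_zero_iff]
  refine ((hdiag p).sub (isDiag_opL Z)).mem_compactOps ?_
  rw [← Filter.tendsto_add_atTop_iff_nat p]
  simp only [Xk.oneTensorSeq_iterate_apply]
  exact hA

open Classical in
lemma star_u_mul_sumConj_mul_u (x : G.QuotAlg) (e f : Ed) :
    star (G.u e) * sumConj x * G.u f =
      if e = f then G.pv (G.s e) * x * G.pv (G.s e) else 0 := by
  rw [sumConj, Finset.mul_sum, Finset.sum_mul, Finset.sum_eq_single e]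
  · have : star (G.u e) * (G.u e * x * star (G.u e)) * G.u f =
        (star (G.u e) * G.u e) * x * (star (G.u e) * G.u f) := by noncomm_ring
    rw [this, star_u_mul_u_self, star_u_mul_u]
    split_ifs <;> simp
  · intro g _ hg
    have : star (G.u e) * (G.u g * x * star (G.u g)) * G.u f =
        (star (G.u e) * G.u g) * x * (star (G.u g) * G.u f) := by noncomm_ring
    rw [this, star_u_mul_u_of_ne hg.symm]
    simp
  · simp

lemma sumConj_mem_diagonalAlg (x : G.QuotAlg) :
    sumConj x ∈ diagonalAlg (sum_u_mul_star_u (G := G)) :=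
  fun e f hef => by classical rw [star_u_mul_sumConj_mul_u, if_neg hef]

lemma sumConj_mul_u {x : G.QuotAlg} (hx : ∀ v, x * G.pv v = G.pv v * x) (e : Ed) :
    sumConj x * G.u e = G.u e * x := by
  classical
  rw [mul_eq_of_mem_diagonalAlg (sumConj_mem_diagonalAlg x), star_u_mul_sumConj_mul_u, if_pos rfl,
    ← hx, mul_assoc x, pv_mul_self, hx, ← mul_assoc, u_mul_pv]

lemma sumConj_mul_pv (x : G.QuotAlg) (v : V) : sumConj x * G.pv v = G.pv v * sumConj x := by
  rw [sumConj, Finset.sum_mul, Finset.mul_sum]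
  refine Finset.sum_congr rfl fun e _ => ?_
  by_cases h : v = G.r e
  · rw [h, mul_assoc, star_u_mul_pv, ← mul_assoc, ← mul_assoc, pv_mul_u]
  · rw [mul_assoc, star_u_mul_pv_of_ne h, ← mul_assoc, ← mul_assoc, pv_mul_u_of_ne h, mul_zero,
      zero_mul, zero_mul]

/-! ### The partial isometries of paths -/

section uPath

variable {k : ℕ}

lemma uPath_zero (α : G.Path 0) : uPath α = G.pv α.source := by
  rw [uPath, α.edges_zero]
  rfl

lemma uPath_succ (α : G.Path (k + 1)) : uPath α = G.u α.head * uPath α.tail := by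
  rw [uPath, Path.edges_eq]
  rfl

lemma uPath_cons (e : Ed) (α : G.Path k) (h) : uPath (α.cons e h) = G.u e * uPath α := rfl

lemma uPath_mul_pv (α : G.Path k) : uPath α * G.pv α.source = uPath α := by
  induction k with
  | zero => rw [uPath_zero, pv_mul_self]
  | succ k ih => rw [uPath_succ, mul_assoc, ← Path.source_tail, ih]

lemma uPath_mul_pv_of_ne (α : G.Path k) {v : V} (h : α.source ≠ v) : uPath α * G.pv v = 0 := by
  rw [← uPath_mul_pv, mul_assoc, pv_mul_pv_of_ne h, mul_zero]

lemma pv_mul_star_uPath (α : G.Path k) : G.pv α.source * star (uPath α) = star (uPath α) := by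
  simpa only [star_mul, star_pv] using congrArg star (uPath_mul_pv α)

lemma pv_mul_uPath (α : G.Path k) : G.pv α.range * uPath α = uPath α := by
  cases k with
  | zero =>
    rw [uPath_zero, α.range_zero, pv_mul_self]
  | succ k => rw [uPath_succ, Path.range_eq, ← mul_assoc, pv_mul_u]

lemma u_mul_uPath_of_ne {e : Ed} {α : G.Path k} (h : G.s e ≠ α.range) :
    G.u e * uPath α = 0 := by
  rw [← pv_mul_uPath, ← mul_assoc, u_mul_pv_of_ne h, zero_mul]

lemma uPath_snoc (α : G.Path k) (e : Ed) (h : α.source = G.r e) :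
    uPath (α.snoc e h) = uPath α * G.u e := by
  have key : ∀ (l : List Ed) (v : V), v = G.r e →
      (l ++ [e]).foldr (fun e x => G.u e * x) (G.pv (G.s e)) =
        l.foldr (fun e x => G.u e * x) (G.pv v) * G.u e := by
    intro l v hv
    induction l with
    | nil => rw [List.nil_append, List.foldr_cons, List.foldr_nil, List.foldr_nil, hv, pv_mul_u,
        u_mul_pv]
    | cons f l ih => simp only [List.cons_append, List.foldr_cons, mul_assoc, ih]
  exact key α.edges α.source h

open Classical in
lemma star_uPath_mul_uPath (α β : G.Path k) :
    star (uPath α) * uPath β = if α = β then G.pv α.source else 0 := by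
  induction k with
  | zero =>
    rw [uPath_zero, uPath_zero, star_pv]
    split_ifs with h
    · rw [h, pv_mul_self]
    · refine pv_mul_pv_of_ne fun hs => h (Path.ext hs ?_)
      rw [α.edges_zero, β.edges_zero]
  | succ k ih =>
    rw [uPath_succ, uPath_succ, star_mul, mul_assoc, ← mul_assoc _ (G.u _)]
    by_cases hh : α.head = β.head
    · rw [hh, star_u_mul_u_self, Path.s_head, pv_mul_uPath, ih]
      have htail : α = β ↔ α.tail = β.tail :=
        ⟨fun h => h ▸ rfl, fun h => Path.head_tail_injective (Prod.ext hh h)⟩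
      simp only [htail]
      rfl
    · rw [star_u_mul_u_of_ne hh, zero_mul, mul_zero, if_neg fun h => hh (congrArg Path.head h)]

lemma star_uPath_mul_self (α : G.Path k) : star (uPath α) * uPath α = G.pv α.source := by
  classical rw [star_uPath_mul_uPath, if_pos rfl]

lemma star_uPath_mul_mul_uPath_succ (α β : G.Path (k + 1)) (x : G.QuotAlg) :
    star (uPath α) * x * uPath β =
      star (uPath α.tail) * (star (G.u α.head) * x * G.u β.head) * uPath β.tail := by
  rw [uPath_succ, uPath_succ, star_mul]; noncomm_ring

lemma uPath_mul_mul_star_uPath_succ (α β : G.Path (k + 1)) (x : G.QuotAlg) :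
    uPath α * x * star (uPath β) =
      G.u α.head * (uPath α.tail * x * star (uPath β.tail)) * star (G.u β.head) := by
  rw [uPath_succ, uPath_succ, star_mul]; noncomm_ring

lemma star_uPath_mul_mul_uPath_mem {X : Set G.QuotAlg}
    (pv_mul_mem : ∀ v w, ∀ x ∈ X, G.pv v * x * G.pv w ∈ X)
    (star_u_mul_mem : ∀ e f, ∀ x ∈ X, star (G.u e) * x * G.u f ∈ X)
    (α β : G.Path k) {x : G.QuotAlg} (hx : x ∈ X) : star (uPath α) * x * uPath β ∈ X := by
  induction k generalizing x with
  | zero =>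
    rw [uPath_zero, uPath_zero, star_pv]
    exact pv_mul_mem _ _ _ hx
  | succ k ih =>
    rw [star_uPath_mul_mul_uPath_succ]
    exact ih _ _ (star_u_mul_mem _ _ _ hx)

lemma uPath_mul_mul_star_uPath_mem {X : Set G.QuotAlg}
    (pv_mul_mem : ∀ v w, ∀ x ∈ X, G.pv v * x * G.pv w ∈ X)
    (u_mul_mem : ∀ e f, ∀ x ∈ X, G.u e * x * star (G.u f) ∈ X)
    (α β : G.Path k) {x : G.QuotAlg} (hx : x ∈ X) : uPath α * x * star (uPath β) ∈ X := by
  induction k with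
  | zero =>
    rw [uPath_zero, uPath_zero, star_pv]
    exact pv_mul_mem _ _ _ hx
  | succ k ih =>
    rw [uPath_mul_mul_star_uPath_succ]
    exact u_mul_mem _ _ _ (ih _ _)

lemma sum_uPath_mul_mul_star_uPath {x : G.QuotAlg} (hx : ∀ v, x * G.pv v = G.pv v * x) :
    ∑ α : G.Path k, uPath α * x * star (uPath α) = sumConj^[k] x := by
  classical
  induction k with
  | zero =>
    rw [Path.sum_zero, Function.iterate_zero_apply]
    have hterm : ∀ v, uPath (Path.ofVertex v) * x * star (uPath (Path.ofVertex v)) = G.pv v * x :=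
      fun v => by
        rw [uPath_zero, star_pv, mul_assoc, hx, ← mul_assoc]
        exact congrArg (· * x) (pv_mul_self v)
    simp only [hterm]
    rw [← Finset.sum_mul, sum_pv, one_mul]
  | succ k ih =>
    rw [Path.sum_succ, Function.iterate_succ_apply', ← ih, sumConj]
    refine Finset.sum_congr rfl fun e _ => ?_
    rw [Finset.mul_sum, Finset.sum_mul]
    refine Finset.sum_congr rfl fun γ _ => ?_
    have h : G.u e * (uPath γ * x * star (uPath γ)) * star (G.u e) =
        (G.u e * uPath γ) * x * star (G.u e * uPath γ) := by
      rw [star_mul]; noncomm_ring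
    split_ifs with hs
    · rw [uPath_cons, h]
    · rw [h, u_mul_uPath_of_ne hs, zero_mul, zero_mul]

lemma sum_uPath_mul_star_uPath (k : ℕ) : ∑ α : G.Path k, uPath α * star (uPath α) = 1 := by
  have h := sum_uPath_mul_mul_star_uPath (G := G) (k := k) (x := 1) (by simp)
  simp only [mul_one] at h
  have h1 : sumConj (1 : G.QuotAlg) = 1 := by simpa [sumConj] using sum_u_mul_star_u (G := G)
  rw [h, Function.iterate_fixed h1]

end uPath

/-! ### The coefficient algebra -/

namespace WeightSequence

variable (Z : G.WeightSequence)

/-- The elements `z_j = ∑ u_α z u_α^*`, the sum over the paths `α` of length `j`. -/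
def zShift (j : ℕ) : G.QuotAlg := sumConj^[j] Z.z

lemma zShift_succ (j : ℕ) : Z.zShift (j + 1) = sumConj (Z.zShift j) :=
  Function.iterate_succ_apply' _ _ _

lemma zShift_mul_pv (j : ℕ) (v : V) : Z.zShift j * G.pv v = G.pv v * Z.zShift j := by
  cases j with
  | zero => exact Z.z_mul_pv v
  | succ j => rw [zShift_succ, sumConj_mul_pv]

lemma uPath_mul_zShift {k : ℕ} (α : G.Path k) (j : ℕ) :
    uPath α * Z.zShift j = Z.zShift (j + k) * uPath α := by
  induction k with
  | zero => rw [uPath_zero, add_zero, zShift_mul_pv]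
  | succ k ih =>
    rw [uPath_succ, mul_assoc, ih, ← mul_assoc, ← sumConj_mul_u (Z.zShift_mul_pv _), mul_assoc,
      ← zShift_succ]
    rfl

/-- The coefficient algebra: the closed `*`-subalgebra generated by the `z_j` and the `p_v`. Under
Condition A it is invariant under `x ↦ uₑ^* x u_f` and `x uₑ = uₑ (uₑ^* x uₑ)` for its elements `x`;
the elements of `q(𝓓)` are then limits of matrices over it. -/
def coeffAlg : NonUnitalStarSubalgebra ℂ G.QuotAlg :=
  (NonUnitalStarAlgebra.adjoin ℂ (Set.range Z.zShift ∪ Set.range G.pv)).topologicalClosure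

lemma isClosed_coeffAlg : IsClosed (Z.coeffAlg : Set G.QuotAlg) := isClosed_closure

lemma zShift_mem_coeffAlg (j : ℕ) : Z.zShift j ∈ Z.coeffAlg :=
  subset_closure (NonUnitalStarAlgebra.subset_adjoin ℂ _ (Or.inl ⟨j, rfl⟩))

lemma pv_mem_coeffAlg (v : V) : G.pv v ∈ Z.coeffAlg :=
  subset_closure (NonUnitalStarAlgebra.subset_adjoin ℂ _ (Or.inr ⟨v, rfl⟩))

lemma one_mem_coeffAlg : (1 : G.QuotAlg) ∈ Z.coeffAlg := by
  rw [← sum_pv]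
  exact sum_mem fun v _ => Z.pv_mem_coeffAlg v

lemma z_pow_mem_coeffAlg (l : ℕ) : Z.z ^ l ∈ Z.coeffAlg := by
  induction l with
  | zero => rw [pow_zero]; exact Z.one_mem_coeffAlg
  | succ l ih => rw [pow_succ]; exact mul_mem ih (Z.zShift_mem_coeffAlg 0)

lemma coeffAlg_le {A : NonUnitalStarSubalgebra ℂ G.QuotAlg} (hA : IsClosed (A : Set G.QuotAlg))
    (hz : ∀ j, Z.zShift j ∈ A) (hp : ∀ v, G.pv v ∈ A) : Z.coeffAlg ≤ A := by
  refine NonUnitalStarSubalgebra.topologicalClosure_minimal _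
    (NonUnitalStarAlgebra.adjoin_le (Set.union_subset ?_ ?_)) hA
  exacts [Set.range_subset_iff.2 hz, Set.range_subset_iff.2 hp]

variable {Z}

lemma mul_pv_of_mem_coeffAlg {x : G.QuotAlg} (hx : x ∈ Z.coeffAlg) (v : V) :
    x * G.pv v = G.pv v * x := by
  have hle : Z.coeffAlg ≤ NonUnitalStarSubalgebra.centralizer ℂ {G.pv v} := by
    refine Z.coeffAlg_le (Set.isClosed_centralizer _) (fun j => ?_) fun w => ?_ <;>
      simp only [NonUnitalStarSubalgebra.mem_centralizer_iff, Set.mem_singleton_iff, forall_eq,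
        star_pv, and_self]
    · exact (Z.zShift_mul_pv j v).symm
    · rcases eq_or_ne v w with rfl | h
      · rfl
      · rw [pv_mul_pv_of_ne h, pv_mul_pv_of_ne h.symm]
  exact ((NonUnitalStarSubalgebra.mem_centralizer_iff ℂ).1 (hle hx) _ rfl).1.symm

lemma uPath_mul_mul_star_uPath_of_ne {x : G.QuotAlg} (hx : x ∈ Z.coeffAlg) {k l : ℕ}
    {μ : G.Path k} {ν : G.Path l} (h : μ.source ≠ ν.source) :
    uPath μ * x * star (uPath ν) = 0 := by
  rw [← uPath_mul_pv μ, mul_assoc (uPath μ), ← mul_pv_of_mem_coeffAlg hx, ← mul_assoc, mul_assoc,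
    ← pv_mul_star_uPath, ← mul_assoc (G.pv _), pv_mul_pv_of_ne h, zero_mul, mul_zero]

section ConditionA

variable {p : ℕ} (hA : Z.ConditionA p)
include hA

lemma ConditionA.zShift_add_mul (j m : ℕ) : Z.zShift (j + m * p) = Z.zShift j := by
  rw [zShift, zShift, Function.iterate_add_apply, mul_comm, Function.iterate_mul,
    Function.iterate_fixed hA.sumConj_iterate_z]

lemma ConditionA.zShift_eq_sumConj (hp : 1 ≤ p) (j : ℕ) :
    Z.zShift j = sumConj (Z.zShift (j + p - 1)) := by
  rw [← zShift_succ, Nat.sub_add_cancel (hp.trans (Nat.le_add_left _ _)),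
    ← hA.zShift_add_mul j 1, one_mul]

variable (hp : 1 ≤ p)
include hp

lemma star_u_mul_mem_coeffAlg {x : G.QuotAlg} (hx : x ∈ Z.coeffAlg) (e f : Ed) :
    star (G.u e) * x * G.u f ∈ Z.coeffAlg := by
  classical
  suffices hle : Z.coeffAlg ≤ entryAlg sum_u_mul_star_u Z.coeffAlg from hle hx e f
  refine Z.coeffAlg_le (isClosed_entryAlg _ Z.isClosed_coeffAlg) (fun j e f => ?_) fun v e f => ?_
  · rw [hA.zShift_eq_sumConj hp, star_u_mul_sumConj_mul_u]
    split_ifs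
    exacts [mul_mem (mul_mem (Z.pv_mem_coeffAlg _) (Z.zShift_mem_coeffAlg _))
      (Z.pv_mem_coeffAlg _), zero_mem _]
  · rcases eq_or_ne v (G.r e) with rfl | h
    · rw [star_u_mul_pv, star_u_mul_u]
      split_ifs
      exacts [Z.pv_mem_coeffAlg _, zero_mem _]
    · rw [star_u_mul_pv_of_ne h, zero_mul]
      exact zero_mem _

lemma coeffAlg_le_diagonalAlg : Z.coeffAlg ≤ diagonalAlg sum_u_mul_star_u := by
  refine Z.coeffAlg_le (isClosed_diagonalAlg _) (fun j => ?_) fun v e f hef => ?_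
  · rw [hA.zShift_eq_sumConj hp]
    exact sumConj_mem_diagonalAlg _
  · rcases eq_or_ne v (G.r e) with rfl | h
    · rw [star_u_mul_pv, star_u_mul_u_of_ne hef]
    · rw [star_u_mul_pv_of_ne h, zero_mul]

lemma mul_u_of_mem_coeffAlg {x : G.QuotAlg} (hx : x ∈ Z.coeffAlg) (e : Ed) :
    x * G.u e = G.u e * (star (G.u e) * x * G.u e) :=
  mul_eq_of_mem_diagonalAlg (coeffAlg_le_diagonalAlg hA hp hx) e

end ConditionA

/-! ### The matrix algebras over the coefficient algebra -/

variable (Z) in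
/-- The algebra of matrices over the coefficient algebra indexed by the paths of length `k`. -/
def matAlg (k : ℕ) : NonUnitalStarSubalgebra ℂ G.QuotAlg :=
  entryAlg (sum_uPath_mul_star_uPath k) Z.coeffAlg

lemma isClosed_matAlg (k : ℕ) : IsClosed (Z.matAlg k : Set G.QuotAlg) :=
  isClosed_entryAlg _ Z.isClosed_coeffAlg

lemma uPath_mul_mem_matAlg {k : ℕ} {x : G.QuotAlg} (hx : x ∈ Z.coeffAlg) (μ ν : G.Path k) :
    uPath μ * x * star (uPath ν) ∈ Z.matAlg k := by
  classical
  intro α β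
  have h : star (uPath α) * (uPath μ * x * star (uPath ν)) * uPath β =
      (star (uPath α) * uPath μ) * x * (star (uPath ν) * uPath β) := by noncomm_ring
  rw [h, star_uPath_mul_uPath, star_uPath_mul_uPath]
  split_ifs
  · exact mul_mem (mul_mem (Z.pv_mem_coeffAlg _) hx) (Z.pv_mem_coeffAlg _)
  all_goals simp only [mul_zero, zero_mul, zero_mem]

lemma matAlg_zero : Z.matAlg 0 = Z.coeffAlg := by
  refine le_antisymm (fun x hx => ?_) fun x hx α β => ?_
  · rw [eq_sum_entries (sum_uPath_mul_star_uPath 0) (sum_uPath_mul_star_uPath 0) x]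
    refine sum_mem fun α _ => sum_mem fun β _ => ?_
    refine mul_mem (mul_mem ?_ (hx α β)) (star_mem ?_) <;> rw [uPath_zero] <;>
      exact Z.pv_mem_coeffAlg _
  · rw [uPath_zero, uPath_zero, star_pv]
    exact mul_mem (mul_mem (Z.pv_mem_coeffAlg _) hx) (Z.pv_mem_coeffAlg _)

lemma mem_matAlg_succ_iff {k : ℕ} {x : G.QuotAlg} :
    x ∈ Z.matAlg (k + 1) ↔ ∀ e f, star (G.u e) * x * G.u f ∈ Z.matAlg k := by
  refine ⟨fun hx e f α β => ?_, fun hx μ ν => ?_⟩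
  · have h : star (uPath α) * (star (G.u e) * x * G.u f) * uPath β =
        star (G.u e * uPath α) * x * (G.u f * uPath β) := by rw [star_mul]; noncomm_ring
    rw [h]
    by_cases hα : G.s e = α.range
    · by_cases hβ : G.s f = β.range
      · exact hx (α.cons e hα) (β.cons f hβ)
      · rw [u_mul_uPath_of_ne hβ, mul_zero]; exact zero_mem _
    · rw [u_mul_uPath_of_ne hα, star_zero, zero_mul, zero_mul]; exact zero_mem _
  · rw [star_uPath_mul_mul_uPath_succ]
    exact hx _ _ _ _

lemma C_le_of_forall {p n : ℕ} {A : NonUnitalStarSubalgebra ℂ G.QuotAlg}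
    (hA : IsClosed (A : Set G.QuotAlg))
    (h : ∀ (l k : ℕ) (α β : G.Path k), k < (n + 1) * p → uPath α * Z.z ^ l * star (uPath β) ∈ A) :
    Z.C p n ≤ A := by
  refine NonUnitalStarSubalgebra.topologicalClosure_minimal _
    (NonUnitalStarAlgebra.adjoin_le ?_) hA
  rintro _ ⟨l, k, α, β, -, hk, -, rfl⟩
  exact h l k α β hk

lemma uPath_mul_z_pow_mem_C {p n : ℕ} (l : ℕ) {k : ℕ} (hk : n * p ≤ k) (hk' : k < (n + 1) * p)
    {α β : G.Path k} (h : α.source = β.source) :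
    uPath α * Z.z ^ l * star (uPath β) ∈ Z.C p n :=
  subset_closure (NonUnitalStarAlgebra.subset_adjoin ℂ _ ⟨l, k, α, β, hk, hk', h, rfl⟩)

lemma uPath_mul_star_uPath_mem_C {p n k : ℕ} (hk : n * p ≤ k) (hk' : k < (n + 1) * p)
    {α β : G.Path k} (h : α.source = β.source) : uPath α * star (uPath β) ∈ Z.C p n := by
  simpa only [pow_zero, mul_one] using uPath_mul_z_pow_mem_C (Z := Z) 0 hk hk' h

section ConditionA

variable {p : ℕ} (hA : Z.ConditionA p)
include hA

lemma zShift_mem_C (hp : 1 ≤ p) (n j : ℕ) : Z.zShift j ∈ Z.C p n := by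
  have hj : Z.zShift j = Z.zShift (j % p + n * p) := by
    rw [hA.zShift_add_mul, ← hA.zShift_add_mul (j % p) (j / p), mul_comm, Nat.mod_add_div]
  have hmod := Nat.mod_lt j hp
  rw [hj, zShift, ← sum_uPath_mul_mul_star_uPath Z.z_mul_pv]
  refine sum_mem fun α _ => ?_
  simpa only [pow_one] using uPath_mul_z_pow_mem_C (Z := Z) 1 (Nat.le_add_left _ _)
    (by rw [add_mul]; omega) (rfl : α.source = α.source)

lemma uPath_mul_mem_C {n k : ℕ} (hk : n * p ≤ k) (hk' : k < (n + 1) * p) {x : G.QuotAlg}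
    (hx : x ∈ Z.coeffAlg) {μ ν : G.Path k} (h : μ.source = ν.source) :
    uPath μ * x * star (uPath ν) ∈ Z.C p n := by
  have hp : 1 ≤ p := Nat.pos_of_ne_zero fun hp0 => by simp [hp0] at hk'
  refine closure_minimal (fun y hy => ?_) ((isClosed_closure : IsClosed (Z.C p n : Set _)).preimage
    (by fun_prop : Continuous fun y => uPath μ * y * star (uPath ν))) hx
  change uPath μ * y * star (uPath ν) ∈ Z.C p n
  induction hy using NonUnitalStarAlgebra.adjoin_induction generalizing μ ν with
  | mem y hy =>
    obtain ⟨j, rfl⟩ | ⟨v, rfl⟩ := hy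
    · rw [uPath_mul_zShift, mul_assoc]
      exact mul_mem (zShift_mem_C hA hp n _) (uPath_mul_star_uPath_mem_C hk hk' h)
    · by_cases hv : μ.source = v
      · rw [← hv, uPath_mul_pv]
        exact uPath_mul_star_uPath_mem_C hk hk' h
      · rw [uPath_mul_pv_of_ne _ hv, zero_mul]
        exact zero_mem _
  | add y y' _ _ ihy ihy' =>
    rw [mul_add, add_mul]
    exact add_mem (ihy h) (ihy' h)
  | zero => rw [mul_zero, zero_mul]; exact zero_mem _
  | mul y y' hy _ ihy ihy' =>
    have hsplit : uPath μ * (y * y') * star (uPath ν) =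
        (uPath μ * y * star (uPath μ)) * (uPath μ * y' * star (uPath ν)) := by
      calc uPath μ * (y * y') * star (uPath ν)
          = uPath μ * (G.pv μ.source * y) * y' * star (uPath ν) := by
            rw [← mul_assoc (uPath μ) (G.pv _), uPath_mul_pv, ← mul_assoc (uPath μ) y y']
        _ = uPath μ * y * (star (uPath μ) * uPath μ) * y' * star (uPath ν) := by
            rw [star_uPath_mul_self, ← mul_pv_of_mem_coeffAlg (subset_closure hy), mul_assoc _ y]
        _ = _ := by noncomm_ring
    rw [hsplit]
    exact mul_mem (ihy rfl) (ihy' h)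
  | smul c y _ ihy =>
    rw [mul_smul_comm, smul_mul_assoc]
    exact SMulMemClass.smul_mem c (ihy h)
  | star y _ ihy =>
    have hstar : uPath μ * star y * star (uPath ν) = star (uPath ν * y * star (uPath μ)) := by
      simp only [star_mul, star_star, mul_assoc]
    rw [hstar]
    exact star_mem (ihy h.symm)

variable (hp : 1 ≤ p)
include hp

lemma matAlg_mono : Monotone Z.matAlg := by
  refine monotone_nat_of_le_succ fun k => ?_
  induction k with
  | zero =>
    intro x hx
    rw [mem_matAlg_succ_iff, matAlg_zero]
    rw [matAlg_zero] at hx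
    exact star_u_mul_mem_coeffAlg hA hp hx
  | succ k ih =>
    exact fun x hx => mem_matAlg_succ_iff.2 fun e f => ih (mem_matAlg_succ_iff.1 hx e f)

lemma coeffAlg_le_matAlg (k : ℕ) : Z.coeffAlg ≤ Z.matAlg k :=
  matAlg_zero.symm.trans_le (matAlg_mono hA hp (Nat.zero_le k))

lemma C_eq_matAlg (n : ℕ) : Z.C p n = Z.matAlg (n * p + (p - 1)) := by
  have hsucc : n * p + (p - 1) + 1 = (n + 1) * p := by rw [add_mul]; omega
  have hexp := sum_uPath_mul_star_uPath (G := G) (n * p + (p - 1))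
  refine le_antisymm (C_le_of_forall (isClosed_matAlg _) fun l k α β hk => ?_) fun x hx => ?_
  · exact matAlg_mono hA hp (by omega) (uPath_mul_mem_matAlg (Z.z_pow_mem_coeffAlg l) α β)
  · rw [eq_sum_entries hexp hexp x]
    refine sum_mem fun μ _ => sum_mem fun ν _ => ?_
    by_cases h : μ.source = ν.source
    · exact uPath_mul_mem_C hA (Nat.le_add_right _ _) (by omega) (hx μ ν) h
    · rw [uPath_mul_mul_star_uPath_of_ne (hx μ ν) h]
      exact zero_mem _

end ConditionA

end WeightSequence

/-! ### The weighted Toeplitz algebra contains the creation operators -/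

lemma isClosed_adjointableOps :
    IsClosed (G.adjointableOps : Set (G.Fock →L[ℂ] G.Fock)) := by
  have eq_iInter : (G.adjointableOps : Set (G.Fock →L[ℂ] G.Fock)) = ⋂ v, ⋂ ξ,
      {T | T (Fock.rightAct G (Fock.delta v) ξ) = Fock.rightAct G (Fock.delta v) (T ξ)} := by
    ext T
    simp only [Set.mem_iInter]
    exact Fock.isAdjointable_iff T
  rw [eq_iInter]
  exact isClosed_iInter fun v => isClosed_iInter fun ξ => isClosed_eq (by fun_prop) (by fun_prop)

lemma IsDiag.isPositive {X : G.adjointableOps} {T : (k : ℕ) → (G.Xk k →L[ℂ] G.Xk k)}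
    (hX : IsDiag X T) (hT : ∀ k, (T k).IsPositive) : X.1.IsPositive := by
  have hsa : Star.star X = X :=
    hX.star.ext (hX.congr (funext fun k => (hT k).isSelfAdjoint.star_eq.symm))
  rw [ContinuousLinearMap.isPositive_def']
  refine ⟨congrArg Subtype.val hsa, fun ξ => ?_⟩
  rw [ContinuousLinearMap.reApplyInnerSelf_apply, lp.inner_eq_tsum,
    RCLike.re_tsum _ (lp.summable_inner _ _)]
  exact tsum_nonneg fun k => by rw [hX]; exact (hT k).re_inner_nonneg_left _

lemma norm_one_sub_smul_le {E : Type*} [NormedAddCommGroup E] [InnerProductSpace ℂ E]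
    [CompleteSpace E] {T : E →L[ℂ] E} {c ε : ℝ} (hc : 0 < c) (hεc : ε ≤ c) (hT : T.IsPositive)
    (hTc : ‖T‖ ≤ c) (hTε : (T - (ε : ℂ) • ContinuousLinearMap.id ℂ E).IsPositive) :
    ‖1 - (c⁻¹ : ℂ) • T‖ ≤ 1 - ε / c := by
  have hci : 0 ≤ c⁻¹ := inv_nonneg.2 hc.le
  have T_le : T ≤ algebraMap ℝ _ c :=
    (CStarAlgebra.norm_le_iff_le_algebraMap T hc.le
      ((ContinuousLinearMap.nonneg_iff_isPositive T).2 hT)).1 hTc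
  have le_T : algebraMap ℝ _ ε ≤ T := by
    rw [ContinuousLinearMap.le_def, Algebra.algebraMap_eq_smul_one, ← Complex.coe_smul]
    exact hTε
  have smul_T_le : c⁻¹ • T ≤ 1 := by
    simpa [Algebra.algebraMap_eq_smul_one, smul_smul, hc.ne'] using
      smul_le_smul_of_nonneg_left T_le hci
  have le_smul_T : algebraMap ℝ _ (ε / c) ≤ c⁻¹ • T := by
    simpa [Algebra.algebraMap_eq_smul_one, smul_smul, div_eq_inv_mul] using
      smul_le_smul_of_nonneg_left le_T hci
  rw [← Complex.ofReal_inv, Complex.coe_smul,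
    CStarAlgebra.norm_le_iff_le_algebraMap _ (sub_nonneg.2 ((div_le_one hc).2 hεc))
      (sub_nonneg.2 smul_T_le), map_sub, map_one]
  exact sub_le_sub_left le_smul_T 1

lemma Q_zero_mul_S (e : Ed) : G.Q 0 * G.S e = 0 := by
  refine Subtype.ext (ContinuousLinearMap.ext fun ξ => ?_)
  ext k : 2
  change (G.Q 0).1 ((G.S e).1 ξ) k = 0
  rw [isDiag_Q]
  cases k with
  | zero => rw [S_apply_zero, map_zero]
  | succ k => simp

namespace WeightSequence

variable (Z : G.WeightSequence)

lemma isClosed_toeplitz : IsClosed (Z.toeplitz : Set G.adjointableOps) := isClosed_closure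

lemma opL_mul_S_mem (e : Ed) : Z.opL * G.S e ∈ Z.toeplitz :=
  subset_closure (NonUnitalStarAlgebra.subset_adjoin ℂ _ ⟨e, rfl⟩)

lemma isDiag_opL_sub_Q : IsDiag (Z.opL - G.Q 0) fun k => if k = 0 then 0 else Z.op k := by
  refine ((isDiag_opL Z).sub (isDiag_Q 0)).congr (funext fun k => ?_)
  by_cases h : k = 0
  · subst h; simp [Z.op_zero, ContinuousLinearMap.one_def]
  · simp [h]

lemma opL_sub_Q_mul_self : (Z.opL - G.Q 0) * (Z.opL - G.Q 0) =
    ∑ e, (Z.opL * G.S e) * star (Z.opL * G.S e) := by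
  have sum_eq : ∑ e, (Z.opL * G.S e) * star (Z.opL * G.S e) = Z.opL * (1 - G.Q 0) * Z.opL := by
    simp only [← sum_S_mul_star_S, Finset.mul_sum, Finset.sum_mul, star_mul, star_opL, mul_assoc]
  rw [sum_eq]
  refine (Z.isDiag_opL_sub_Q.mul Z.isDiag_opL_sub_Q).ext
    ((((isDiag_opL Z).mul (IsDiag.one.sub (isDiag_Q 0))).mul (isDiag_opL Z)).congr
      (funext fun k => ?_))
  by_cases h : k = 0 <;> simp [h]

lemma opL_sub_Q_nonneg : 0 ≤ (Z.opL - G.Q 0).1 := by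
  rw [ContinuousLinearMap.nonneg_iff_isPositive]
  refine Z.isDiag_opL_sub_Q.isPositive fun k => ?_
  split_ifs
  · exact ContinuousLinearMap.isPositive_zero
  · exact Z.positive k

lemma opL_sub_Q_mem : Z.opL - G.Q 0 ∈ Z.toeplitz := by
  have square_mem : (Z.opL - G.Q 0) * (Z.opL - G.Q 0) ∈ Z.toeplitz := by
    rw [opL_sub_Q_mul_self]
    exact sum_mem fun e _ => mul_mem (Z.opL_mul_S_mem e) (star_mem (Z.opL_mul_S_mem e))
  let ι : G.adjointableOps →⋆ₙₐ[ℂ] (G.Fock →L[ℂ] G.Fock) :=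
    (G.adjointableOps.subtype : G.adjointableOps →⋆ₐ[ℂ] (G.Fock →L[ℂ] G.Fock))
  have isClosed_map : IsClosed (Z.toeplitz.map ι : Set (G.Fock →L[ℂ] G.Fock)) := by
    rw [NonUnitalStarSubalgebra.coe_map]
    exact isClosed_adjointableOps.isClosedEmbedding_subtypeVal.isClosedMap _ Z.isClosed_toeplitz
  obtain ⟨Y, hY, hYeq⟩ := NonUnitalStarSubalgebra.mem_map.1
    (mem_of_nonneg_of_mul_self_mem isClosed_map Z.opL_sub_Q_nonneg
      (NonUnitalStarSubalgebra.mem_map.2 ⟨_, square_mem, rfl⟩))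
  rwa [Subtype.ext hYeq] at hY

lemma S_sub_pow_mul_S_mem (c : ℂ) (e : Ed) (n : ℕ) :
    G.S e - (1 - c • (Z.opL - G.Q 0)) ^ n * G.S e ∈ Z.toeplitz := by
  induction n with
  | zero => simp
  | succ n ih =>
    set K := 1 - c • (Z.opL - G.Q 0) with K_def
    have K_mul (X : G.adjointableOps) : K * X = X - c • ((Z.opL - G.Q 0) * X) := by
      rw [K_def, sub_mul, one_mul, smul_mul_assoc]
    have K_mul_S : K * G.S e = G.S e - c • (Z.opL * G.S e) := by
      rw [K_mul, sub_mul, Q_zero_mul_S, sub_zero]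
    have step : G.S e - K ^ (n + 1) * G.S e =
        c • (Z.opL * G.S e) + K * (G.S e - K ^ n * G.S e) := by
      rw [mul_sub, K_mul_S, pow_succ', mul_assoc]
      abel
    rw [step, K_mul]
    exact add_mem (SMulMemClass.smul_mem _ (Z.opL_mul_S_mem e))
      (sub_mem ih (SMulMemClass.smul_mem _ (mul_mem Z.opL_sub_Q_mem ih)))

lemma exists_norm_pow_mul_S_le : ∃ (c : ℂ) (ρ : ℝ), 0 ≤ ρ ∧ ρ < 1 ∧ ∀ e n,
    ‖(1 - c • (Z.opL - G.Q 0)) ^ n * G.S e‖ ≤ ρ ^ n * ‖G.S e‖ := by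
  obtain ⟨M, hM⟩ := Z.bounded
  obtain ⟨ε, hε, hZε⟩ := Z.lower_bound
  obtain ⟨c, hMc, hεc⟩ : ∃ c, M ≤ c ∧ ε ≤ c := ⟨max M ε, le_max_left _ _, le_max_right _ _⟩
  have hc0 : 0 < c := hε.trans_le hεc
  have hρ0 : 0 ≤ 1 - ε / c := sub_nonneg.2 ((div_le_one hc0).2 hεc)
  refine ⟨(c⁻¹ : ℂ), 1 - ε / c, hρ0, sub_lt_self _ (div_pos hε hc0), fun e n => ?_⟩
  have isDiag_K := IsDiag.one.sub (Z.isDiag_opL_sub_Q.smul (c⁻¹ : ℂ))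
  set K := 1 - (c⁻¹ : ℂ) • (Z.opL - G.Q 0)
  have insert_compl_Q : K ^ n * G.S e = K ^ n * (1 - G.Q 0) * G.S e := by
    rw [mul_assoc, sub_mul, one_mul, Q_zero_mul_S, sub_zero]
  rw [insert_compl_Q]
  refine (norm_mul_le _ _).trans (mul_le_mul_of_nonneg_right ?_ (norm_nonneg _))
  refine ((isDiag_K.pow n).mul (IsDiag.one.sub (isDiag_Q 0))).norm_le (pow_nonneg hρ0 n)
    fun k => ?_
  by_cases hk : k = 0
  · rw [if_pos hk, if_pos hk, sub_self, mul_zero, norm_zero]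
    exact pow_nonneg hρ0 n
  · rw [if_neg hk, if_neg hk, sub_zero, mul_one]
    have norm_le := norm_one_sub_smul_le hc0 hεc (Z.positive k)
      ((hM k).trans hMc) (hZε k (Nat.one_le_iff_ne_zero.2 hk))
    rcases Nat.eq_zero_or_pos n with rfl | hn
    · rw [pow_zero, pow_zero]
      exact ContinuousLinearMap.norm_id_le
    · exact (norm_pow_le' _ hn).trans (pow_le_pow_left₀ (norm_nonneg _) norm_le n)

/-- Since `Z - Q₀` is bounded below on the range of `S_e`, the powers of `1 - c (Z - Q₀)` applied
to `S_e` tend to zero geometrically. -/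
lemma S_mem_toeplitz (e : Ed) : G.S e ∈ Z.toeplitz := by
  obtain ⟨c, ρ, hρ0, hρ1, hnorm⟩ := Z.exists_norm_pow_mul_S_le
  refine Z.isClosed_toeplitz.mem_of_tendsto ?_
    (Filter.Eventually.of_forall (f := Filter.atTop) (Z.S_sub_pow_mul_S_mem c e))
  rw [tendsto_iff_norm_sub_tendsto_zero]
  refine squeeze_zero (fun _ => norm_nonneg _) (fun n => ?_)
    (by simpa using (tendsto_pow_atTop_nhds_zero_of_lt_one hρ0 hρ1).mul_const ‖G.S e‖)
  rw [sub_sub_cancel_left, norm_neg]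
  exact hnorm e n

lemma P_mem_toeplitz (hG : G.NoSinks) (v : V) : G.P v ∈ Z.toeplitz := by
  obtain ⟨e, rfl⟩ := hG v
  classical
  have star_S_mul_S_self := star_S_mul_S (G := G) e e
  rw [if_pos rfl] at star_S_mul_S_self
  rw [← star_S_mul_S_self]
  exact mul_mem (star_mem (Z.S_mem_toeplitz e)) (Z.S_mem_toeplitz e)

end WeightSequence

/-! ### The gauge action -/

variable (G) in
/-- `X` is homogeneous of degree `d` for the gauge action. -/
def IsDeg (d : ℤ) (X : G.adjointableOps) : Prop :=
  ∀ t : ℝ, G.gauge t X = Complex.exp (Complex.I * d * t) • X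

variable (G) in
/-- The gauge unitary `∑ₙ e^{int} Qₙ` as an adjointable operator. -/
def gaugeU (t : ℝ) : G.adjointableOps := ⟨Fock.gaugeUnitary t, Fock.isAdjointable_gaugeUnitary t⟩

lemma isDiag_gaugeU (t : ℝ) : IsDiag (G.gaugeU t) fun k =>
    Complex.exp (Complex.I * k * t) • (1 : G.Xk k →L[ℂ] G.Xk k) := fun _ _ => rfl

lemma gaugeU_add (s t : ℝ) : G.gaugeU (s + t) = G.gaugeU s * G.gaugeU t :=
  (isDiag_gaugeU (s + t)).ext (((isDiag_gaugeU s).mul (isDiag_gaugeU t)).congr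
    (funext fun k => by
      rw [smul_mul_smul_comm, one_mul, ← Complex.exp_add, Complex.ofReal_add, mul_add]))

lemma gaugeU_zero : G.gaugeU 0 = 1 :=
  (isDiag_gaugeU 0).ext (IsDiag.one.congr (funext fun k => by simp))

lemma star_exp_I_mul (k : ℤ) (t : ℝ) :
    star (Complex.exp (Complex.I * k * t)) = Complex.exp (-(Complex.I * k * t)) := by
  rw [← starRingEnd_apply, ← Complex.exp_conj]
  simp

lemma star_gaugeU (t : ℝ) : star (G.gaugeU t) = G.gaugeU (-t) :=
  (isDiag_gaugeU t).star.ext ((isDiag_gaugeU (-t)).congr (funext fun k => by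
    have star_exp := star_exp_I_mul k t
    rw [Int.cast_natCast] at star_exp
    rw [star_smul, star_one, star_exp, Complex.ofReal_neg, mul_neg]))

lemma star_gaugeU_mul (t : ℝ) : star (G.gaugeU t) * G.gaugeU t = 1 := by
  rw [star_gaugeU, ← gaugeU_add, neg_add_cancel, gaugeU_zero]

lemma gaugeU_mul_star (t : ℝ) : G.gaugeU t * star (G.gaugeU t) = 1 := by
  rw [star_gaugeU, ← gaugeU_add, add_neg_cancel, gaugeU_zero]

lemma gauge_eq (t : ℝ) (X : G.adjointableOps) :
    G.gauge t X = G.gaugeU t * X * star (G.gaugeU t) := rfl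

lemma gauge_mul (t : ℝ) (X Y : G.adjointableOps) :
    G.gauge t (X * Y) = G.gauge t X * G.gauge t Y := by
  have reassoc : G.gaugeU t * X * star (G.gaugeU t) * (G.gaugeU t * Y * star (G.gaugeU t)) =
      G.gaugeU t * X * (star (G.gaugeU t) * G.gaugeU t) * Y * star (G.gaugeU t) := by
    noncomm_ring
  rw [gauge_eq, gauge_eq, gauge_eq, reassoc, star_gaugeU_mul, mul_one, ← mul_assoc]

lemma gauge_star (t : ℝ) (X : G.adjointableOps) : G.gauge t (star X) = star (G.gauge t X) := by
  simp only [gauge_eq, star_mul, star_star, mul_assoc]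

lemma gauge_add (t : ℝ) (X Y : G.adjointableOps) :
    G.gauge t (X + Y) = G.gauge t X + G.gauge t Y := by
  simp only [gauge_eq, mul_add, add_mul]

lemma gauge_smul (t : ℝ) (c : ℂ) (X : G.adjointableOps) :
    G.gauge t (c • X) = c • G.gauge t X := by
  simp only [gauge_eq, mul_smul_comm, smul_mul_assoc]

lemma norm_gaugeU_le (t : ℝ) : ‖G.gaugeU t‖ ≤ 1 := by
  refine (isDiag_gaugeU t).norm_le zero_le_one fun k => ?_
  rw [norm_smul, show Complex.I * k * t = ((k * t : ℝ) : ℂ) * Complex.I by push_cast; ring,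
    Complex.norm_exp_ofReal_mul_I, one_mul]
  exact ContinuousLinearMap.norm_id_le

lemma norm_gauge_le (t : ℝ) (X : G.adjointableOps) : ‖G.gauge t X‖ ≤ ‖X‖ := by
  rw [gauge_eq, star_gaugeU]
  calc ‖G.gaugeU t * X * G.gaugeU (-t)‖
      ≤ ‖G.gaugeU t‖ * ‖X‖ * ‖G.gaugeU (-t)‖ := norm_mul₃_le
    _ ≤ 1 * ‖X‖ * 1 := by gcongr <;> exact norm_gaugeU_le _
    _ = ‖X‖ := by ring

namespace IsDeg

variable {d d' : ℤ} {X Y : G.adjointableOps}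

lemma mul (hX : G.IsDeg d X) (hY : G.IsDeg d' Y) : G.IsDeg (d + d') (X * Y) := fun t => by
  rw [gauge_mul, hX, hY, smul_mul_smul_comm, ← Complex.exp_add]
  congr 2
  push_cast
  ring

lemma star (hX : G.IsDeg d X) : G.IsDeg (-d) (star X) := fun t => by
  rw [gauge_star, hX, star_smul, star_exp_I_mul]
  congr 2
  push_cast
  ring

lemma zero : G.IsDeg d 0 := fun t => by simp [gauge_eq]

end IsDeg

lemma IsDiag.isDeg {X : G.adjointableOps} {T : (k : ℕ) → (G.Xk k →L[ℂ] G.Xk k)}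
    (hX : IsDiag X T) : G.IsDeg 0 X := fun t => by
  have gaugeU_comm : G.gaugeU t * X = X * G.gaugeU t :=
    ((isDiag_gaugeU t).mul hX).ext ((hX.mul (isDiag_gaugeU t)).congr (funext fun k => by
      rw [mul_smul_comm, smul_mul_assoc, one_mul, mul_one]))
  rw [gauge_eq, gaugeU_comm, mul_assoc, gaugeU_mul_star]
  simp

lemma gaugeU_mul_S (t : ℝ) (e : Ed) :
    G.gaugeU t * G.S e = Complex.exp (Complex.I * t) • (G.S e * G.gaugeU t) := by
  refine Subtype.ext (ContinuousLinearMap.ext fun ξ => ?_)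
  ext k : 2
  change (G.gaugeU t).1 ((G.S e).1 ξ) k =
    Complex.exp (Complex.I * t) • (G.S e).1 ((G.gaugeU t).1 ξ) k
  rw [isDiag_gaugeU]
  cases k with
  | zero => simp [S_apply_zero]
  | succ k =>
    rw [S_apply_succ, S_apply_succ, isDiag_gaugeU]
    change Complex.exp _ • Xk.create e k (ξ k) =
      Complex.exp _ • Xk.create e k (Complex.exp _ • ξ k)
    rw [map_smul, smul_smul, ← Complex.exp_add]
    congr 2
    push_cast
    ring

lemma isDeg_S (e : Ed) : G.IsDeg 1 (G.S e) := fun t => by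
  rw [gauge_eq, gaugeU_mul_S, smul_mul_assoc, mul_assoc, gaugeU_mul_star, mul_one]
  simp

variable (G) in
/-- The average of the gauge action over the `m`-th roots of unity. It stands in for the integral
of the gauge action over the circle: it agrees with it on degrees `d` with `|d| < m`. -/
def gaugeAvg (m : ℕ) (X : G.adjointableOps) : G.adjointableOps :=
  (m : ℂ)⁻¹ • ∑ j ∈ Finset.range m, G.gauge (2 * Real.pi * j / m) X

lemma gaugeAvg_add (m : ℕ) (X Y : G.adjointableOps) :
    G.gaugeAvg m (X + Y) = G.gaugeAvg m X + G.gaugeAvg m Y := by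
  simp only [gaugeAvg, gauge_add, Finset.sum_add_distrib, smul_add]

lemma gaugeAvg_smul (m : ℕ) (c : ℂ) (X : G.adjointableOps) :
    G.gaugeAvg m (c • X) = c • G.gaugeAvg m X := by
  simp only [gaugeAvg, gauge_smul, ← Finset.smul_sum, smul_comm c]

lemma norm_gaugeAvg_le (m : ℕ) (X : G.adjointableOps) : ‖G.gaugeAvg m X‖ ≤ ‖X‖ := by
  have norm_sum : ‖∑ j ∈ Finset.range m, G.gauge (2 * Real.pi * j / m) X‖ ≤ m * ‖X‖ := by
    simpa using norm_sum_le_of_le (Finset.range m) fun j _ =>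
      norm_gauge_le (2 * Real.pi * j / m) X
  rw [gaugeAvg, norm_smul, norm_inv, Complex.norm_natCast]
  rcases Nat.eq_zero_or_pos m with rfl | hm
  · simp
  · rw [inv_mul_le_iff₀ (by positivity)]
    exact norm_sum

lemma IsDeg.gaugeAvg_zero {X : G.adjointableOps} (hX : G.IsDeg 0 X) {m : ℕ} (hm : 0 < m) :
    G.gaugeAvg m X = X := by
  have gauge_eq_self (t : ℝ) : G.gauge t X = X := by rw [hX]; simp
  have hm' : (m : ℂ) ≠ 0 := by exact_mod_cast hm.ne'
  simp only [gaugeAvg, gauge_eq_self, Finset.sum_const, Finset.card_range]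
  rw [← Nat.cast_smul_eq_nsmul ℂ, smul_smul, inv_mul_cancel₀ hm', one_smul]

lemma IsDeg.gaugeAvg_eq_zero {d : ℤ} {X : G.adjointableOps} (hX : G.IsDeg d X) (hd : d ≠ 0)
    {m : ℕ} (hm : d.natAbs < m) : G.gaugeAvg m X = 0 := by
  have hm0 : m ≠ 0 := (Nat.zero_le _).trans_lt hm |>.ne'
  have hprim := Complex.isPrimitiveRoot_exp m hm0
  set ζ := Complex.exp (2 * Real.pi * Complex.I / m) with ζ_def
  have gauge_root (j : ℕ) : G.gauge (2 * Real.pi * j / m) X = (ζ ^ d) ^ j • X := by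
    rw [hX, ζ_def, ← Complex.exp_int_mul, ← Complex.exp_nat_mul]
    congr 2
    push_cast
    ring
  have pow_eq_one : (ζ ^ d) ^ m = 1 := by
    rw [← zpow_natCast, zpow_comm, zpow_natCast, hprim.pow_eq_one, one_zpow]
  have ne_one : ζ ^ d ≠ 1 := fun h =>
    hd (Int.eq_zero_of_dvd_of_natAbs_lt_natAbs ((hprim.zpow_eq_one_iff_dvd d).1 h) (by simpa))
  have geom_sum_eq_zero : ∑ j ∈ Finset.range m, (ζ ^ d) ^ j = 0 := by
    rw [geom_sum_eq ne_one, pow_eq_one, sub_self, zero_div]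
  simp only [gaugeAvg, gauge_root]
  rw [← Finset.sum_smul, geom_sum_eq_zero, zero_smul, smul_zero]

namespace WeightSequence

variable {Z : G.WeightSequence}

/-! ### Approximation of `q(𝓓)` by the matrix algebras -/

variable (Z) in
/-- All matrix coefficients of `x` between sufficiently long paths whose lengths differ by `d` lie
in the coefficient algebra. This is how homogeneity of degree `d` is seen in the quotient. -/
def HasCoeffs (d : ℤ) (x : G.QuotAlg) : Prop :=
  ∃ N : ℕ, ∀ m n : ℕ, N ≤ m → N ≤ n → (m : ℤ) - n = d → ∀ (μ : G.Path m) (ν : G.Path n),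
    star (uPath μ) * x * uPath ν ∈ Z.coeffAlg

namespace HasCoeffs

variable {d d' : ℤ} {x y : G.QuotAlg}

lemma zero : Z.HasCoeffs d 0 := ⟨0, fun m n _ _ _ μ ν => by simp⟩

lemma add (hx : Z.HasCoeffs d x) (hy : Z.HasCoeffs d y) : Z.HasCoeffs d (x + y) := by
  obtain ⟨M, hM⟩ := hx
  obtain ⟨N, hN⟩ := hy
  refine ⟨max M N, fun m n hm hn h μ ν => ?_⟩
  rw [mul_add, add_mul]
  exact add_mem (hM m n (by omega) (by omega) h μ ν) (hN m n (by omega) (by omega) h μ ν)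

lemma smul (c : ℂ) (hx : Z.HasCoeffs d x) : Z.HasCoeffs d (c • x) := by
  obtain ⟨M, hM⟩ := hx
  refine ⟨M, fun m n hm hn h μ ν => ?_⟩
  rw [mul_smul_comm, smul_mul_assoc]
  exact SMulMemClass.smul_mem c (hM m n hm hn h μ ν)

lemma mul (hx : Z.HasCoeffs d x) (hy : Z.HasCoeffs d' y) : Z.HasCoeffs (d + d') (x * y) := by
  obtain ⟨M, hM⟩ := hx
  obtain ⟨N, hN⟩ := hy
  refine ⟨M + N + d'.natAbs, fun m n hm hn h μ ν => ?_⟩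
  obtain ⟨l, hl⟩ : ∃ l : ℕ, (l : ℤ) = n + d' := ⟨(n + d').toNat, by omega⟩
  rw [mul_mul_mul_eq_sum_entries (sum_uPath_mul_star_uPath l)]
  exact sum_mem fun α _ => mul_mem (hM m l (by omega) (by omega) (by omega) μ α)
    (hN l n (by omega) (by omega) (by omega) α ν)

lemma star (hx : Z.HasCoeffs d x) : Z.HasCoeffs (-d) (star x) := by
  obtain ⟨M, hM⟩ := hx
  refine ⟨M, fun m n hm hn h μ ν => ?_⟩
  rw [mul_star_mul_eq_star]
  exact star_mem (hM n m hn hm (by omega) ν μ)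

lemma exists_mem_matAlg (hx : Z.HasCoeffs 0 x) : ∃ N, ∀ k, N ≤ k → x ∈ Z.matAlg k := by
  obtain ⟨N, hN⟩ := hx
  exact ⟨N, fun k hk => hN k k hk hk (sub_self _)⟩

end HasCoeffs

lemma isDeg_opL_mul_S (e : Ed) : G.IsDeg 1 (Z.opL * G.S e) := by
  simpa using (isDiag_opL Z).isDeg.mul (isDeg_S e)

section ConditionA

variable {p : ℕ} (hA : Z.ConditionA p) (hp : 1 ≤ p)
include hA hp

lemma hasCoeffs_z_mul_u (e : Ed) : Z.HasCoeffs 1 (Z.z * G.u e) := by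
  refine ⟨0, fun m n _ _ h μ ν => ?_⟩
  obtain rfl : m = n + 1 := by omega
  have z_mem : Z.z ∈ Z.matAlg (n + 1) := coeffAlg_le_matAlg hA hp _ (Z.zShift_mem_coeffAlg 0)
  rw [mul_assoc, mul_assoc Z.z, ← mul_assoc]
  by_cases hs : G.s e = ν.range
  · rw [← uPath_cons e ν hs]
    exact z_mem _ _
  · rw [u_mul_uPath_of_ne hs, mul_zero]
    exact zero_mem _

lemma exists_isDeg_hasCoeffs {w : G.adjointableOps}
    (hw : w ∈ Subsemigroup.closure ((Set.range fun e : Ed => Z.opL * G.S e) ∪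
      star (Set.range fun e : Ed => Z.opL * G.S e))) :
    ∃ d : ℤ, G.IsDeg d w ∧ Z.HasCoeffs d (QuotAlg.q G w) := by
  have hasCoeffs_generator (e : Ed) : Z.HasCoeffs 1 (QuotAlg.q G (Z.opL * G.S e)) := by
    rw [map_mul]
    exact hasCoeffs_z_mul_u hA hp e
  induction hw using Subsemigroup.closure_induction with
  | mem w hw =>
    rcases hw with ⟨e, rfl⟩ | ⟨e, he⟩
    · exact ⟨1, isDeg_opL_mul_S e, hasCoeffs_generator e⟩
    · rw [← star_star w, ← he, QuotAlg.q_star]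
      exact ⟨-1, (isDeg_opL_mul_S e).star, (hasCoeffs_generator e).star⟩
  | mul x y _ _ hx hy =>
    obtain ⟨d, hxd, hxc⟩ := hx
    obtain ⟨d', hyd, hyc⟩ := hy
    rw [map_mul]
    exact ⟨d + d', hxd.mul hyd, hxc.mul hyc⟩

lemma exists_gaugeAvg_eq {X : G.adjointableOps}
    (hX : X ∈ NonUnitalStarAlgebra.adjoin ℂ (Set.range fun e : Ed => Z.opL * G.S e)) :
    ∃ Y, Z.HasCoeffs 0 (QuotAlg.q G Y) ∧ ∃ M, ∀ m, M ≤ m → G.gaugeAvg m X = Y := by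
  have mem_span := hX
  rw [← SetLike.mem_coe, ← NonUnitalStarSubalgebra.coe_toNonUnitalSubalgebra,
    ← NonUnitalSubalgebra.coe_toSubmodule, SetLike.mem_coe,
    NonUnitalStarAlgebra.adjoin_eq_span] at mem_span
  clear hX
  induction mem_span using Submodule.span_induction with
  | mem w hw =>
    obtain ⟨d, hdeg, hcoeffs⟩ := exists_isDeg_hasCoeffs hA hp hw
    by_cases hd : d = 0
    · subst hd
      exact ⟨w, hcoeffs, 1, fun m hm => hdeg.gaugeAvg_zero hm⟩
    · exact ⟨0, by rw [map_zero]; exact HasCoeffs.zero, d.natAbs + 1,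
        fun m hm => hdeg.gaugeAvg_eq_zero hd hm⟩
  | zero =>
    exact ⟨0, by rw [map_zero]; exact HasCoeffs.zero, 1, fun m hm => IsDeg.zero.gaugeAvg_zero hm⟩
  | add x y _ _ hx hy =>
    obtain ⟨X₀, hX₀, M, hM⟩ := hx
    obtain ⟨Y₀, hY₀, N, hN⟩ := hy
    refine ⟨X₀ + Y₀, by rw [map_add]; exact hX₀.add hY₀, max M N, fun m hm => ?_⟩
    rw [gaugeAvg_add, hM m (by omega), hN m (by omega)]
  | smul c x _ hx =>
    obtain ⟨X₀, hX₀, M, hM⟩ := hx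
    refine ⟨c • X₀, by rw [map_smul]; exact hX₀.smul c, M, fun m hm => ?_⟩
    rw [gaugeAvg_smul, hM m hm]

/-- Averaging over the gauge action fixes `X` and moves an approximant from the generated
`*`-algebra into its degree-zero part. -/
lemma exists_mem_matAlg_norm_sub_le {x : G.QuotAlg} (hx : x ∈ Z.qD) {ε : ℝ} (hε : 0 < ε) :
    ∃ N, ∀ k, N ≤ k → ∃ c ∈ Z.matAlg k, ‖c - x‖ ≤ ε := by
  obtain ⟨X, ⟨hXT, hXg⟩, rfl⟩ := hx
  obtain ⟨Y, hY, hXY⟩ := Metric.mem_closure_iff.1 hXT ε hε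
  obtain ⟨Y₀, hY₀, M, hM⟩ := exists_gaugeAvg_eq hA hp hY
  obtain ⟨N, hN⟩ := hY₀.exists_mem_matAlg
  refine ⟨N, fun k hk => ⟨_, hN k hk, ?_⟩⟩
  have isDeg_X : G.IsDeg 0 X := fun t => by rw [hXg]; simp
  have sub_eq : Y₀ - X = G.gaugeAvg (M + 1) (Y + (-1 : ℂ) • X) := by
    rw [gaugeAvg_add, gaugeAvg_smul, isDeg_X.gaugeAvg_zero M.succ_pos, hM _ M.le_succ, neg_smul,
      one_smul, sub_eq_add_neg]
  calc ‖QuotAlg.q G Y₀ - QuotAlg.q G X‖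
      ≤ ‖Y₀ - X‖ := by rw [← map_sub]; exact QuotAlg.norm_q_le _
    _ ≤ ‖Y + (-1 : ℂ) • X‖ := by rw [sub_eq]; exact norm_gaugeAvg_le _ _
    _ = dist X Y := by rw [neg_smul, one_smul, ← sub_eq_add_neg, ← dist_eq_norm, dist_comm]
    _ ≤ ε := hXY.le

end ConditionA

variable (Z) in
/-- `q(𝓓)` as a `*`-subalgebra of `𝓛 / 𝓚`. -/
def qDAlg : NonUnitalStarSubalgebra ℂ G.QuotAlg where
  carrier := Z.qD
  zero_mem' := ⟨0, ⟨zero_mem _, fun t => by simp [gauge_eq]⟩, map_zero _⟩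
  add_mem' := by
    rintro _ _ ⟨X, hX, rfl⟩ ⟨Y, hY, rfl⟩
    exact ⟨X + Y, ⟨add_mem hX.1 hY.1, fun t => by rw [gauge_add, hX.2, hY.2]⟩, map_add _ _ _⟩
  mul_mem' := by
    rintro _ _ ⟨X, hX, rfl⟩ ⟨Y, hY, rfl⟩
    exact ⟨X * Y, ⟨mul_mem hX.1 hY.1, fun t => by rw [gauge_mul, hX.2, hY.2]⟩, map_mul _ _ _⟩
  smul_mem' := by
    rintro c _ ⟨X, hX, rfl⟩
    exact ⟨c • X, ⟨SMulMemClass.smul_mem c hX.1, fun t => by rw [gauge_smul, hX.2]⟩, map_smul _ _ _⟩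
  star_mem' := by
    rintro _ ⟨X, hX, rfl⟩
    exact ⟨star X, ⟨star_mem hX.1, fun t => by rw [gauge_star, hX.2]⟩, QuotAlg.q_star _⟩

lemma q_mem_qD {X : G.adjointableOps} (hX : X ∈ Z.toeplitz) (hdeg : G.IsDeg 0 X) :
    QuotAlg.q G X ∈ Z.qD := ⟨X, ⟨hX, fun t => by rw [hdeg]; simp⟩, rfl⟩

lemma isDeg_of_mem_D {X : G.adjointableOps} (hX : X ∈ Z.D) : G.IsDeg 0 X := fun t => by
  rw [hX.2]; simp

lemma isDeg_of_mem_F {X : G.adjointableOps} (hX : X ∈ Z.F) : G.IsDeg 1 X := fun t => by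
  rw [hX.2]; simp

lemma u_mem_qF (e : Ed) : G.u e ∈ Z.qF :=
  ⟨G.S e, ⟨Z.S_mem_toeplitz e, fun t => by rw [isDeg_S]; simp⟩, rfl⟩

lemma star_u_mul_mem_qD {ξ : G.QuotAlg} (hξ : ξ ∈ Z.qF) (e : Ed) :
    star (G.u e) * ξ ∈ Z.qD := by
  obtain ⟨X, hX, rfl⟩ := hξ
  have q_mem := q_mem_qD (mul_mem (star_mem (Z.S_mem_toeplitz e)) hX.1)
    (by simpa using (isDeg_S e).star.mul (isDeg_of_mem_F hX))
  rwa [map_mul, QuotAlg.q_star] at q_mem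

lemma star_mul_u_mem_qD {η : G.QuotAlg} (hη : η ∈ Z.qF) (e : Ed) : star η * G.u e ∈ Z.qD := by
  have star_mem_qD := Z.qDAlg.star_mem' (star_u_mul_mem_qD hη e)
  rwa [star_mul, star_star] at star_mem_qD

lemma u_mul_mul_star_u_mem_qD {x : G.QuotAlg} (hx : x ∈ Z.qD) (e f : Ed) :
    G.u e * x * star (G.u f) ∈ Z.qD := by
  obtain ⟨X, hX, rfl⟩ := hx
  have q_mem := q_mem_qD
    (mul_mem (mul_mem (Z.S_mem_toeplitz e) hX.1) (star_mem (Z.S_mem_toeplitz f)))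
    (by simpa using ((isDeg_S e).mul (isDeg_of_mem_D hX)).mul (isDeg_S f).star)
  rwa [map_mul, map_mul, QuotAlg.q_star] at q_mem

lemma z_mem_qD : Z.z ∈ Z.qD := by
  have q_mem := q_mem_qD Z.opL_sub_Q_mem Z.isDiag_opL_sub_Q.isDeg
  rwa [map_sub, q_Q, sub_zero] at q_mem

section NoSinks

variable (hG : G.NoSinks)
include hG

lemma pv_mem_qD (v : V) : G.pv v ∈ Z.qD :=
  q_mem_qD (Z.P_mem_toeplitz hG v) (isDiag_P v).isDeg

lemma one_mem_qD : (1 : G.QuotAlg) ∈ Z.qD := by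
  rw [← sum_pv]
  exact sum_mem (S := Z.qDAlg) fun v _ => pv_mem_qD hG v

lemma uPath_mul_mul_star_uPath_mem_qD {x : G.QuotAlg} (hx : x ∈ Z.qD) {k : ℕ}
    (α β : G.Path k) : uPath α * x * star (uPath β) ∈ Z.qD :=
  uPath_mul_mul_star_uPath_mem
    (fun v w _ hx => Z.qDAlg.mul_mem (Z.qDAlg.mul_mem (pv_mem_qD hG v) hx) (pv_mem_qD hG w))
    (fun e f _ hx => u_mul_mul_star_u_mem_qD hx e f) α β hx

lemma uPath_mul_star_uPath_mem_qD {k : ℕ} (α β : G.Path k) :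
    uPath α * star (uPath β) ∈ Z.qD := by
  simpa using uPath_mul_mul_star_uPath_mem_qD hG (one_mem_qD hG) α β

lemma C_le_closure_qDAlg (p n : ℕ) : Z.C p n ≤ Z.qDAlg.topologicalClosure := by
  refine closure_mono (NonUnitalStarAlgebra.adjoin_le ?_)
  rintro _ ⟨l, k, α, β, -, -, -, rfl⟩
  refine uPath_mul_mul_star_uPath_mem_qD hG ?_ α β
  induction l with
  | zero => rw [pow_zero]; exact one_mem_qD hG
  | succ l ih => rw [pow_succ]; exact Z.qDAlg.mul_mem ih z_mem_qD

end NoSinks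

end WeightSequence

/-! ### Closed ideals of `q(𝓓)` -/

lemma QuotAlg.exists_mem_inter_norm_sub_le
    {C : NonUnitalStarSubalgebra ℂ G.QuotAlg} (hC : IsClosed (C : Set G.QuotAlg))
    {J : Submodule ℂ G.QuotAlg} (hJ : IsClosed (J : Set G.QuotAlg))
    (hl : ∀ a ∈ C, ∀ x ∈ J, a * x ∈ J) (hr : ∀ a ∈ C, ∀ x ∈ J, x * a ∈ J)
    (hJJ : ∀ a ∈ J, ∀ x ∈ J, a * x ∈ J) {x c : G.QuotAlg} (hx : x ∈ J) (hc : c ∈ C) {δ : ℝ}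
    (hδ : 0 < δ) (hxc : ‖c - x‖ ≤ δ) :
    ∃ y ∈ J, y ∈ C ∧ ‖c - y‖ ^ 2 ≤ 2 * ((‖x‖ + δ) * δ) := by
  let _ : CStarAlgebra G.adjointableOps :=
    StarSubalgebra.cstarAlgebra _ (h_closed := isClosed_adjointableOps)
  let _ : PartialOrder G.adjointableOps := CStarAlgebra.spectralOrder _
  let _ : StarOrderedRing G.adjointableOps := CStarAlgebra.spectralOrderedRing _
  exact _root_.exists_mem_inter_norm_sub_le (q := qStar G) QuotAlg.norm_q_le QuotAlg.q_surjective
    hC hJ hl hr hJJ hx hc hδ hxc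

namespace WeightSequence

variable {Z : G.WeightSequence} {J : Submodule ℂ G.QuotAlg}

namespace IsIdeal

variable (hJ : Z.IsIdeal J)
include hJ

lemma mul_mem_left_closure {a : G.QuotAlg} (ha : a ∈ Z.qDAlg.topologicalClosure) {x : G.QuotAlg}
    (hx : x ∈ J) : a * x ∈ J :=
  closure_minimal (fun b hb => hJ.mul_mem_left b hb x hx)
    (hJ.isClosed.preimage (by fun_prop : Continuous fun b => b * x)) ha

lemma mul_mem_right_closure {a : G.QuotAlg} (ha : a ∈ Z.qDAlg.topologicalClosure) {x : G.QuotAlg}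
    (hx : x ∈ J) : x * a ∈ J :=
  closure_minimal (fun b hb => hJ.mul_mem_right b hb x hx)
    (hJ.isClosed.preimage (by fun_prop : Continuous fun b => x * b)) ha

lemma mul_mul_mem {a x b : G.QuotAlg} (ha : a ∈ Z.qD) (hx : x ∈ J) (hb : b ∈ Z.qD) :
    a * x * b ∈ J :=
  hJ.mul_mem_right b hb _ (hJ.mul_mem_left a ha x hx)

lemma qFImage_le_iff : Z.qFImage J ≤ J ↔ ∀ e f, ∀ x ∈ J, star (G.u e) * x * G.u f ∈ J := by
  refine ⟨fun h e f x hx => h (subset_closure (Submodule.subset_span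
    ⟨x, hx, _, u_mem_qF f, _, u_mem_qF e, rfl⟩)), fun h => ?_⟩
  refine Submodule.topologicalClosure_minimal _ (Submodule.span_le.2 ?_) hJ.isClosed
  rintro _ ⟨a, ha, ξ, hξ, η, hη, rfl⟩
  rw [eq_sum_entries sum_u_mul_star_u sum_u_mul_star_u a]
  simp only [Finset.mul_sum, Finset.sum_mul]
  refine sum_mem fun e _ => sum_mem fun f _ => ?_
  have regroup : star η * (G.u e * (star (G.u e) * a * G.u f) * star (G.u f)) * ξ =
      (star η * G.u e) * (star (G.u e) * a * G.u f) * (star (G.u f) * ξ) := by noncomm_ring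
  rw [regroup]
  exact hJ.mul_mul_mem (star_mul_u_mem_qD hη e) (h e f a ha) (star_u_mul_mem_qD hξ f)

lemma qFPreimage_subset_iff :
    Z.qFPreimage J ⊆ J ↔ ∀ e f, ∀ x ∈ J, G.u e * x * star (G.u f) ∈ J := by
  refine ⟨fun h e f x hx => h ⟨u_mul_mul_star_u_mem_qD (hJ.subset hx) e f,
    fun ξ hξ η hη => ?_⟩, fun h a ha => ?_⟩
  · have regroup : star η * (G.u e * x * star (G.u f)) * ξ =
        (star η * G.u e) * x * (star (G.u f) * ξ) := by noncomm_ring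
    rw [regroup]
    exact hJ.mul_mul_mem (star_mul_u_mem_qD hη e) hx (star_u_mul_mem_qD hξ f)
  · rw [eq_sum_entries sum_u_mul_star_u sum_u_mul_star_u a]
    exact sum_mem fun e _ => sum_mem fun f _ =>
      h e f _ (ha.2 _ (u_mem_qF f) _ (u_mem_qF e))

lemma fullyInvariant_iff : Z.FullyInvariant J ↔
    (∀ e f, ∀ x ∈ J, star (G.u e) * x * G.u f ∈ J) ∧
      ∀ e f, ∀ x ∈ J, G.u e * x * star (G.u f) ∈ J :=
  and_congr hJ.qFImage_le_iff hJ.qFPreimage_subset_iff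

section NoSinks

variable (hG : G.NoSinks)
include hG

lemma pv_mul_mul_pv_mem (v w : V) : ∀ x ∈ J, G.pv v * x * G.pv w ∈ J :=
  fun _ hx => hJ.mul_mul_mem (pv_mem_qD hG v) hx (pv_mem_qD hG w)

lemma star_uPath_mul_mem (hF : Z.FullyInvariant J) {k : ℕ} (α β : G.Path k) {x : G.QuotAlg}
    (hx : x ∈ J) : star (uPath α) * x * uPath β ∈ J :=
  star_uPath_mul_mul_uPath_mem (hJ.pv_mul_mul_pv_mem hG) (hJ.fullyInvariant_iff.1 hF).1 α β hx

lemma uPath_mul_mem (hF : Z.FullyInvariant J) {k : ℕ} (α β : G.Path k) {x : G.QuotAlg}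
    (hx : x ∈ J) : uPath α * x * star (uPath β) ∈ J :=
  uPath_mul_mul_star_uPath_mem (hJ.pv_mul_mul_pv_mem hG) (hJ.fullyInvariant_iff.1 hF).2 α β hx

lemma subset_closure_restrict {p : ℕ} (hA : Z.ConditionA p) (hp : 1 ≤ p) :
    (J : Set G.QuotAlg) ⊆ closure (⋃ n, Z.restrict p J (n + 1)) := by
  intro x hx
  refine Metric.mem_closure_iff.2 fun ε hε => ?_
  obtain ⟨δ, ⟨hδε, hδ_bound⟩, hδ⟩ : ∃ δ : ℝ,
      (δ < ε / 2 ∧ 2 * ((‖x‖ + δ) * δ) < (ε / 2) ^ 2) ∧ 0 < δ := by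
    have bound_tendsto : ContinuousAt (fun δ : ℝ => 2 * ((‖x‖ + δ) * δ)) 0 := by fun_prop
    have small := (gt_mem_nhds (half_pos hε)).and
      (bound_tendsto.eventually_lt_const (u := (ε / 2) ^ 2) (by simpa using by positivity))
    exact ((small.filter_mono nhdsWithin_le_nhds).and
      (self_mem_nhdsWithin : Set.Ioi (0 : ℝ) ∈ _)).exists
  obtain ⟨N, hN⟩ := exists_mem_matAlg_norm_sub_le hA hp (hJ.subset hx) hδ
  obtain ⟨c, hc, hcx⟩ := hN ((N + 1) * p + (p - 1)) (by nlinarith)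
  rw [← C_eq_matAlg hA hp] at hc
  obtain ⟨y, hyJ, hyC, hcy⟩ := QuotAlg.exists_mem_inter_norm_sub_le isClosed_closure hJ.isClosed
    (fun a ha x => hJ.mul_mem_left_closure (C_le_closure_qDAlg hG p _ ha))
    (fun a ha x => hJ.mul_mem_right_closure (C_le_closure_qDAlg hG p _ ha))
    (fun a ha => hJ.mul_mem_left a (hJ.subset ha)) hx hc hδ hcx
  refine ⟨y, Set.mem_iUnion.2 ⟨N, hyJ, hyC⟩, ?_⟩
  have hcy' : ‖c - y‖ < ε / 2 := lt_of_pow_lt_pow_left₀ 2 (half_pos hε).le (hcy.trans_lt hδ_bound)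
  calc dist x y ≤ dist c x + dist c y := dist_triangle_left _ _ _
    _ = ‖c - x‖ + ‖c - y‖ := by rw [dist_eq_norm, dist_eq_norm]
    _ < ε := by linarith

end NoSinks

end IsIdeal

end WeightSequence

namespace WeightSequence

variable {Z : G.WeightSequence} {J : Submodule ℂ G.QuotAlg}

/-! ### Coefficient ideals -/

variable (Z) in
/-- The corner `p_v R` of the coefficient algebra `R` at the vertex `v`. -/
def vertexCoeffs (v : V) : Set G.QuotAlg := {y | y ∈ Z.coeffAlg ∧ G.pv v * y = y}

variable (Z J) in
/-- The coefficient ideal `I_k(v)`: the matrix entries at `v` of the elements of `J` that are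
matrices over the coefficient algebra indexed by the paths of length `k`. -/
def coeffIdeal (k : ℕ) (v : V) : Set G.QuotAlg :=
  {y | y ∈ Z.vertexCoeffs v ∧ ∀ μ : G.Path k, μ.source = v → uPath μ * y * star (uPath μ) ∈ J}

variable (Z) in
/-- The elements of the corner at `v` whose compressions by the edges `g` into `v` lie in
`X (s g)`. -/
def edgePreimage (X : V → Set G.QuotAlg) (v : V) : Set G.QuotAlg :=
  {y | y ∈ Z.vertexCoeffs v ∧ ∀ g, G.r g = v → star (G.u g) * y * G.u g ∈ X (G.s g)}

lemma star_uPath_mul_mem_vertexCoeffs {k : ℕ} {x : G.QuotAlg} (hx : x ∈ Z.matAlg k)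
    (μ ν : G.Path k) : star (uPath μ) * x * uPath ν ∈ Z.vertexCoeffs μ.source :=
  ⟨hx μ ν, by rw [← mul_assoc, ← mul_assoc, pv_mul_star_uPath]⟩

lemma star_u_mul_mem_vertexCoeffs {p : ℕ} (hA : Z.ConditionA p) (hp : 1 ≤ p) {y : G.QuotAlg}
    (hy : y ∈ Z.coeffAlg) (e : Ed) : star (G.u e) * y * G.u e ∈ Z.vertexCoeffs (G.s e) :=
  ⟨star_u_mul_mem_coeffAlg hA hp hy e e, by rw [← mul_assoc, ← mul_assoc, pv_mul_star_u]⟩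

lemma star_uPath_mul_uPath_mul {k : ℕ} (μ : G.Path k) {y : G.QuotAlg}
    (hy : y ∈ Z.vertexCoeffs μ.source) :
    star (uPath μ) * (uPath μ * y * star (uPath μ)) * uPath μ = y := by
  have regroup : star (uPath μ) * (uPath μ * y * star (uPath μ)) * uPath μ =
      (star (uPath μ) * uPath μ) * y * (star (uPath μ) * uPath μ) := by noncomm_ring
  rw [regroup, star_uPath_mul_self, hy.2, mul_pv_of_mem_coeffAlg hy.1, hy.2]

lemma injOn_uPath_mul_mul_star_uPath {k : ℕ} (μ : G.Path k) :
    Set.InjOn (fun y => uPath μ * y * star (uPath μ)) (Z.vertexCoeffs μ.source) :=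
  Set.LeftInvOn.injOn (f₁' := fun x => star (uPath μ) * x * uPath μ)
    fun _ hy => star_uPath_mul_uPath_mul μ hy

lemma zero_mem_coeffIdeal (k : ℕ) (v : V) : (0 : G.QuotAlg) ∈ Z.coeffIdeal J k v :=
  ⟨⟨zero_mem _, mul_zero _⟩, fun μ _ => by simp⟩

lemma mem_coeffIdeal_zero {v : V} {y : G.QuotAlg} :
    y ∈ Z.coeffIdeal J 0 v ↔ y ∈ Z.vertexCoeffs v ∧ y ∈ J := by
  refine and_congr_right fun hy => ?_
  have conj_eq (μ : G.Path 0) (hμ : μ.source = v) : uPath μ * y * star (uPath μ) = y := by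
    rw [uPath_zero, hμ, star_pv, hy.2, mul_pv_of_mem_coeffAlg hy.1, hy.2]
  refine ⟨fun h => ?_, fun h μ hμ => by rwa [conj_eq μ hμ]⟩
  have conj_mem := h (Path.ofVertex v) rfl
  rwa [conj_eq _ rfl] at conj_mem

lemma uPath_snoc_mul_conj {p : ℕ} (hA : Z.ConditionA p) (hp : 1 ≤ p) {y : G.QuotAlg}
    (hy : y ∈ Z.coeffAlg) {k : ℕ} (μ : G.Path k) (g : Ed) (h : μ.source = G.r g) :
    uPath (μ.snoc g h) * (star (G.u g) * y * G.u g) * star (uPath (μ.snoc g h)) =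
      uPath μ * y * (G.u g * star (G.u g)) * star (uPath μ) := by
  calc uPath (μ.snoc g h) * (star (G.u g) * y * G.u g) * star (uPath (μ.snoc g h))
      = uPath μ * (G.u g * (star (G.u g) * y * G.u g)) * star (G.u g) * star (uPath μ) := by
        rw [uPath_snoc, star_mul]; noncomm_ring
    _ = uPath μ * y * (G.u g * star (G.u g)) * star (uPath μ) := by
        rw [← mul_u_of_mem_coeffAlg hA hp hy]; noncomm_ring

lemma uPath_mul_mul_u_of_ne {y : G.QuotAlg} (hy : y ∈ Z.coeffAlg) {k : ℕ} (μ : G.Path k) (g : Ed)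
    (h : μ.source ≠ G.r g) : uPath μ * y * G.u g = 0 := by
  rw [← uPath_mul_pv μ, mul_assoc (uPath μ), ← mul_pv_of_mem_coeffAlg hy, mul_assoc, mul_assoc,
    pv_mul_u_of_ne h, mul_zero, mul_zero]

section restrict

variable {p : ℕ} (hA : Z.ConditionA p) (hp : 1 ≤ p)
include hA hp

lemma mem_restrict_zero_iff {x : G.QuotAlg} :
    x ∈ Z.restrict p J 0 ↔ x ∈ J ∧ x ∈ Z.matAlg (p - 1) := by
  refine and_congr_right fun _ => ?_
  rw [C_eq_matAlg hA hp, zero_mul, zero_add]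

lemma coeffIdeal_sub_one_subset (hG : G.NoSinks)
    (star_uPath_mul_mem : ∀ α β : G.Path (p - 1), ∀ x ∈ Z.restrict p J 0,
      star (uPath α) * x * uPath β ∈ Z.restrict p J 0) (v : V) :
    Z.coeffIdeal J (p - 1) v ⊆ Z.coeffIdeal J 0 v := by
  intro y hy
  obtain ⟨μ, rfl⟩ := Path.exists_source_eq hG (p - 1) v
  refine mem_coeffIdeal_zero.2 ⟨hy.1, ?_⟩
  rw [← star_uPath_mul_uPath_mul μ hy.1]
  exact (star_uPath_mul_mem μ μ _ ((mem_restrict_zero_iff hA hp).2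
    ⟨hy.2 μ rfl, uPath_mul_mem_matAlg hy.1.1 μ μ⟩)).1

lemma coeffIdeal_zero_eq_of_path (hG : G.NoSinks)
    (star_uPath_mul_mem : ∀ α β : G.Path (p - 1), ∀ x ∈ Z.restrict p J 0,
      star (uPath α) * x * uPath β ∈ Z.restrict p J 0)
    (uPath_mul_mem : ∀ (k : ℕ) (α β : G.Path k), ∀ x ∈ Z.restrict p J 0,
      uPath α * x * star (uPath β) ∈ J) :
    Z.coeffIdeal J 0 = Z.coeffIdeal J (p - 1) := by
  funext v
  refine Set.Subset.antisymm (fun y hy => ⟨hy.1, fun μ _ => uPath_mul_mem _ μ μ y ?_⟩)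
    (coeffIdeal_sub_one_subset hA hp hG star_uPath_mul_mem v)
  exact (mem_restrict_zero_iff hA hp).2
    ⟨(mem_coeffIdeal_zero.1 hy).2, coeffAlg_le_matAlg hA hp _ hy.1.1⟩

end restrict

namespace IsIdeal

lemma star_u_mul_mem_restrict_zero (hJ : Z.IsIdeal J) {p : ℕ} (hA : Z.ConditionA p) (hp : 1 ≤ p)
    (hF : Z.FullyInvariant J) (e f : Ed) :
    ∀ x ∈ Z.restrict p J 0, star (G.u e) * x * G.u f ∈ Z.restrict p J 0 := by
  simp only [mem_restrict_zero_iff hA hp]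
  exact fun x hx => ⟨(hJ.fullyInvariant_iff.1 hF).1 e f x hx.1,
    mem_matAlg_succ_iff.1 (matAlg_mono hA hp (p - 1).le_succ hx.2) e f⟩

variable (hJ : Z.IsIdeal J) (hG : G.NoSinks)
include hJ hG

lemma uPath_mul_mul_star_uPath_mem_of_mem {k : ℕ} {y : G.QuotAlg} {μ : G.Path k}
    (hy : y ∈ Z.vertexCoeffs μ.source) (h : uPath μ * y * star (uPath μ) ∈ J) (α β : G.Path k) :
    uPath α * y * star (uPath β) ∈ J := by
  have matrix_units : uPath α * y * star (uPath β) = (uPath α * star (uPath μ)) *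
      (uPath μ * y * star (uPath μ)) * (uPath μ * star (uPath β)) := by
    conv_lhs => rw [← star_uPath_mul_uPath_mul μ hy]
    noncomm_ring
  rw [matrix_units]
  exact hJ.mul_mul_mem (uPath_mul_star_uPath_mem_qD hG _ _) h (uPath_mul_star_uPath_mem_qD hG _ _)

lemma mem_coeffIdeal_of_mem {k : ℕ} {y : G.QuotAlg} {μ : G.Path k}
    (hy : y ∈ Z.vertexCoeffs μ.source) (h : uPath μ * y * star (uPath μ) ∈ J) :
    y ∈ Z.coeffIdeal J k μ.source :=
  ⟨hy, fun α _ => hJ.uPath_mul_mul_star_uPath_mem_of_mem hG hy h α α⟩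

lemma star_uPath_mul_mem_coeffIdeal {k : ℕ} {x : G.QuotAlg} (hx : x ∈ J) (hxk : x ∈ Z.matAlg k)
    (μ ν : G.Path k) : star (uPath μ) * x * uPath ν ∈ Z.coeffIdeal J k μ.source := by
  refine hJ.mem_coeffIdeal_of_mem hG (star_uPath_mul_mem_vertexCoeffs hxk μ ν) ?_
  have regroup : uPath μ * (star (uPath μ) * x * uPath ν) * star (uPath μ) =
      (uPath μ * star (uPath μ)) * x * (uPath ν * star (uPath μ)) := by noncomm_ring
  rw [regroup]
  exact hJ.mul_mul_mem (uPath_mul_star_uPath_mem_qD hG _ _) hx (uPath_mul_star_uPath_mem_qD hG _ _)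

lemma mem_of_forall_mem_coeffIdeal {k : ℕ} {x : G.QuotAlg}
    (h : ∀ μ ν : G.Path k, star (uPath μ) * x * uPath ν ∈ Z.coeffIdeal J k μ.source) : x ∈ J := by
  have hexp := sum_uPath_mul_star_uPath (G := G) k
  rw [eq_sum_entries hexp hexp x]
  exact sum_mem fun μ _ => sum_mem fun ν _ =>
    hJ.uPath_mul_mul_star_uPath_mem_of_mem hG (h μ ν).1 ((h μ ν).2 μ rfl) μ ν

lemma coeffIdeal_eq_of_fullyInvariant (hF : Z.FullyInvariant J) (k : ℕ) :
    Z.coeffIdeal J k = Z.coeffIdeal J 0 := by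
  ext v y
  rw [mem_coeffIdeal_zero]
  refine and_congr_right fun hy => ⟨fun h => ?_, fun h μ _ => hJ.uPath_mul_mem hG hF μ μ h⟩
  obtain ⟨μ, rfl⟩ := Path.exists_source_eq hG k v
  rw [← star_uPath_mul_uPath_mul μ hy]
  exact hJ.star_uPath_mul_mem hG hF μ μ (h μ rfl)

section Constant

variable (coeffIdeal_eq : ∀ k, Z.coeffIdeal J k = Z.coeffIdeal J 0)
include coeffIdeal_eq

lemma star_u_mul_mem_of_coeffIdeal_eq {k : ℕ} {y : G.QuotAlg} (hyJ : y ∈ J)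
    (hy : y ∈ Z.matAlg (k + 1)) (e f : Ed) : star (G.u e) * y * G.u f ∈ J := by
  refine hJ.mem_of_forall_mem_coeffIdeal (k := k) hG fun μ ν => ?_
  have regroup : star (uPath μ) * (star (G.u e) * y * G.u f) * uPath ν =
      star (G.u e * uPath μ) * y * (G.u f * uPath ν) := by rw [star_mul]; noncomm_ring
  rw [regroup]
  by_cases he : G.s e = μ.range
  · by_cases hf : G.s f = ν.range
    · rw [← uPath_cons e μ he, ← uPath_cons f ν hf, coeffIdeal_eq k, ← coeffIdeal_eq (k + 1)]
      exact hJ.star_uPath_mul_mem_coeffIdeal hG hyJ hy (μ.cons e he) (ν.cons f hf)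
    · rw [u_mul_uPath_of_ne hf, mul_zero]
      exact zero_mem_coeffIdeal _ _
  · rw [u_mul_uPath_of_ne he, star_zero, zero_mul, zero_mul]
    exact zero_mem_coeffIdeal _ _

lemma u_mul_mem_of_coeffIdeal_eq {k : ℕ} {y : G.QuotAlg} (hyJ : y ∈ J) (hy : y ∈ Z.matAlg k)
    (e f : Ed) : G.u e * y * star (G.u f) ∈ J := by
  refine hJ.mem_of_forall_mem_coeffIdeal (k := k + 1) hG fun μ ν => ?_
  have regroup : star (uPath μ) * (G.u e * y * star (G.u f)) * uPath ν =
      star (star (G.u e) * G.u μ.head * uPath μ.tail) * y *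
        (star (G.u f) * G.u ν.head * uPath ν.tail) := by
    rw [uPath_succ μ, uPath_succ ν]
    simp only [star_mul, star_star, mul_assoc]
  rw [regroup]
  rcases eq_or_ne e μ.head with rfl | he
  · rcases eq_or_ne f ν.head with rfl | hf
    · rw [star_u_mul_u_self, star_u_mul_u_self, Path.s_head, Path.s_head, pv_mul_uPath,
        pv_mul_uPath, coeffIdeal_eq (k + 1), ← coeffIdeal_eq k]
      exact hJ.star_uPath_mul_mem_coeffIdeal hG hyJ hy μ.tail ν.tail
    · rw [star_u_mul_u_of_ne hf, zero_mul, mul_zero]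
      exact zero_mem_coeffIdeal _ _
  · rw [star_u_mul_u_of_ne he, zero_mul, star_zero, zero_mul, zero_mul]
    exact zero_mem_coeffIdeal _ _

end Constant

section ConditionA

variable {p : ℕ} (hA : Z.ConditionA p) (hp : 1 ≤ p)
include hA hp

lemma map_mem_of_forall_mem_matAlg {f : G.QuotAlg → G.QuotAlg} (hf : Continuous f)
    (h : ∀ k, ∀ y ∈ J, y ∈ Z.matAlg (k + 1) → f y ∈ J) {x : G.QuotAlg} (hx : x ∈ J) :
    f x ∈ J := by
  refine closure_minimal (Set.iUnion_subset fun n y hy => ?_) (hJ.isClosed.preimage hf)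
    (hJ.subset_closure_restrict hG hA hp hx)
  have length_eq : (n + 1) * p + (p - 1) = n * p + 2 * (p - 1) + 1 := by rw [add_mul]; omega
  have hyC := hy.2
  rw [C_eq_matAlg hA hp, length_eq] at hyC
  exact h _ y hy.1 hyC

lemma fullyInvariant_of_coeffIdeal_eq (h : ∀ k, Z.coeffIdeal J k = Z.coeffIdeal J 0) :
    Z.FullyInvariant J :=
  hJ.fullyInvariant_iff.2
    ⟨fun e f _ => hJ.map_mem_of_forall_mem_matAlg hG hA hp (by fun_prop)
      fun _ _ hyJ hy => hJ.star_u_mul_mem_of_coeffIdeal_eq hG h hyJ hy e f,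
    fun e f _ => hJ.map_mem_of_forall_mem_matAlg hG hA hp (by fun_prop)
      fun _ _ hyJ hy => hJ.u_mul_mem_of_coeffIdeal_eq hG h hyJ hy e f⟩

lemma coeffIdeal_eq_edgePreimage (k : ℕ) :
    Z.coeffIdeal J k = Z.edgePreimage (Z.coeffIdeal J (k + 1)) := by
  ext v y
  refine and_congr_right fun hy => ⟨fun h g hg => ?_, fun h μ hμ => ?_⟩
  · obtain ⟨μ, hμ⟩ := Path.exists_source_eq hG k v
    have hy' : y ∈ Z.vertexCoeffs μ.source := hμ ▸ hy
    let μg := μ.snoc g (hμ.trans hg.symm)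
    refine hJ.mem_coeffIdeal_of_mem hG (μ := μg) (star_u_mul_mem_vertexCoeffs hA hp hy.1 g) ?_
    have compress : uPath μ * y * (G.u g * star (G.u g)) * star (uPath μ) =
        (uPath μ * y * star (uPath μ)) * (uPath μg * star (uPath μg)) := by
      calc uPath μ * y * (G.u g * star (G.u g)) * star (uPath μ)
          = uPath μ * (y * (star (uPath μ) * uPath μ)) * (G.u g * star (G.u g)) *
              star (uPath μ) := by
            rw [star_uPath_mul_self, mul_pv_of_mem_coeffAlg hy.1, hy'.2]
        _ = _ := by rw [uPath_snoc, star_mul]; noncomm_ring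
    rw [uPath_snoc_mul_conj hA hp hy.1, compress]
    exact hJ.mul_mem_right _ (uPath_mul_star_uPath_mem_qD hG _ _) _ (h μ hμ)
  · have sum_edges : uPath μ * y * star (uPath μ) =
        ∑ g, uPath μ * y * (G.u g * star (G.u g)) * star (uPath μ) := by
      rw [← Finset.sum_mul, ← Finset.mul_sum, sum_u_mul_star_u, mul_one]
    rw [sum_edges]
    refine sum_mem fun g _ => ?_
    by_cases hg : μ.source = G.r g
    · rw [← uPath_snoc_mul_conj hA hp hy.1 μ g hg]
      exact (h g (hg.symm.trans hμ)).2 _ rfl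
    · rw [← mul_assoc (uPath μ * y), uPath_mul_mul_u_of_ne hy.1 μ g hg, zero_mul, zero_mul]
      exact zero_mem J

lemma coeffIdeal_eq_iterate (k m : ℕ) :
    Z.coeffIdeal J k = Z.edgePreimage^[m] (Z.coeffIdeal J (k + m)) := by
  induction m with
  | zero => rfl
  | succ m ih =>
    rw [ih, hJ.coeffIdeal_eq_edgePreimage hG hA hp (k + m), Function.iterate_succ_apply, add_assoc]

lemma corner_eq_image {k : ℕ} (ξ : V → G.Path k) (n : ℕ) (v : V) :
    Z.corner p J ξ n v = (fun y => uPath (ξ v) * y * star (uPath (ξ v))) ''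
      Z.coeffIdeal J (n * p + (p - 1)) v := by
  ext x
  constructor
  · rintro ⟨μ, ν, rfl, -, y, ⟨hyJ, hyC⟩, rfl⟩
    rw [C_eq_matAlg hA hp] at hyC
    refine ⟨_, hJ.star_uPath_mul_mem_coeffIdeal hG hyJ hyC μ ν, ?_⟩
    simp only [mul_assoc]
  · rintro ⟨y, hy, rfl⟩
    obtain ⟨μ, rfl⟩ := Path.exists_source_eq hG (n * p + (p - 1)) v
    refine ⟨μ, μ, rfl, rfl, uPath μ * y * star (uPath μ), ⟨hy.2 μ rfl, ?_⟩, ?_⟩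
    · rw [C_eq_matAlg hA hp]
      exact uPath_mul_mem_matAlg hy.1.1 μ μ
    · beta_reduce
      conv_lhs => rw [← star_uPath_mul_uPath_mul μ hy.1]
      noncomm_ring

lemma corner_eq_corner_iff {k : ℕ} {ξ : V → G.Path k} (hξ : ∀ v, (ξ v).source = v) :
    (∀ (v : V) (n : ℕ), Z.corner p J ξ 0 v = Z.corner p J ξ n v) ↔
      ∀ n, Z.coeffIdeal J (n * p + (p - 1)) = Z.coeffIdeal J (p - 1) := by
  have corner_eq_iff (v : V) (n : ℕ) : Z.corner p J ξ 0 v = Z.corner p J ξ n v ↔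
      Z.coeffIdeal J (n * p + (p - 1)) v = Z.coeffIdeal J (p - 1) v := by
    rw [hJ.corner_eq_image hG hA hp, hJ.corner_eq_image hG hA hp, zero_mul, zero_add, eq_comm]
    have injOn := injOn_uPath_mul_mul_star_uPath (Z := Z) (ξ v)
    rw [hξ] at injOn
    exact injOn.image_eq_image_iff (fun _ hy => hy.1) fun _ hy => hy.1
  simp only [corner_eq_iff, funext_iff]
  exact forall_comm

lemma edgePreimage_coeffIdeal_zero
    (periodic : ∀ n, Z.coeffIdeal J (n * p + (p - 1)) = Z.coeffIdeal J (p - 1)) :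
    Z.edgePreimage (Z.coeffIdeal J 0) = Z.coeffIdeal J (p - 1) := by
  have iterate_eq := hJ.coeffIdeal_eq_iterate hG hA hp
  have length_eq : p - 1 + (p - 1 + 1) = 1 * p + (p - 1) := by omega
  calc Z.edgePreimage (Z.coeffIdeal J 0)
      = Z.edgePreimage^[p - 1 + 1] (Z.coeffIdeal J (p - 1)) := by
        rw [Function.iterate_succ_apply', iterate_eq 0 (p - 1), zero_add]
    _ = Z.edgePreimage^[p - 1 + 1] (Z.coeffIdeal J (p - 1 + (p - 1 + 1))) := by
        rw [length_eq, periodic]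
    _ = Z.coeffIdeal J (p - 1) := (iterate_eq _ _).symm

lemma coeffIdeal_eq_of_eq
    (periodic : ∀ n, Z.coeffIdeal J (n * p + (p - 1)) = Z.coeffIdeal J (p - 1))
    (h : Z.coeffIdeal J 0 = Z.coeffIdeal J (p - 1)) (k : ℕ) :
    Z.coeffIdeal J k = Z.coeffIdeal J 0 := by
  have fixed : Z.edgePreimage (Z.coeffIdeal J 0) = Z.coeffIdeal J 0 := by
    rw [hJ.edgePreimage_coeffIdeal_zero hG hA hp periodic, h]
  have hk : k ≤ k * p + (p - 1) := (Nat.le_mul_of_pos_right _ hp).trans (Nat.le_add_right _ _)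
  rw [hJ.coeffIdeal_eq_iterate hG hA hp k (k * p + (p - 1) - k), Nat.add_sub_cancel' hk, periodic,
    ← h, Function.iterate_fixed fixed]

lemma star_uPath_mul_mem_restrict_zero (hF : Z.FullyInvariant J) (α β : G.Path (p - 1)) :
    ∀ x ∈ Z.restrict p J 0, star (uPath α) * x * uPath β ∈ Z.restrict p J 0 := by
  simp only [mem_restrict_zero_iff hA hp]
  exact fun x hx =>
    ⟨hJ.star_uPath_mul_mem hG hF α β hx.1, coeffAlg_le_matAlg hA hp _ (hx.2 α β)⟩

lemma coeffIdeal_zero_eq_of_edge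
    (periodic : ∀ n, Z.coeffIdeal J (n * p + (p - 1)) = Z.coeffIdeal J (p - 1))
    (star_u_mul_mem : ∀ e f, ∀ x ∈ Z.restrict p J 0,
      star (G.u e) * x * G.u f ∈ Z.restrict p J 0) :
    Z.coeffIdeal J 0 = Z.coeffIdeal J (p - 1) := by
  have pv_mul_mem (v w : V) : ∀ x ∈ Z.restrict p J 0, G.pv v * x * G.pv w ∈ Z.restrict p J 0 := by
    simp only [mem_restrict_zero_iff hA hp]
    exact fun x hx => ⟨hJ.pv_mul_mul_pv_mem hG v w x hx.1,
      mul_mem (mul_mem (coeffAlg_le_matAlg hA hp _ (Z.pv_mem_coeffAlg v)) hx.2)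
        (coeffAlg_le_matAlg hA hp _ (Z.pv_mem_coeffAlg w))⟩
  funext v
  refine Set.Subset.antisymm (fun y hy => ?_) (coeffIdeal_sub_one_subset hA hp hG
    (fun α β _ => star_uPath_mul_mul_uPath_mem pv_mul_mem star_u_mul_mem α β) v)
  rw [← hJ.edgePreimage_coeffIdeal_zero hG hA hp periodic]
  refine ⟨hy.1, fun g _ => mem_coeffIdeal_zero.2
    ⟨star_u_mul_mem_vertexCoeffs hA hp hy.1.1 g, (star_u_mul_mem g g y ?_).1⟩⟩
  exact (mem_restrict_zero_iff hA hp).2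
    ⟨(mem_coeffIdeal_zero.1 hy).2, coeffAlg_le_matAlg hA hp _ hy.1.1⟩

end ConditionA

end IsIdeal

end WeightSequence

end DirGraph

end

theorem mainTheorem5_general {V Ed : Type*} [Fintype V] [Fintype Ed] (G : DirGraph V Ed)
    (hsinks : G.NoSinks) (Z : G.WeightSequence) (p : ℕ) (hp : 1 ≤ p) (hA : Z.ConditionA p)
    (ξ : V → G.Path (p - 1)) (hξ : ∀ v, (ξ v).source = v)
    (J : Submodule ℂ G.QuotAlg) (hJ : Z.IsIdeal J) :
    (Z.FullyInvariant J ↔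
      (∀ (v : V) (n : ℕ), Z.corner p J ξ 0 v = Z.corner p J ξ n v) ∧
      (∀ α β : G.Path (p - 1), ∀ x ∈ Z.restrict p J 0,
        star (DirGraph.uPath α) * x * DirGraph.uPath β ∈ Z.restrict p J 0) ∧
      (∀ (k : ℕ) (α β : G.Path k), ∀ x ∈ Z.restrict p J 0,
        DirGraph.uPath α * x * star (DirGraph.uPath β) ∈ J)) ∧
    (Z.FullyInvariant J ↔
      (∀ (v : V) (n : ℕ), Z.corner p J ξ 0 v = Z.corner p J ξ n v) ∧
      (∀ e f : Ed, ∀ x ∈ Z.restrict p J 0,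
        star (G.u e) * x * G.u f ∈ Z.restrict p J 0)) := by
  have periodic_of_fullyInvariant (hF : Z.FullyInvariant J) (n : ℕ) :
      Z.coeffIdeal J (n * p + (p - 1)) = Z.coeffIdeal J (p - 1) := by
    rw [hJ.coeffIdeal_eq_of_fullyInvariant hsinks hF,
      hJ.coeffIdeal_eq_of_fullyInvariant hsinks hF (p - 1)]
  rw [hJ.corner_eq_corner_iff hsinks hA hp hξ]
  refine ⟨⟨fun hF => ⟨periodic_of_fullyInvariant hF, ?_, ?_⟩,
    fun ⟨periodic, hstar, hmul⟩ => ?_⟩, ⟨fun hF => ⟨periodic_of_fullyInvariant hF, ?_⟩,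
    fun ⟨periodic, hedge⟩ => ?_⟩⟩
  · exact hJ.star_uPath_mul_mem_restrict_zero hsinks hA hp hF
  · exact fun k α β x hx => hJ.uPath_mul_mem hsinks hF α β hx.1
  · exact hJ.fullyInvariant_of_coeffIdeal_eq hsinks hA hp (hJ.coeffIdeal_eq_of_eq hsinks hA hp
      periodic (DirGraph.WeightSequence.coeffIdeal_zero_eq_of_path hA hp hsinks hstar hmul))
  · exact hJ.star_u_mul_mem_restrict_zero hA hp hF
  · exact hJ.fullyInvariant_of_coeffIdeal_eq hsinks hA hp (hJ.coeffIdeal_eq_of_eq hsinks hA hp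
      periodic (hJ.coeffIdeal_zero_eq_of_edge hsinks hA hp periodic hedge))

theorem mainTheorem5 {V Ed : Type*} [Fintype V] [Fintype Ed] (G : DirGraph V Ed)
    (hsinks : G.NoSinks) (hsources : G.NoSources)
    (Z : G.WeightSequence) (p : ℕ) (hp : 1 ≤ p) (hA : Z.ConditionA p)
    (ξ : V → G.Path (p - 1)) (hξ : ∀ v, (ξ v).source = v)
    (J : Submodule ℂ G.QuotAlg) (hJ : Z.IsIdeal J) :
    (Z.FullyInvariant J ↔
      (∀ (v : V) (n : ℕ), Z.corner p J ξ 0 v = Z.corner p J ξ n v) ∧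
      (∀ α β : G.Path (p - 1), ∀ x ∈ Z.restrict p J 0,
        star (DirGraph.uPath α) * x * DirGraph.uPath β ∈ Z.restrict p J 0) ∧
      (∀ (k : ℕ) (α β : G.Path k), ∀ x ∈ Z.restrict p J 0,
        DirGraph.uPath α * x * star (DirGraph.uPath β) ∈ J)) ∧
    (Z.FullyInvariant J ↔
      (∀ (v : V) (n : ℕ), Z.corner p J ξ 0 v = Z.corner p J ξ n v) ∧
      (∀ e f : Ed, ∀ x ∈ Z.restrict p J 0,
        star (G.u e) * x * G.u f ∈ Z.restrict p J 0)) :=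
  mainTheorem5_general G hsinks Z p hp hA ξ hξ J hJ
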